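/- Let $N\ge 1$, $I=[a,b]$ with $a<b$, and let $G\colon\mathbb R^N\to[0,\infty)$ be a $C^1$ G-function, i.e. $G$ is convex, even, $G(0)=0$ and $G(x)/|x|\to\infty$ as $|x|\to\infty$. Assume that $G$ satisfies $\Delta_2$ and $\nabla_2$ globally: there are $K_1>0$, $K_2>1$ with $G(2x)\le K_1G(x)$ and $G(x)\le \frac1{2K_2}G(K_2x)$ for all $x\in\mathbb R^N$. Let $G^*(y)=\sup_x(\langle x,y\rangle-G(x))$ and $$p_G=\inf_{x\ne0}\frac{\langle x,\nabla G(x)\rangle}{G(x)},\qquad q_G=\sup_{x\ne0}\frac{\langle x,\nabla G(x)\rangle}{G(x)}.$$ For $H\in\{G,G^*\}$ let $L^H$ be the set of measurable $u\colon I\to\mathbb R^N$ with $\int_I H(u)\,dt<\infty$, with the Luxemburg norm $\|u\|_{L^H}=\inf\{\lambda>0:\int_I H(u/\lambda)\,dt\le1\}$. Let $W^1_0L^G$ be the space of absolutely continuous $u\colon I\to\mathbb R^N$ with $u,\dot u\in L^G$ and $u(a)=u(b)=0$, normed by $\|\dot u\|_{L^G}$, and let $C_{\infty,G}>0$ be a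 constant of its embedding into $L^\infty$: $\|u\|_{L^\infty}\le C_{\infty,G}\|\dot u\|_{L^G}$ for all $u\in W^1_0L^G$. Let $F\colon I\times\mathbb R^N\times\mathbb R^N\to\mathbb R$ and $V\colon I\times\mathbb R^N\to\mathbb R$ be of class $C^1$ and let $f\in L^{G^*}$. Assume that for all $t\in I$ and $x,v\in\mathbb R^N$: * $F(t,x,\cdot)$ is convex; * for some continuous $\alpha\colon[0,\infty)\to[0,\infty)$ and some integrable $\beta\colon I\to[0,\infty)$ (independent of $t,x,v$): $|F(t,x,v)|\le\alpha(|x|)(\beta(t)+G(v))$, $|F_x(t,x,v)|\le\alpha(|x|)(\beta(t)+G(v))$ and $G^*(F_v(t,x,v))\le\alpha(|x|)(\beta(t)+G^*(\nabla G(v)))$; * $\langle F_x(t,x,v),x\rangle+\langle F_v(t,x,v),v\rangle\le\theta_F F(t,x,v)$, where $\theta_F>0$ is a constant; * $F(t,x,v)\ge\Lambda G(v)$, where $\Lambda>0$ is a constant, and $F(t,x,0)=0$; * $\langle\nabla_xV(t,x),x\rangle\le\theta_VV(t,x)$ and $V(t,x)<0$ whenever $|x|\ge r_0$, where $\theta_V>1$,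 $\theta_V>\theta_F$ and $r_0>0$ are constants; * $\int_IV(t,0)\,dt=0$; * $V(t,x)\ge-g(t)$ whenever $|x|\le\rho_0$, where $\rho_0>0$ is a constant and $g\in L^1(I,\mathbb R)$. If $$\int_I g(t)\,dt+2|I|\,\|f\|_{L^{G^*}}\frac{\rho_0}{C_{\infty,G}}<\Lambda\begin{cases}\left(\rho_0/C_{\infty,G}\right)^{q_G},&\rho_0\le C_{\infty,G},\\ \left(\rho_0/C_{\infty,G}\right)^{p_G},&\rho_0>C_{\infty,G},\end{cases}$$ then, with $\mathcal L(t,x,v)=F(t,x,v)+V(t,x)+\langle f(t),x\rangle$, the problem $$\frac{d}{dt}\mathcal L_v(t,u(t),\dot u(t))=\mathcal L_x(t,u(t),\dot u(t))\ \text{ for a.e. }t\in I,\qquad u(a)=u(b)=0,$$ has at least one solution $u\in W^1_0L^G$ with $u\not\equiv0$. Here the equation means that $t\mapsto\mathcal L_v(t,u(t),\dot u(t))$ coincides a.e. with an absolutely continuous function whose derivative equals $\mathcal L_x(t,u(t),\dot u(t))$ a.e. -/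

import Mathlib

open MeasureTheory Set Filter Topology

noncomputable section

namespace AnisoMP

/-- The Euclidean space `ℝ^N`. -/
abbrev Euc (N : ℕ) : Type := EuclideanSpace ℝ (Fin N)

variable {N : ℕ}

/-- A continuously differentiable G-function: convex, even, vanishing at the origin,
nonnegative and superlinear at infinity. -/
structure IsGFunction (G : Euc N → ℝ) : Prop where
  contDiff : ContDiff ℝ 1 G
  nonneg : ∀ x, 0 ≤ G x
  convex : ConvexOn ℝ univ G
  even : ∀ x, G (-x) = G x
  zero : G 0 = 0
  superlinear : Tendsto (fun x => G x / ‖x‖) (Bornology.cobounded (Euc N)) atTop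

/-- The `Δ₂` condition, globally. -/
def Delta2 (G : Euc N → ℝ) : Prop :=
  ∃ K : ℝ, 0 < K ∧ ∀ x, G ((2 : ℝ) • x) ≤ K * G x

/-- The `∇₂` condition, globally. -/
def Nabla2 (G : Euc N → ℝ) : Prop :=
  ∃ K : ℝ, 1 < K ∧ ∀ x, G x ≤ 1 / (2 * K) * G (K • x)

/-- The convex conjugate `G*(y) = sup_x (⟨x, y⟩ - G x)`. The supremum is finite for every `y`
when `G` is a G-function. -/
def conj (G : Euc N → ℝ) (y : Euc N) : ℝ :=
  ⨆ x : Euc N, (inner ℝ x y - G x)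

/-- The lower Simonenko index. -/
def pIndex (G : Euc N → ℝ) : ℝ :=
  ⨅ x : {x : Euc N // x ≠ 0}, inner ℝ (x : Euc N) (gradient G x) / G x

/-- The upper Simonenko index. -/
def qIndex (G : Euc N → ℝ) : ℝ :=
  ⨆ x : {x : Euc N // x ≠ 0}, inner ℝ (x : Euc N) (gradient G x) / G x

/-- The modular `∫_I G(u) dt`, `I = [a, b]`, with values in `[0, ∞]`. -/
def modular (G : Euc N → ℝ) (a b : ℝ) (u : ℝ → Euc N) : ENNReal :=
  ∫⁻ t in Icc a b, ENNReal.ofReal (G (u t))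

/-- Membership in the Orlicz space (class) `L^G([a, b], ℝ^N)`. -/
def MemOrlicz (G : Euc N → ℝ) (a b : ℝ) (u : ℝ → Euc N) : Prop :=
  AEStronglyMeasurable u (volume.restrict (Icc a b)) ∧ modular G a b u < ⊤

/-- The Luxemburg norm on `L^G([a, b], ℝ^N)`. -/
def luxNorm (G : Euc N → ℝ) (a b : ℝ) (u : ℝ → Euc N) : ℝ :=
  sInf {r : ℝ | 0 < r ∧ modular G a b (fun t => r⁻¹ • u t) ≤ 1}

/-- Membership in the Orlicz-Sobolev space `W^1 L^G([a, b], ℝ^N)`, through the absolutely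
continuous representative and its almost everywhere defined derivative. -/
def MemW (G : Euc N → ℝ) (a b : ℝ) (u : ℝ → Euc N) : Prop :=
  AbsolutelyContinuousOnInterval u a b ∧ MemOrlicz G a b u ∧ MemOrlicz G a b (deriv u)

/-- Membership in `W^1_0 L^G([a, b], ℝ^N)`; this space is normed by `‖u'‖_{L^G}`. -/
def MemW0 (G : Euc N → ℝ) (a b : ℝ) (u : ℝ → Euc N) : Prop :=
  MemW G a b u ∧ u a = 0 ∧ u b = 0

/-- `C` is a constant of the embedding into `L^∞`:
`‖u‖_∞ ≤ C ‖u'‖_{L^G}` for all `u` in `W^1_0 L^G`. -/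
def IsEmbeddingConstant (G : Euc N → ℝ) (a b C : ℝ) : Prop :=
  0 < C ∧ ∀ u : ℝ → Euc N, MemW0 G a b u → ∀ t ∈ Icc a b, ‖u t‖ ≤ C * luxNorm G a b (deriv u)

/-- The Lagrangian `L(t, x, v) = F(t, x, v) + V(t, x) + ⟨f(t), x⟩`. -/
def lagrangian (F : ℝ → Euc N → Euc N → ℝ) (V : ℝ → Euc N → ℝ) (f : ℝ → Euc N)
    (t : ℝ) (x v : Euc N) : ℝ :=
  F t x v + V t x + inner ℝ (f t) x

/-- `u` solves `d/dt L_v(t, u, u') = L_x(t, u, u')` for a.e. `t ∈ [a, b]`, `u(a) = u(b) = 0`,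
in `W^1_0 L^G`: the momentum `t ↦ L_v(t, u(t), u'(t))` agrees almost everywhere with an absolutely
continuous function `p`, and `p' = L_x(t, u, u')` almost everywhere. -/
def IsSolution (G : Euc N → ℝ) (L : ℝ → Euc N → Euc N → ℝ) (a b : ℝ) (u : ℝ → Euc N) : Prop :=
  MemW0 G a b u ∧ ∃ p : ℝ → Euc N, AbsolutelyContinuousOnInterval p a b ∧
    (∀ᵐ t ∂volume.restrict (Icc a b), p t = gradient (fun v => L t (u t) v) (deriv u t)) ∧
    ∀ᵐ t ∂volume.restrict (Icc a b),
      HasDerivAt p (gradient (fun x => L t x (deriv u t)) (u t)) t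

end AnisoMP

end

/-! The action J(v) = ∫ F(t,u,v) + V(t,u) + ⟨f,u⟩, where u is the primitive of a zero-mean velocity
v, has a mountain pass at the origin, where J = 0. Put r = ρ₀/C. If ∫ G(v/r) = 1 then |u| ≤ ρ₀, so V
≥ -g along u. Comparing G(v) with G(v/r) through the Simonenko indices bounds ∫ F below by Λ r^q
(for r ≤ 1) or Λ r^p (for r > 1). A Hölder and a Poincaré inequality bound the force by 2|I| ‖f‖ r.
The assumed strict inequality is what makes J ≥ c₀ > 0 on this set (`IsAdmissible.exists_barrier`).
Along a suitable ray F grows at most like s^θF while V falls at least like -s^θV, so J is eventually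
negative (`IsAdmissible.exists_action_nonpos`). The Ambrosetti-Rabinowitz combination J(v) - θV⁻¹
J'(v)v controls the modular ∫ G(v) (`IsAdmissible.exists_modular_le`).

The critical point is obtained by a Galerkin scheme. On finite-dimensional spaces of continuous
zero-mean velocities `mountainPass` gives critical points v_n at levels between c₀ and c₁, with
modulars bounded independently of n. Superlinearity of G makes the primitives equicontinuous, so a
subsequence converges uniformly to some u. Jensen's inequality for difference quotients and Fatou's
lemma show that u' has finite modular.

The velocities converge only weakly, so the nonlinear terms need an argument; convexity in v
supplies it. Testing the Galerkin equation with z - v_n, for z close to u', gives an upper bound for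
the energies, and tangent minorants give a lower bound, so the energies converge. Then the convexity
defect of v_n relative to z is small in L¹, and coercivity makes the modulars G(v_n) asymptotically
equi-integrable (`IsGalerkinSequence.eventually_tail_le`). With this the limit is taken in an
inequality for energy increments rather than in the equation itself: every test direction has
directional derivative at most 0 at u, and replacing the direction by its opposite gives 0.

Density extends this to all continuous zero-mean velocities, and the du Bois-Reymond lemma turns it
into the Euler-Lagrange equation. The lower level c₀ survives the limit, whereas the zero curve has
action 0, so u is not zero. The Lagrangian is continued by constants in time outside [a, b], so that
all auxiliary estimates hold for every real t. -/

noncomputable section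

namespace AnisoMP

variable {N : ℕ}

/-! ### Ekeland's principle and the mountain pass theorem in finite dimension -/

/-- Ekeland's variational principle in its weak form. -/
theorem ekeland {X : Type*} [MetricSpace X] [CompleteSpace X] {Φ : X → ℝ}
    (hΦ : LowerSemicontinuous Φ) {m : ℝ} (hm : ∀ x, m ≤ Φ x) {ε : ℝ} (hε : 0 < ε) (x₀ : X) :
    ∃ x, Φ x ≤ Φ x₀ ∧ ∀ y, Φ x - ε * dist x y ≤ Φ y := by
  -- `y ∈ S x` says that `y` improves on `x` by at least `ε` times the distance. The relation is
  -- transitive by the triangle inequality, so these sets are nested along any sequence that follows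
  -- it.
  let S : X → Set X := fun x => {y | Φ y + ε * dist x y ≤ Φ x}
  have hself : ∀ x, x ∈ S x := fun x => by simp [S]
  have hsub : ∀ {x y}, y ∈ S x → S y ⊆ S x := by
    intro x y hy z hz
    simp only [S, mem_ofPred_eq] at hy hz ⊢
    have := mul_le_mul_of_nonneg_left (dist_triangle x y z) hε.le
    linarith
  have hclosed : ∀ x, IsClosed (S x) := by
    intro x
    have : LowerSemicontinuous (fun y => Φ y + ε * dist x y) :=
      hΦ.add (Continuous.lowerSemicontinuous (by fun_prop))
    exact this.isClosed_preimage (Φ x)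
  -- Each new point nearly minimises `Φ` over the current set. A further improvement by more than
  -- `(1/2)^n` is then impossible, which bounds the radius of the next set by `ε⁻¹ * (1/2)^n`.
  have hstep : ∀ (n : ℕ) (x : X), ∃ y ∈ S x, ∀ z ∈ S x, Φ y ≤ Φ z + (1 / 2 : ℝ) ^ n := by
    intro n x
    have hne : (Φ '' S x).Nonempty := ⟨_, mem_image_of_mem _ (hself x)⟩
    have hbd : BddBelow (Φ '' S x) := ⟨m, by rintro _ ⟨y, -, rfl⟩; exact hm y⟩
    obtain ⟨_, ⟨y, hy, rfl⟩, hlt⟩ :=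
      exists_lt_of_csInf_lt hne (lt_add_of_pos_right (sInf (Φ '' S x))
        (by positivity : (0 : ℝ) < (1 / 2) ^ n))
    refine ⟨y, hy, fun z hz => ?_⟩
    have := csInf_le hbd (mem_image_of_mem Φ hz)
    linarith
  choose nxt hnxt₁ hnxt₂ using hstep
  let x : ℕ → X := fun n => Nat.rec x₀ (fun k y => nxt k y) n
  have hxs : ∀ n, x (n + 1) ∈ S (x n) := fun n => hnxt₁ n (x n)
  have hanti : Antitone (fun n => S (x n)) := antitone_nat_of_succ_le fun n => hsub (hxs n)
  have hdist : ∀ n, ∀ y ∈ S (x (n + 1)), dist (x (n + 1)) y ≤ ε⁻¹ * (1 / 2 : ℝ) ^ n := by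
    intro n y hy
    have h1 := hnxt₂ n (x n) y (hsub (hxs n) hy)
    have h2 : Φ y + ε * dist (x (n + 1)) y ≤ Φ (x (n + 1)) := hy
    have h3 : Φ (x (n + 1)) ≤ Φ y + (1 / 2 : ℝ) ^ n := h1
    rw [inv_mul_eq_div, le_div_iff₀ hε]
    linarith
  have hlim0 : Tendsto (fun n : ℕ => ε⁻¹ * (1 / 2 : ℝ) ^ n) atTop (𝓝 0) := by
    simpa using (tendsto_pow_atTop_nhds_zero_of_lt_one (by norm_num : (0 : ℝ) ≤ 1 / 2)
      (by norm_num)).const_mul ε⁻¹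
  have hcau : CauchySeq (fun n => x (n + 1)) := by
    refine cauchySeq_of_le_tendsto_0' _ (fun n k hnk => ?_) hlim0
    exact hdist n _ (hanti (Nat.succ_le_succ hnk) (hself _))
  obtain ⟨l, hl⟩ := cauchySeq_tendsto_of_complete hcau
  have hlS : ∀ n, l ∈ S (x n) := by
    intro n
    refine (hclosed (x n)).mem_of_tendsto hl ?_
    filter_upwards [eventually_ge_atTop n] with k hk
    exact hanti (Nat.le_succ_of_le hk) (hself _)
  refine ⟨l, ?_, fun y => ?_⟩
  · have : Φ l + ε * dist x₀ l ≤ Φ x₀ := hlS 0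
    have := mul_nonneg hε.le (dist_nonneg (x := x₀) (y := l))
    linarith
  -- A violating `y` lies in `S l`, hence in all the shrinking sets, so the sequence converges to
  -- `y` as well as to `l`; but `y = l` does not violate the inequality.
  · by_contra! hlt
    have hy : y ∈ S l := by simp only [S, mem_ofPred_eq]; linarith
    have hyl : Tendsto (fun n => x (n + 1)) atTop (𝓝 y) := by
      rw [tendsto_iff_dist_tendsto_zero]
      exact squeeze_zero (fun _ => dist_nonneg) (fun n => hdist n y (hsub (hlS (n + 1)) hy)) hlim0
    obtain rfl := tendsto_nhds_unique hl hyl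
    simp at hlt

/-- The mean value theorem along a segment, for a function differentiable along lines. -/
theorem exists_mean_value_line {E : Type*} [AddCommGroup E] [Module ℝ E]
    {J : E → ℝ} {D : E → E → ℝ}
    (hJ : ∀ x h, HasDerivAt (fun s : ℝ => J (x + s • h)) (D x h) 0) (x h : E) {τ : ℝ}
    (hτ : 0 < τ) : ∃ ξ ∈ Ioo 0 τ, J (x + τ • h) - J x = τ * D (x + ξ • h) h := by
  have hd : ∀ s : ℝ, HasDerivAt (fun s : ℝ => J (x + s • h)) (D (x + s • h) h) s := by
    intro s
    have h1 := hJ (x + s • h) h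
    have h2 : HasDerivAt (fun r : ℝ => r - s) 1 s := (hasDerivAt_id s).sub_const s
    have h3 := HasDerivAt.comp (h₂ := fun r : ℝ => J (x + s • h + r • h)) s
      (by simpa using h1) h2
    simp only [mul_one] at h3
    refine h3.congr_of_eventuallyEq (Eventually.of_forall fun r => ?_)
    simp only [Function.comp]
    congr 1
    module
  obtain ⟨ξ, hξ, h⟩ := exists_hasDerivAt_eq_slope (fun s : ℝ => J (x + s • h))
    (fun s => D (x + s • h) h) hτ (fun s _ => (hd s).continuousAt.continuousWithinAt)
    (fun s _ => hd s)
  refine ⟨ξ, hξ, ?_⟩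
  simp only [zero_smul, add_zero, sub_zero] at h
  rw [h]
  field_simp

/-- Existence of almost critical points at a mountain pass, in a Euclidean space. -/
theorem mountainPass_almost_critical {E : Type*} [NormedAddCommGroup E] [InnerProductSpace ℝ E]
    [CompleteSpace E] {J : E → ℝ} {g : E → E} (hJc : Continuous J) (hg : Continuous g)
    (hJ : ∀ x h, HasDerivAt (fun s : ℝ => J (x + s • h)) (inner ℝ (g x) h) 0)
    {e : E} {c₀ c₁ : ℝ} (h0 : J 0 ≤ 0) (he : J e ≤ 0)
    (hbar : ∀ γ : C(unitInterval, E), γ 0 = 0 → γ 1 = e → ∃ s, c₀ ≤ J (γ s))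
    (hc₁ : ∀ s ∈ Icc (0 : ℝ) 1, J (s • e) ≤ c₁) {ε σ : ℝ} (hε : 0 < ε) (hσ : 0 < σ)
    (hσc : σ < c₀) : ∃ x, c₀ - σ ≤ J x ∧ J x ≤ c₁ ∧ ‖g x‖ ≤ 2 * ε := by
  -- The paths from `0` to `e` form a complete metric space in the uniform distance. Ekeland's
  -- principle is applied there to the maximum of `J` along a path, starting from the straight
  -- segment, whose maximum is at most `c₁`.
  let Γ : Set C(unitInterval, E) := {γ | γ 0 = 0 ∧ γ 1 = e}
  have hΓ : IsClosed Γ := by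
    refine IsClosed.inter ?_ ?_
    · exact isClosed_eq (continuous_eval_const 0) continuous_const
    · exact isClosed_eq (continuous_eval_const 1) continuous_const
  have : CompleteSpace Γ := hΓ.completeSpace_coe
  let Φ : Γ → ℝ := fun γ => ⨆ s, J (γ.1 s)
  have hbdd : ∀ γ : Γ, BddAbove (range fun s => J (γ.1 s)) := fun γ =>
    (isCompact_range (hJc.comp γ.1.continuous)).bddAbove
  have hle : ∀ (γ : Γ) s, J (γ.1 s) ≤ Φ γ := fun γ s => le_ciSup (hbdd γ) s
  have hlsc : LowerSemicontinuous Φ := by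
    refine lowerSemicontinuous_ciSup hbdd fun s => Continuous.lowerSemicontinuous ?_
    exact hJc.comp ((continuous_eval_const s).comp continuous_subtype_val)
  have hlow : ∀ γ, c₀ ≤ Φ γ := fun γ => by
    obtain ⟨s, hs⟩ := hbar γ.1 γ.2.1 γ.2.2
    exact hs.trans (hle γ s)
  let γ₀ : Γ := ⟨⟨fun s => (s : ℝ) • e, by fun_prop⟩, by simp [Γ]⟩
  obtain ⟨γ, hγ₁, hγ₂⟩ := ekeland hlsc hlow hε γ₀
  have hΦc₁ : Φ γ ≤ c₁ := hγ₁.trans (ciSup_le fun s => hc₁ s s.2)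
  by_contra! hcon
  have hcrit : ∀ s, Φ γ - σ ≤ J (γ.1 s) → 2 * ε < ‖g (γ.1 s)‖ := fun s hs =>
    hcon _ (by linarith [hlow γ]) ((hle γ s).trans hΦc₁)
  -- The cutoff vanishes below `Φ γ - σ` and equals `1` above `Φ γ - σ / 2`. Only the top of the
  -- path is deformed.
  let χ : ℝ → ℝ := fun r => max 0 (min 1 ((r - (Φ γ - σ)) * (2 / σ)))
  have hχ0 : ∀ r, 0 ≤ χ r := fun r => le_max_left _ _
  have hχ1 : ∀ r, χ r ≤ 1 := fun r => max_le zero_le_one (min_le_left _ _)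
  have hχz : ∀ r, r ≤ Φ γ - σ → χ r = 0 := fun r hr =>
    max_eq_left ((min_le_right _ _).trans
      (mul_nonpos_of_nonpos_of_nonneg (by linarith) (by positivity)))
  have hχo : ∀ r, Φ γ - σ / 2 ≤ r → χ r = 1 := fun r hr => by
    have : 1 ≤ (r - (Φ γ - σ)) * (2 / σ) := by
      rw [← mul_div_assoc, le_div_iff₀ hσ]; linarith
    simp [χ, this]
  have hχc : Continuous χ := by fun_prop
  -- The normalised gradient along the path. The maximum with `2 * ε` keeps the denominator positive
  -- where the gradient may vanish; wherever the cutoff is nonzero, the gradient norm exceeds `2 *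
  -- ε`.
  let W : unitInterval → E := fun s =>
    (χ (J (γ.1 s)) * (max ‖g (γ.1 s)‖ (2 * ε))⁻¹) • g (γ.1 s)
  have hmaxpos : ∀ s, 0 < max ‖g (γ.1 s)‖ (2 * ε) := fun s =>
    lt_max_of_lt_right (by positivity)
  have hWc : Continuous W := by
    have h1 : Continuous fun s => g (γ.1 s) := hg.comp γ.1.continuous
    refine Continuous.smul (Continuous.mul (hχc.comp (hJc.comp γ.1.continuous)) ?_) h1
    exact Continuous.inv₀ (h1.norm.max continuous_const) fun s => (hmaxpos s).ne'
  have hWn : ∀ s, ‖W s‖ ≤ 1 := by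
    intro s
    rw [norm_smul, Real.norm_of_nonneg (mul_nonneg (hχ0 _) (inv_nonneg.2 (hmaxpos s).le)),
      mul_assoc]
    refine mul_le_one₀ (hχ1 _) (by have := hmaxpos s; positivity) ?_
    rw [inv_mul_le_iff₀ (hmaxpos s), mul_one]
    exact le_max_left _ _
  have hWin : ∀ s, 2 * ε * χ (J (γ.1 s)) ≤ inner ℝ (g (γ.1 s)) (W s) := by
    intro s
    simp only [W, inner_smul_right, real_inner_self_eq_norm_sq]
    by_cases hs : J (γ.1 s) ≤ Φ γ - σ
    · simp [hχz _ hs]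
    · have h1 := hcrit s (not_le.1 hs).le
      rw [max_eq_left h1.le]
      have h2 : 0 < ‖g (γ.1 s)‖ := lt_trans (by positivity) h1
      have h3 : χ (J (γ.1 s)) * ‖g (γ.1 s)‖⁻¹ * ‖g (γ.1 s)‖ ^ 2
          = ‖g (γ.1 s)‖ * χ (J (γ.1 s)) := by field_simp
      rw [h3]
      exact mul_le_mul_of_nonneg_right h1.le (hχ0 _)
  -- Compactness of the path and of the unit interval of displacements makes the change of the
  -- gradient uniformly small.
  have huc : ∃ δ > 0, ∀ ξ ∈ Icc (0 : ℝ) 1, ξ < δ → ∀ s : unitInterval,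
      ‖g (γ.1 s + ξ • (-W s)) - g (γ.1 s)‖ ≤ ε / 2 := by
    have hcont : Continuous fun p : unitInterval × unitInterval =>
        g (γ.1 p.1 + (p.2 : ℝ) • (-W p.1)) := by
      refine hg.comp ?_
      have := γ.1.continuous
      fun_prop
    have hu := CompactSpace.uniformContinuous_of_continuous hcont
    rw [Metric.uniformContinuous_iff] at hu
    obtain ⟨δ, hδ, hu⟩ := hu (ε / 2) (by positivity)
    refine ⟨δ, hδ, fun ξ hξ hξδ s => ?_⟩
    have := hu (a := (s, ⟨ξ, hξ⟩)) (b := (s, 0)) (by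
      simp only [Prod.dist_eq, dist_self, Subtype.dist_eq, Real.dist_eq]
      simpa [abs_of_nonneg hξ.1] using ⟨hδ, hξδ⟩)
    rw [dist_eq_norm] at this
    simpa using this.le
  obtain ⟨δ, hδ, huc⟩ := huc
  -- The bound `4 * ε * τ < σ` keeps points below `Φ γ - σ / 2` below the new maximum, since they
  -- rise by at most `ε * τ / 2`.
  obtain ⟨τ, hτ0, hτ⟩ : ∃ τ : ℝ, 0 < τ ∧ τ < min δ (min 1 (σ / (4 * ε))) :=
    exists_between (by positivity)
  rw [lt_min_iff, lt_min_iff, lt_div_iff₀ (by positivity)] at hτ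
  -- Since `σ < c₀ ≤ Φ γ`, the endpoints lie below the cutoff level and do not move.
  have hzero : ∀ s, J (γ.1 s) ≤ 0 → W s = 0 := fun s hs => by
    simp [W, hχz _ (hs.trans (by linarith [hlow γ] : (0 : ℝ) ≤ Φ γ - σ))]
  let γ' : Γ := ⟨⟨fun s => γ.1 s + τ • (-W s), by have := γ.1.continuous; fun_prop⟩, by
    have hw0 := hzero 0 (by rw [γ.2.1]; exact h0)
    have hw1 := hzero 1 (by rw [γ.2.2]; exact he)
    simp [Γ, hw0, hw1, γ.2.1, γ.2.2]⟩
  have hdist : dist γ γ' ≤ τ := by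
    rw [Subtype.dist_eq, ContinuousMap.dist_le hτ0.le]
    intro s
    simp only [γ', ContinuousMap.coe_mk, dist_self_add_right, norm_smul, norm_neg,
      Real.norm_of_nonneg hτ0.le]
    exact mul_le_of_le_one_right hτ0.le (hWn s)
  -- The top of the path descends at rate at least `2 * ε - ε / 2`, while the path moves by at most
  -- `τ`. A gain of `3 / 2 * ε * τ` contradicts the slope `ε` allowed by Ekeland's principle.
  have hΦ' : Φ γ' ≤ Φ γ - 3 / 2 * ε * τ := by
    refine ciSup_le fun s => ?_
    obtain ⟨ξ, hξ, hmv⟩ := exists_mean_value_line hJ (γ.1 s) (-W s) hτ0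
    have h1 := huc ξ ⟨hξ.1.le, by linarith [hξ.2]⟩ (by linarith [hξ.2]) s
    have h2 : |inner ℝ (g (γ.1 s + ξ • (-W s)) - g (γ.1 s)) (-W s)| ≤ ε / 2 := by
      refine (abs_real_inner_le_norm _ _).trans ?_
      rw [norm_neg]
      exact (mul_le_of_le_one_right (norm_nonneg _) (hWn s)).trans h1
    rw [inner_sub_left, inner_neg_right (g (γ.1 s))] at h2
    have h3 := hWin s
    have h4 := (abs_le.1 h2).2
    have h5 : inner ℝ (g (γ.1 s + ξ • (-W s))) (-W s) ≤ ε / 2 - 2 * ε * χ (J (γ.1 s)) := by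
      linarith
    have h6 := mul_le_mul_of_nonneg_left h5 hτ0.le
    change J (γ.1 s + τ • (-W s)) ≤ _
    by_cases hs : Φ γ - σ / 2 ≤ J (γ.1 s)
    · rw [hχo _ hs] at h6
      linarith [hle γ s]
    · have h7 : 0 ≤ τ * (2 * ε * χ (J (γ.1 s))) := by have := hχ0 (J (γ.1 s)); positivity
      linarith [not_le.1 hs]
  have h8 := hγ₂ γ'
  have h9 := mul_le_mul_of_nonneg_left hdist hε.le
  have : 0 < ε * τ := by positivity
  linarith

/-- The mountain pass theorem in a finite-dimensional normed space: if almost critical points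
below the level of the reference segment are bounded, there is a critical point. -/
theorem mountainPass {E : Type*} [NormedAddCommGroup E] [NormedSpace ℝ E]
    [FiniteDimensional ℝ E] {J : E → ℝ} {D : E → E →L[ℝ] ℝ} (hJc : Continuous J)
    (hD : Continuous D) (hJ : ∀ x h, HasDerivAt (fun s : ℝ => J (x + s • h)) (D x h) 0)
    {e : E} {c₀ c₁ : ℝ} (hc₀ : 0 < c₀) (h0 : J 0 ≤ 0) (he : J e ≤ 0)
    (hbar : ∀ γ : C(unitInterval, E), γ 0 = 0 → γ 1 = e → ∃ s, c₀ ≤ J (γ s))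
    (hc₁ : ∀ s ∈ Icc (0 : ℝ) 1, J (s • e) ≤ c₁)
    (hPS : ∃ δ > 0, ∃ R : ℝ, ∀ x, J x ≤ c₁ → ‖D x‖ ≤ δ → ‖x‖ ≤ R) :
    ∃ x, c₀ ≤ J x ∧ J x ≤ c₁ ∧ D x = 0 := by
  have halmost : ∀ ε > 0, ∀ σ > 0, σ < c₀ →
      ∃ x, c₀ - σ ≤ J x ∧ J x ≤ c₁ ∧ ‖D x‖ ≤ ε := by
    intro ε hε σ hσ hσc
    -- The norm of `E` need not come from an inner product, so the gradient is taken in Euclidean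
    -- coordinates. The isomorphism distorts differentials by at most `K`, hence the tolerance `ε /
    -- (2 * K)`.
    let A := toEuclidean (E := E)
    let B : EuclideanSpace ℝ (Fin (Module.finrank ℝ E)) →L[ℝ] E := A.symm
    let T := InnerProductSpace.toDual ℝ (EuclideanSpace ℝ (Fin (Module.finrank ℝ E)))
    let g : EuclideanSpace ℝ (Fin (Module.finrank ℝ E)) →
      EuclideanSpace ℝ (Fin (Module.finrank ℝ E)) := fun y => T.symm ((D (B y)).comp B)
    have hg : Continuous g := by
      refine T.symm.continuous.comp ?_
      exact (hD.comp B.continuous).clm_comp continuous_const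
    let K := ‖(A : E →L[ℝ] EuclideanSpace ℝ (Fin (Module.finrank ℝ E)))‖ + 1
    have hK : 0 < K := by positivity
    obtain ⟨y, hy₁, hy₂, hy₃⟩ := mountainPass_almost_critical (J := fun y => J (B y)) (g := g)
      (hJc.comp B.continuous) hg (fun y h => by
        have := hJ (B y) (B h)
        simpa [g, T, InnerProductSpace.toDual_symm_apply] using this)
      (e := A e) (by simpa using h0) (by simpa [B] using he)
      (fun γ hγ0 hγ1 => by
        obtain ⟨s, hs⟩ := hbar ⟨fun s => B (γ s), by fun_prop⟩ (by simp [hγ0])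
          (by simp [hγ1, B])
        exact ⟨s, hs⟩)
      (fun s hs => by simpa [B] using hc₁ s hs) (ε := ε / (2 * K)) (by positivity) hσ hσc
    refine ⟨B y, hy₁, hy₂, ?_⟩
    have h1 : D (B y) = ((D (B y)).comp B).comp
        (A : E →L[ℝ] EuclideanSpace ℝ (Fin (Module.finrank ℝ E))) := by
      ext z; simp [B]
    have h2 : ‖(D (B y)).comp B‖ = ‖g y‖ := by simp [g]
    rw [h1]
    refine (ContinuousLinearMap.opNorm_comp_le _ _).trans ?_
    rw [h2]
    calc ‖g y‖ * ‖(A : E →L[ℝ] EuclideanSpace ℝ (Fin (Module.finrank ℝ E)))‖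
        ≤ (2 * (ε / (2 * K))) * K :=
          mul_le_mul hy₃ (by simp [K]) (norm_nonneg _) (by positivity)
      _ = ε := by field_simp
  obtain ⟨δ, hδ, R, hR⟩ := hPS
  -- The denominator `n + 2` makes the loss of level strictly smaller than `c₀` already for `n = 0`.
  have hseq : ∀ n : ℕ, ∃ x, c₀ - c₀ / (n + 2) ≤ J x ∧ J x ≤ c₁ ∧ ‖D x‖ ≤ min δ (1 / (n + 1)) :=
    fun n => halmost _ (by positivity) _ (by positivity)
      (by rw [div_lt_iff₀ (by positivity)]; nlinarith [(Nat.cast_nonneg n : (0 : ℝ) ≤ n)])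
  choose x hx₁ hx₂ hx₃ using hseq
  have : ProperSpace E := FiniteDimensional.proper_real E
  obtain ⟨l, -, φ, hφ, hl⟩ := (isCompact_closedBall (0 : E) R).tendsto_subseq (x := x)
    (fun n => by
      simpa using hR _ (hx₂ n) ((hx₃ n).trans (min_le_left _ _)))
  have hJl := (hJc.tendsto l).comp hl
  have hDl := (hD.tendsto l).comp hl
  refine ⟨l, ?_, le_of_tendsto' hJl fun n => hx₂ _, ?_⟩
  · have : Tendsto (fun n : ℕ => c₀ - c₀ / ((n : ℝ) + 2)) atTop (𝓝 (c₀ - 0)) := by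
      refine tendsto_const_nhds.sub ?_
      exact tendsto_const_nhds.div_atTop
        (tendsto_atTop_add_const_right _ _ tendsto_natCast_atTop_atTop)
    rw [sub_zero] at this
    exact le_of_tendsto_of_tendsto' (this.comp hφ.tendsto_atTop) hJl fun n => hx₁ _
  · have h1 : Tendsto (fun n => ‖D (x (φ n))‖) atTop (𝓝 0) := by
      refine squeeze_zero (fun _ => norm_nonneg _)
        (fun n => (hx₃ (φ n)).trans (min_le_right _ _)) ?_
      exact tendsto_one_div_add_atTop_nhds_zero_nat.comp hφ.tendsto_atTop
    have h2 := tendsto_nhds_unique hDl.norm h1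
    simpa using h2

/-! ### G-functions, their conjugates and the Simonenko indices -/

namespace IsGFunction

variable {G : Euc N → ℝ}

theorem continuous (hG : IsGFunction G) : Continuous G := hG.contDiff.continuous

theorem hasGradientAt (hG : IsGFunction G) (x : Euc N) : HasGradientAt G (gradient G x) x :=
  (hG.contDiff.differentiable one_ne_zero x).hasGradientAt

/-- Superlinearity in additive form: outside a large ball the quotient `G v / ‖v‖` exceeds `M`, and
inside it the left side is bounded. -/
theorem mul_norm_le (hG : IsGFunction G) (M : ℝ) : ∃ c, 0 ≤ c ∧ ∀ v, M * ‖v‖ ≤ G v + c := by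
  have h := hG.superlinear.eventually_ge_atTop M
  rw [← comap_norm_atTop, eventually_comap] at h
  obtain ⟨R, hR⟩ := eventually_atTop.1 h
  refine ⟨|M| * max R 0, by positivity, fun v => ?_⟩
  by_cases hv' : R ≤ ‖v‖ ∧ 0 < ‖v‖
  · have h1 := hR ‖v‖ hv'.1 v rfl
    rw [le_div_iff₀ hv'.2] at h1
    have : 0 ≤ |M| * max R 0 := by positivity
    linarith
  · have h3 : ‖v‖ ≤ max R 0 := by
      rw [not_and_or, not_le, not_lt] at hv'
      rcases hv' with h | h
      · exact h.le.trans (le_max_left _ _)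
      · exact h.trans (le_max_right _ _)
    have h4 : M * ‖v‖ ≤ |M| * max R 0 :=
      mul_le_mul (le_abs_self M) h3 (norm_nonneg _) (abs_nonneg _)
    linarith [hG.nonneg v]

theorem smul_le (hG : IsGFunction G) {s : ℝ} (h0 : 0 ≤ s) (h1 : s ≤ 1) (v : Euc N) :
    G (s • v) ≤ s * G v := by
  have := hG.convex.2 (mem_univ v) (mem_univ 0) h0 (sub_nonneg.2 h1) (by ring)
  simpa [hG.zero] using this

theorem le_smul (hG : IsGFunction G) {s : ℝ} (h1 : 1 ≤ s) (v : Euc N) :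
    s * G v ≤ G (s • v) := by
  have h0 : 0 < s := by linarith
  have := hG.smul_le (inv_nonneg.2 h0.le) (inv_le_one_of_one_le₀ h1) (s • v)
  rw [smul_smul, inv_mul_cancel₀ h0.ne', one_smul, inv_mul_eq_div, le_div_iff₀ h0] at this
  linarith

/-- If `G` vanished at `x`, then `Δ₂` would carry the zero to `2x`, `4x` and so on, against
superlinear growth. -/
theorem pos (hG : IsGFunction G) (hΔ : Delta2 G) {x : Euc N} (hx : x ≠ 0) : 0 < G x := by
  refine lt_of_le_of_ne (hG.nonneg x) fun h => ?_
  obtain ⟨K, hK, hΔ⟩ := hΔ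
  have hz : ∀ n : ℕ, G ((2 : ℝ) ^ n • x) = 0 := by
    intro n
    induction n with
    | zero => simpa using h.symm
    | succ k ih =>
      refine le_antisymm ?_ (hG.nonneg _)
      have := hΔ ((2 : ℝ) ^ k • x)
      rw [ih, mul_zero, smul_smul] at this
      rwa [pow_succ']
  obtain ⟨c, -, hc⟩ := hG.mul_norm_le 1
  have hx' : 0 < ‖x‖ := norm_pos_iff.2 hx
  obtain ⟨n, hn⟩ := pow_unbounded_of_one_lt (c / ‖x‖) (one_lt_two (α := ℝ))
  have h1 := hc ((2 : ℝ) ^ n • x)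
  rw [hz, norm_smul, norm_pow, Real.norm_ofNat, one_mul, zero_add] at h1
  rw [div_lt_iff₀ hx'] at hn
  linarith

/-- Write the sum as twice the midpoint and use convexity, then `Δ₂`. This makes finiteness of the
modular stable under addition. -/
theorem add_le (hG : IsGFunction G) (hΔ : Delta2 G) :
    ∃ K, 0 < K ∧ ∀ v w, G (v + w) ≤ K * (G v + G w) := by
  obtain ⟨K, hK, hΔ⟩ := hΔ
  refine ⟨K, hK, fun v w => ?_⟩
  have h1 := hG.convex.2 (mem_univ v) (mem_univ w) (by norm_num : (0 : ℝ) ≤ 1 / 2)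
    (by norm_num : (0 : ℝ) ≤ 1 / 2) (by norm_num)
  have h2 := hΔ ((1 / 2 : ℝ) • v + (1 / 2 : ℝ) • w)
  rw [← smul_add, smul_smul] at h2
  norm_num at h2 h1
  have h3 := mul_le_mul_of_nonneg_left h1 hK.le
  have h4 : 0 ≤ K * (G v + G w) := by
    have := hG.nonneg v; have := hG.nonneg w; positivity
  linarith

end IsGFunction

/-- A differentiable convex function lies above its tangents. -/
theorem ConvexOn.inner_gradient_le {φ : Euc N → ℝ} (hφ : ConvexOn ℝ univ φ) {x g : Euc N}
    (hx : HasGradientAt φ g x) (y : Euc N) : φ x + inner ℝ g (y - x) ≤ φ y := by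
  have hline : HasDerivAt (fun s : ℝ => φ (x + s • (y - x))) (inner ℝ g (y - x)) 0 := by
    have h1 : HasDerivAt (fun s : ℝ => x + s • (y - x)) (y - x) 0 := by
      simpa using ((hasDerivAt_id (0 : ℝ)).smul_const (y - x)).const_add x
    have h2 : HasFDerivAt φ (InnerProductSpace.toDual ℝ (Euc N) g) (x + (0 : ℝ) • (y - x)) := by
      simpa using hx.hasFDerivAt
    simpa [Function.comp_def] using h2.comp_hasDerivAt (0 : ℝ) h1
  have hslope := (hasDerivAt_iff_tendsto_slope.1 hline).mono_left
    (nhdsWithin_mono 0 (fun s (hs : s ∈ Ioi (0 : ℝ)) => ne_of_gt hs))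
  have hle : inner ℝ g (y - x) ≤ φ y - φ x := by
    refine le_of_tendsto hslope ?_
    filter_upwards [Ioo_mem_nhdsGT (zero_lt_one (α := ℝ))] with s hs
    have h3 := hφ.2 (mem_univ x) (mem_univ y) (sub_nonneg.2 hs.2.le) hs.1.le (by ring)
    have h4 : (1 - s) • x + s • y = x + s • (y - x) := by module
    rw [h4, smul_eq_mul, smul_eq_mul] at h3
    rw [slope_def_field]
    simp only [zero_smul, add_zero, sub_zero]
    rw [div_le_iff₀ hs.1]
    linarith
  linarith

namespace IsGFunction

variable {G : Euc N → ℝ}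

theorem tangent_le (hG : IsGFunction G) (x y : Euc N) :
    G x + inner ℝ (gradient G x) (y - x) ≤ G y :=
  ConvexOn.inner_gradient_le hG.convex (hG.hasGradientAt x) y

theorem inner_gradient_nonneg (hG : IsGFunction G) (x : Euc N) :
    0 ≤ inner ℝ x (gradient G x) := by
  have := hG.tangent_le x 0
  rw [hG.zero, zero_sub, inner_neg_right, real_inner_comm] at this
  linarith [hG.nonneg x]

/-- The tangent at `x` is evaluated at `2x`, where `Δ₂` bounds `G`. In particular the quotients
defining the upper index are bounded. -/
theorem inner_gradient_le (hG : IsGFunction G) (hΔ : Delta2 G) :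
    ∃ K, 0 < K ∧ ∀ x, inner ℝ x (gradient G x) ≤ K * G x := by
  obtain ⟨K, hK, hΔ⟩ := hΔ
  refine ⟨K, hK, fun x => ?_⟩
  have := hG.tangent_le x ((2 : ℝ) • x)
  rw [two_smul, add_sub_cancel_right, ← two_smul ℝ, real_inner_comm] at this
  linarith [hG.nonneg x, hΔ x]

/-- Superlinearity makes the supremum finite. Without boundedness the real-valued `⨆` would take its
default value and Young's inequality could not be read off. -/
theorem bddAbove_conj (hG : IsGFunction G) (y : Euc N) :
    BddAbove (range fun x : Euc N => inner ℝ x y - G x) := by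
  obtain ⟨c, -, hc⟩ := hG.mul_norm_le ‖y‖
  refine ⟨c, ?_⟩
  rintro _ ⟨x, rfl⟩
  have h1 := real_inner_le_norm x y
  have h2 := hc x
  simp only
  linarith

theorem young (hG : IsGFunction G) (x y : Euc N) : inner ℝ x y ≤ G x + conj G y := by
  have := le_ciSup (hG.bddAbove_conj y) x
  unfold conj
  linarith

theorem conj_nonneg (hG : IsGFunction G) (y : Euc N) : 0 ≤ conj G y := by
  have := hG.young 0 y
  simpa [hG.zero] using this

theorem conj_smul_le (hG : IsGFunction G) {s : ℝ} (h0 : 0 ≤ s) (h1 : s ≤ 1) (y : Euc N) :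
    conj G (s • y) ≤ s * conj G y := by
  refine ciSup_le fun x => ?_
  rw [inner_smul_right]
  have h2 := mul_le_mul_of_nonneg_left (hG.young x y) h0
  have h3 := mul_le_mul_of_nonneg_right h1 (hG.nonneg x)
  linarith

/-- Equality in Young's inequality at the gradient gives `G*(∇G v) = ⟨v, ∇G v⟩ - G v`; the tangent
inequality yields the half used here. This converts the growth of the momentum, stated through
`G*(∇G v)`, into growth in `G v`. -/
theorem conj_gradient_le (hG : IsGFunction G) (hΔ : Delta2 G) :
    ∃ K, 0 < K ∧ ∀ v, conj G (gradient G v) ≤ K * G v := by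
  obtain ⟨K, hK, hle⟩ := hG.inner_gradient_le hΔ
  refine ⟨K, hK, fun v => ciSup_le fun x => ?_⟩
  have h1 := hG.tangent_le v x
  rw [inner_sub_right, real_inner_comm x, real_inner_comm v] at h1
  linarith [hle v, hG.nonneg v]

/-- Young's inequality in norm form: `‖y‖ ≤ G* y + sup_{‖e‖ ≤ 1} G`. -/
theorem norm_le_conj (hG : IsGFunction G) : ∃ c, 0 ≤ c ∧ ∀ y, ‖y‖ ≤ conj G y + c := by
  obtain ⟨c, hc⟩ := (isCompact_closedBall (0 : Euc N) 1).bddAbove_image hG.continuous.continuousOn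
  have hc' : ∀ x : Euc N, ‖x‖ ≤ 1 → G x ≤ c := fun x hx =>
    hc (mem_image_of_mem _ (by simpa using hx))
  refine ⟨c, (hG.nonneg 0).trans (hc' 0 (by simp)), fun y => ?_⟩
  have h1 := hG.young (‖y‖⁻¹ • y) y
  have h2 : G (‖y‖⁻¹ • y) ≤ c := hc' _ (by
    rw [norm_smul, norm_inv, norm_norm]; exact inv_mul_le_one)
  rw [real_inner_smul_left, real_inner_self_eq_norm_sq] at h1
  have h3 : ‖y‖⁻¹ * ‖y‖ ^ 2 = ‖y‖ := by
    rcases eq_or_ne ‖y‖ 0 with h | h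
    · simp [h]
    · field_simp
  linarith

theorem hasDerivAt_ray (hG : IsGFunction G) (x : Euc N) (s : ℝ) :
    HasDerivAt (fun r : ℝ => G (r • x)) (inner ℝ x (gradient G (s • x))) s := by
  have h1 : HasDerivAt (fun r : ℝ => r • x) x s := by
    simpa using (hasDerivAt_id s).smul_const x
  have h2 := (hG.hasGradientAt (s • x)).hasFDerivAt.comp_hasDerivAt s h1
  rw [real_inner_comm]
  simpa [Function.comp_def] using h2

/-- The logarithmic derivative of `s ↦ G (s • x)` is at most `q / s`, so `s ^ (-q) * G (s • x)`
decreases; its values at `r ≤ 1` and at `1` are compared. -/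
theorem rpow_qIndex_mul_le (hG : IsGFunction G) (hΔ : Delta2 G) {r : ℝ} (h0 : 0 < r)
    (h1 : r ≤ 1) (x : Euc N) : r ^ qIndex G * G x ≤ G (r • x) := by
  rcases eq_or_ne x 0 with rfl | hx
  · simp [hG.zero]
  obtain ⟨K, hK, hle⟩ := hG.inner_gradient_le hΔ
  have hq : ∀ y : Euc N, y ≠ 0 → inner ℝ y (gradient G y) ≤ qIndex G * G y := by
    intro y hy
    have hbd : BddAbove (range fun x : {x : Euc N // x ≠ 0} =>
        inner ℝ (x : Euc N) (gradient G x) / G x) := by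
      refine ⟨K, ?_⟩
      rintro _ ⟨z, rfl⟩
      exact (div_le_iff₀ (hG.pos hΔ z.2)).2 (hle z)
    exact (div_le_iff₀ (hG.pos hΔ hy)).1 (le_ciSup hbd ⟨y, hy⟩)
  have hanti : AntitoneOn (fun s : ℝ => s ^ (-qIndex G) * G (s • x)) (Ioi 0) := by
    have hd : ∀ s ∈ Ioi (0 : ℝ), HasDerivAt (fun s : ℝ => s ^ (-qIndex G) * G (s • x))
        (-qIndex G * s ^ (-qIndex G - 1) * G (s • x)
          + s ^ (-qIndex G) * inner ℝ x (gradient G (s • x))) s := fun s hs =>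
      (Real.hasDerivAt_rpow_const (Or.inl (ne_of_gt hs))).mul (hG.hasDerivAt_ray x s)
    refine antitoneOn_of_deriv_nonpos (convex_Ioi 0)
      (fun s hs => (hd s hs).continuousAt.continuousWithinAt)
      (fun s hs => (hd s (interior_subset hs)).differentiableAt.differentiableWithinAt)
      (fun s hs => ?_)
    have hs0 : 0 < s := interior_subset hs
    rw [(hd s hs0).deriv]
    have h2 := hq (s • x) (smul_ne_zero hs0.ne' hx)
    rw [real_inner_smul_left] at h2
    have h3 : s ^ (-qIndex G) = s ^ (-qIndex G - 1) * s := by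
      rw [Real.rpow_sub_one hs0.ne']; field_simp
    rw [h3]
    have h4 : 0 < s ^ (-qIndex G - 1) := Real.rpow_pos_of_pos hs0 _
    nlinarith
  have h5 := hanti h0 (mem_Ioi.2 zero_lt_one) h1
  simp only [Real.one_rpow, one_smul, one_mul] at h5
  have h6 := mul_le_mul_of_nonneg_left h5 (Real.rpow_nonneg h0.le (qIndex G))
  rwa [← mul_assoc, ← Real.rpow_add h0, add_neg_cancel, Real.rpow_zero, one_mul] at h6

/-- The counterpart for dilations: the logarithmic derivative is at least `p / s`, so `s ^ (-p) * G
(s • x)` increases from `1` to `r`. -/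
theorem rpow_pIndex_mul_le (hG : IsGFunction G) (hΔ : Delta2 G) {r : ℝ} (h1 : 1 ≤ r)
    (x : Euc N) : r ^ pIndex G * G x ≤ G (r • x) := by
  rcases eq_or_ne x 0 with rfl | hx
  · simp [hG.zero]
  have h0 : 0 < r := by linarith
  have hp : ∀ y : Euc N, y ≠ 0 → pIndex G * G y ≤ inner ℝ y (gradient G y) := by
    intro y hy
    have hbd : BddBelow (range fun x : {x : Euc N // x ≠ 0} =>
        inner ℝ (x : Euc N) (gradient G x) / G x) := by
      refine ⟨0, ?_⟩
      rintro _ ⟨z, rfl⟩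
      exact div_nonneg (hG.inner_gradient_nonneg z) (hG.nonneg z)
    exact (le_div_iff₀ (hG.pos hΔ hy)).1 (ciInf_le hbd ⟨y, hy⟩)
  have hmono : MonotoneOn (fun s : ℝ => s ^ (-pIndex G) * G (s • x)) (Ioi 0) := by
    have hd : ∀ s ∈ Ioi (0 : ℝ), HasDerivAt (fun s : ℝ => s ^ (-pIndex G) * G (s • x))
        (-pIndex G * s ^ (-pIndex G - 1) * G (s • x)
          + s ^ (-pIndex G) * inner ℝ x (gradient G (s • x))) s := fun s hs =>
      (Real.hasDerivAt_rpow_const (Or.inl (ne_of_gt hs))).mul (hG.hasDerivAt_ray x s)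
    refine monotoneOn_of_deriv_nonneg (convex_Ioi 0)
      (fun s hs => (hd s hs).continuousAt.continuousWithinAt)
      (fun s hs => (hd s (interior_subset hs)).differentiableAt.differentiableWithinAt)
      (fun s hs => ?_)
    have hs0 : 0 < s := interior_subset hs
    rw [(hd s hs0).deriv]
    have h2 := hp (s • x) (smul_ne_zero hs0.ne' hx)
    rw [real_inner_smul_left] at h2
    have h3 : s ^ (-pIndex G) = s ^ (-pIndex G - 1) * s := by
      rw [Real.rpow_sub_one hs0.ne']; field_simp
    rw [h3]
    have h4 : 0 < s ^ (-pIndex G - 1) := Real.rpow_pos_of_pos hs0 _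
    nlinarith
  have h5 := hmono (mem_Ioi.2 zero_lt_one) h0 h1
  simp only [Real.one_rpow, one_smul, one_mul] at h5
  have h6 := mul_le_mul_of_nonneg_left h5 (Real.rpow_nonneg h0.le (pIndex G))
  rwa [← mul_assoc, ← Real.rpow_add h0, add_neg_cancel, Real.rpow_zero, one_mul] at h6

/-- Jensen's inequality on an interval. -/
theorem map_average_le (hG : IsGFunction G) {s t : ℝ} (hst : s < t) {v : ℝ → Euc N}
    (hv : IntegrableOn v (Icc s t)) (hGv : IntegrableOn (fun r => G (v r)) (Icc s t)) :
    G ((t - s)⁻¹ • ∫ r in s..t, v r) ≤ (t - s)⁻¹ * ∫ r in s..t, G (v r) := by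
  have h1 := hG.convex.set_average_mem_epigraph (μ := volume) (t := Ioc s t) (f := v)
    hG.continuous.continuousOn isClosed_univ (by simp [hst]) (by simp) (by simp)
    (hv.mono_set Ioc_subset_Icc_self) (hGv.mono_set Ioc_subset_Icc_self)
  have h2 := h1.2
  simp only [setAverage_eq, measureReal_def, Real.volume_Ioc,
    ENNReal.toReal_ofReal (sub_nonneg.2 hst.le), smul_eq_mul] at h2
  rwa [intervalIntegral.integral_of_le hst.le, intervalIntegral.integral_of_le hst.le]

/-- The Luxemburg norm of a function in the Orlicz class of `G*` is approximated by admissible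
constants. -/
theorem exists_luxNorm_conj_lt (hG : IsGFunction G) {a b : ℝ} {f : ℝ → Euc N}
    (hf : MemOrlicz (conj G) a b f) {c : ℝ} (hc : luxNorm (conj G) a b f < c) :
    ∃ r, 0 < r ∧ r < c ∧ modular (conj G) a b (fun t => r⁻¹ • f t) ≤ 1 := by
  -- An infimum can be approximated from within only if the set is nonempty. Since `G*(s y) ≤ s
  -- G*(y)` for `s ≤ 1`, dividing by `max 1 M`, with `M` the modular of `f`, brings the modular
  -- below `1`.
  have hne : {r : ℝ | 0 < r ∧ modular (conj G) a b (fun t => r⁻¹ • f t) ≤ 1}.Nonempty := by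
    set M := (modular (conj G) a b f).toReal
    have hM : modular (conj G) a b f = ENNReal.ofReal M := (ENNReal.ofReal_toReal hf.2.ne).symm
    have h1 : (1 : ℝ) ≤ max 1 M := le_max_left _ _
    have h0 : 0 < max 1 M := by linarith
    refine ⟨max 1 M, h0, ?_⟩
    calc modular (conj G) a b (fun t => (max 1 M)⁻¹ • f t)
        ≤ ∫⁻ t in Icc a b, ENNReal.ofReal (max 1 M)⁻¹ * ENNReal.ofReal (conj G (f t)) := by
          refine lintegral_mono fun t => ?_
          rw [← ENNReal.ofReal_mul (inv_nonneg.2 h0.le)]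
          exact ENNReal.ofReal_le_ofReal
            (hG.conj_smul_le (inv_nonneg.2 h0.le) (inv_le_one_of_one_le₀ h1) _)
      _ = ENNReal.ofReal (max 1 M)⁻¹ * modular (conj G) a b f :=
          lintegral_const_mul' _ _ ENNReal.ofReal_ne_top
      _ ≤ 1 := by
          rw [hM, ← ENNReal.ofReal_mul (inv_nonneg.2 h0.le), ← ENNReal.ofReal_one]
          refine ENNReal.ofReal_le_ofReal ?_
          rw [inv_mul_le_iff₀ h0, mul_one]
          exact le_max_right _ _
  obtain ⟨r, hr, hrc⟩ := exists_lt_of_csInf_lt hne hc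
  exact ⟨r, hr.1, hrc, hr.2⟩

theorem integrableOn_of_memOrlicz_conj (hG : IsGFunction G) {a b : ℝ} {f : ℝ → Euc N}
    (hf : MemOrlicz (conj G) a b f) : IntegrableOn f (Icc a b) := by
  obtain ⟨c, hc, hle⟩ := hG.norm_le_conj
  refine ⟨hf.1, ?_⟩
  calc ∫⁻ t in Icc a b, ‖f t‖ₑ
      ≤ ∫⁻ t in Icc a b, (ENNReal.ofReal (conj G (f t)) + ENNReal.ofReal c) := by
        refine lintegral_mono fun t => ?_
        rw [← ofReal_norm, ← ENNReal.ofReal_add (hG.conj_nonneg _) hc]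
        exact ENNReal.ofReal_le_ofReal (hle _)
    _ < ⊤ := by
        rw [lintegral_add_right _ measurable_const]
        refine ENNReal.add_lt_top.2 ⟨hf.2, ?_⟩
        simp [ENNReal.mul_lt_top_iff]

end IsGFunction

/-! ### Lagrangians convex in the velocity: integrability and differentiation -/

/-- The directional derivative of a Lagrangian with partial gradients `Lx`, `Lv`. -/
def dirDeriv (Lx Lv : ℝ → Euc N → Euc N → Euc N) (t : ℝ) (x v φ h : Euc N) : ℝ :=
  inner ℝ (Lx t x v) φ + inner ℝ (Lv t x v) h

/-- A Lagrangian with continuous partial gradients `Lx`, `Lv`, convex in the velocity, controlled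
from above and from below by the G-function `G`. -/
structure IsConvexLagrangian (G : Euc N → ℝ) (β : ℝ → ℝ) (L : ℝ → Euc N → Euc N → ℝ)
    (Lx Lv : ℝ → Euc N → Euc N → Euc N) : Prop where
  cont : Continuous fun z : ℝ × Euc N × Euc N => L z.1 z.2.1 z.2.2
  cont_x : Continuous fun z : ℝ × Euc N × Euc N => Lx z.1 z.2.1 z.2.2
  cont_v : Continuous fun z : ℝ × Euc N × Euc N => Lv z.1 z.2.1 z.2.2
  hasDerivAt : ∀ t x v φ h, HasDerivAt (fun s : ℝ => L t (x + s • φ) (v + s • h))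
    (dirDeriv Lx Lv t x v φ h) 0
  tangent : ∀ t x v w, L t x w + inner ℝ (Lv t x w) (v - w) ≤ L t x v
  nonneg : ∀ t, 0 ≤ β t
  -- The last clause is the form in which a bound on `G*(Lv)` is used: by Young's inequality the
  -- momentum pairs integrably with every velocity of finite modular.
  growth : ∀ R, ∃ A, 0 ≤ A ∧ ∀ t x v, ‖x‖ ≤ R → |L t x v| ≤ A * (1 + β t + G v) ∧
    ‖Lx t x v‖ ≤ A * (1 + β t + G v) ∧ ‖Lv t x v‖ ≤ A * (1 + β t + G v) ∧
    ∀ y, |inner ℝ (Lv t x v) y| ≤ A * (1 + β t + G v) + G y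
  coercive : ∀ R, ∃ A, 0 ≤ A ∧ ∀ t x v, ‖x‖ ≤ R → G v ≤ A * (L t x v + A)

section Composition

theorem aestronglyMeasurable_comp {F : Type*} [TopologicalSpace F]
    [TopologicalSpace.PseudoMetrizableSpace F] {μ : Measure ℝ} {Ψ : ℝ → Euc N → Euc N → F}
    (hΨ : Continuous fun z : ℝ × Euc N × Euc N => Ψ z.1 z.2.1 z.2.2) {x v : ℝ → Euc N}
    (hx : AEStronglyMeasurable x μ) (hv : AEStronglyMeasurable v μ) :
    AEStronglyMeasurable (fun t => Ψ t (x t) (v t)) μ :=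
  hΨ.comp_aestronglyMeasurable (f := fun t => (t, x t, v t))
    (aestronglyMeasurable_id.prodMk (hx.prodMk hv))

theorem exists_bound_comp {F : Type*} [NormedAddCommGroup F] {Ψ : ℝ → Euc N → Euc N → F}
    (hΨ : Continuous fun z : ℝ × Euc N × Euc N => Ψ z.1 z.2.1 z.2.2) (a b R : ℝ) :
    ∃ c, 0 ≤ c ∧ ∀ t ∈ Icc a b, ∀ x v, ‖x‖ ≤ R → ‖v‖ ≤ R → ‖Ψ t x v‖ ≤ c := by
  obtain ⟨c, hc⟩ := (isCompact_Icc.prod ((isCompact_closedBall (0 : Euc N) R).prod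
    (isCompact_closedBall (0 : Euc N) R))).exists_bound_of_continuousOn (s := Icc a b ×ˢ _)
    hΨ.continuousOn
  exact ⟨max c 0, le_max_right _ _, fun t ht x v hx hv =>
    (hc (t, x, v) ⟨ht, by simpa using hx, by simpa using hv⟩).trans (le_max_left _ _)⟩

theorem integrable_comp {F : Type*} [NormedAddCommGroup F] {Ψ : ℝ → Euc N → Euc N → F}
    (hΨ : Continuous fun z : ℝ × Euc N × Euc N => Ψ z.1 z.2.1 z.2.2) {a b R : ℝ}
    {x v : ℝ → Euc N} (hx : AEStronglyMeasurable x (volume.restrict (Icc a b)))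
    (hv : AEStronglyMeasurable v (volume.restrict (Icc a b)))
    (hxR : ∀ t ∈ Icc a b, ‖x t‖ ≤ R) (hvR : ∀ t ∈ Icc a b, ‖v t‖ ≤ R) :
    Integrable (fun t => Ψ t (x t) (v t)) (volume.restrict (Icc a b)) := by
  obtain ⟨c, -, hc⟩ := exists_bound_comp hΨ a b R
  refine Integrable.of_bound (aestronglyMeasurable_comp hΨ hx hv) c ?_
  filter_upwards [ae_restrict_mem measurableSet_Icc] with t ht
  exact hc t ht _ _ (hxR t ht) (hvR t ht)

theorem tendsto_integral_comp {ι : Type*} {l : Filter ι} [l.IsCountablyGenerated]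
    {Ψ : ℝ → Euc N → Euc N → ℝ}
    (hΨ : Continuous fun z : ℝ × Euc N × Euc N => Ψ z.1 z.2.1 z.2.2) {a b R : ℝ}
    {x v : ι → ℝ → Euc N} {x₀ v₀ : ℝ → Euc N}
    (hxm : ∀ i, AEStronglyMeasurable (x i) (volume.restrict (Icc a b)))
    (hvm : ∀ i, AEStronglyMeasurable (v i) (volume.restrict (Icc a b)))
    (hxR : ∀ᶠ i in l, ∀ t ∈ Icc a b, ‖x i t‖ ≤ R) (hvR : ∀ᶠ i in l, ∀ t ∈ Icc a b, ‖v i t‖ ≤ R)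
    (hx : ∀ t ∈ Icc a b, Tendsto (fun i => x i t) l (𝓝 (x₀ t)))
    (hv : ∀ᵐ t ∂volume.restrict (Icc a b), Tendsto (fun i => v i t) l (𝓝 (v₀ t))) :
    Tendsto (fun i => ∫ t in Icc a b, Ψ t (x i t) (v i t)) l
      (𝓝 (∫ t in Icc a b, Ψ t (x₀ t) (v₀ t))) := by
  obtain ⟨c, -, hc⟩ := exists_bound_comp hΨ a b R
  refine tendsto_integral_filter_of_dominated_convergence (fun _ => c)
    (Eventually.of_forall fun i => aestronglyMeasurable_comp hΨ (hxm i) (hvm i)) ?_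
    (integrable_const c) ?_
  · filter_upwards [hxR, hvR] with i hi₁ hi₂
    filter_upwards [ae_restrict_mem measurableSet_Icc] with t ht
    exact hc t ht _ _ (hi₁ t ht) (hi₂ t ht)
  · filter_upwards [ae_restrict_mem measurableSet_Icc, hv] with t ht hvt
    exact (hΨ.tendsto (t, x₀ t, v₀ t)).comp
      (tendsto_const_nhds.prodMk_nhds ((hx t ht).prodMk_nhds hvt))

end Composition

namespace IsConvexLagrangian

variable {G : Euc N → ℝ} {β : ℝ → ℝ} {L : ℝ → Euc N → Euc N → ℝ}
  {Lx Lv : ℝ → Euc N → Euc N → Euc N} {a b : ℝ}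

theorem continuous_dirDeriv (hL : IsConvexLagrangian G β L Lx Lv) :
    Continuous fun z : ℝ × Euc N × Euc N × Euc N × Euc N =>
      dirDeriv Lx Lv z.1 z.2.1 z.2.2.1 z.2.2.2.1 z.2.2.2.2 := by
  have h1 := hL.cont_x
  have h2 := hL.cont_v
  have h3 : Continuous fun z : ℝ × Euc N × Euc N × Euc N × Euc N => (z.1, z.2.1, z.2.2.1) := by
    fun_prop
  have h4 := h1.comp h3
  have h5 := h2.comp h3
  simp only [Function.comp_def] at h4 h5
  unfold dirDeriv
  fun_prop

theorem continuous_dirDeriv_comp (hL : IsConvexLagrangian G β L Lx Lv) {φ h : ℝ → Euc N}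
    (hφ : Continuous φ) (hh : Continuous h) :
    Continuous fun z : ℝ × Euc N × Euc N =>
      dirDeriv Lx Lv z.1 z.2.1 z.2.2 (φ z.1) (h z.1) :=
  hL.continuous_dirDeriv.comp (g := fun z : ℝ × Euc N × Euc N × Euc N × Euc N =>
      dirDeriv Lx Lv z.1 z.2.1 z.2.2.1 z.2.2.2.1 z.2.2.2.2)
    (f := fun z : ℝ × Euc N × Euc N => (z.1, z.2.1, z.2.2, φ z.1, h z.1)) (by fun_prop)

theorem integrable_bound (hβ : IntegrableOn β (Icc a b)) {v : ℝ → Euc N}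
    (hGv : IntegrableOn (fun t => G (v t)) (Icc a b)) (A : ℝ) :
    IntegrableOn (fun t => A * (1 + β t + G (v t))) (Icc a b) :=
  (((integrable_const (1 : ℝ)).add hβ).add hGv).const_mul A

theorem integrable_energy (hL : IsConvexLagrangian G β L Lx Lv) (hβ : IntegrableOn β (Icc a b))
    {x v : ℝ → Euc N} {R : ℝ} (hx : AEStronglyMeasurable x (volume.restrict (Icc a b)))
    (hv : AEStronglyMeasurable v (volume.restrict (Icc a b)))
    (hxR : ∀ t ∈ Icc a b, ‖x t‖ ≤ R) (hGv : IntegrableOn (fun t => G (v t)) (Icc a b)) :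
    IntegrableOn (fun t => L t (x t) (v t)) (Icc a b) := by
  obtain ⟨A, -, hA⟩ := hL.growth R
  refine (integrable_bound hβ hGv A).mono' (aestronglyMeasurable_comp hL.cont hx hv) ?_
  filter_upwards [ae_restrict_mem measurableSet_Icc] with t ht
  exact (hA t _ (v t) (hxR t ht)).1

theorem integrable_gradients (hL : IsConvexLagrangian G β L Lx Lv)
    (hβ : IntegrableOn β (Icc a b))
    {x v : ℝ → Euc N} {R : ℝ} (hx : AEStronglyMeasurable x (volume.restrict (Icc a b)))
    (hv : AEStronglyMeasurable v (volume.restrict (Icc a b)))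
    (hxR : ∀ t ∈ Icc a b, ‖x t‖ ≤ R) (hGv : IntegrableOn (fun t => G (v t)) (Icc a b)) :
    IntegrableOn (fun t => Lx t (x t) (v t)) (Icc a b) ∧
      IntegrableOn (fun t => Lv t (x t) (v t)) (Icc a b) := by
  obtain ⟨A, -, hA⟩ := hL.growth R
  constructor
  · refine (integrable_bound hβ hGv A).mono' (aestronglyMeasurable_comp hL.cont_x hx hv) ?_
    filter_upwards [ae_restrict_mem measurableSet_Icc] with t ht
    exact (hA t _ (v t) (hxR t ht)).2.1
  · refine (integrable_bound hβ hGv A).mono' (aestronglyMeasurable_comp hL.cont_v hx hv) ?_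
    filter_upwards [ae_restrict_mem measurableSet_Icc] with t ht
    exact (hA t _ (v t) (hxR t ht)).2.2.1

theorem integrable_inner_velocity (hL : IsConvexLagrangian G β L Lx Lv)
    (hβ : IntegrableOn β (Icc a b)) {x v y : ℝ → Euc N} {R : ℝ}
    (hx : AEStronglyMeasurable x (volume.restrict (Icc a b)))
    (hv : AEStronglyMeasurable v (volume.restrict (Icc a b)))
    (hxR : ∀ t ∈ Icc a b, ‖x t‖ ≤ R) (hGv : IntegrableOn (fun t => G (v t)) (Icc a b))
    (hy : AEStronglyMeasurable y (volume.restrict (Icc a b)))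
    (hGy : IntegrableOn (fun t => G (y t)) (Icc a b)) :
    IntegrableOn (fun t => inner ℝ (Lv t (x t) (v t)) (y t)) (Icc a b) := by
  obtain ⟨A, -, hA⟩ := hL.growth R
  refine ((integrable_bound hβ hGv A).add hGy).mono'
    ((aestronglyMeasurable_comp hL.cont_v hx hv).inner hy) ?_
  filter_upwards [ae_restrict_mem measurableSet_Icc] with t ht
  exact (hA t _ (v t) (hxR t ht)).2.2.2 _

/-- The bound on the directional derivative is uniform along short segments. -/
theorem abs_dirDeriv_le (hL : IsConvexLagrangian G β L Lx Lv) (hG : IsGFunction G)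
    (hΔ : Delta2 G) (R : ℝ) : ∃ A, 0 ≤ A ∧ ∀ t x v φ h, ‖x‖ ≤ R → ‖φ‖ ≤ R → ‖h‖ ≤ R →
      ∀ s : ℝ, |s| ≤ 1 →
      |dirDeriv Lx Lv t (x + s • φ) (v + s • h) φ h| ≤ A * (1 + β t + G v) := by
  obtain ⟨A, hA0, hA⟩ := hL.growth (R + R)
  obtain ⟨K, hK, hadd⟩ := hG.add_le hΔ
  obtain ⟨c, hc⟩ := (isCompact_closedBall (0 : Euc N) R).bddAbove_image hG.continuous.continuousOn
  -- The factor `|R| * 2` comes from the two inner products, and `1 + K + K * |c|` from absorbing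
  -- the bounded shift of the velocity by means of `Δ₂`.
  refine ⟨A * |R| * 2 * (1 + K + K * |c|), by positivity, fun t x v φ h hx hφ hh s hs => ?_⟩
  have hsm : ∀ y : Euc N, ‖y‖ ≤ R → ‖s • y‖ ≤ R := fun y hy => by
    rw [norm_smul]
    exact (mul_le_of_le_one_left (norm_nonneg _) hs).trans hy
  have hx' : ‖x + s • φ‖ ≤ R + R := (norm_add_le _ _).trans (add_le_add hx (hsm φ hφ))
  have hGh : G (s • h) ≤ |c| :=
    (hc (mem_image_of_mem _ (by simpa using hsm h hh))).trans (le_abs_self c)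
  have h1 : G (v + s • h) ≤ K * (G v + |c|) :=
    (hadd _ _).trans (mul_le_mul_of_nonneg_left (by linarith) hK.le)
  obtain ⟨-, hX, hV, -⟩ := hA t (x + s • φ) (v + s • h) hx'
  have hB : 1 + β t + G (v + s • h) ≤ (1 + K + K * |c|) * (1 + β t + G v) := by
    have := hL.nonneg t
    have := hG.nonneg v
    have : 0 ≤ K * |c| := by positivity
    have : 0 ≤ K * (1 + β t) := by positivity
    have : 0 ≤ K * |c| * (β t + G v) := by positivity
    nlinarith
  have hR : ∀ y : Euc N, ‖y‖ ≤ R → ‖y‖ ≤ |R| := fun y hy => hy.trans (le_abs_self R)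
  have hB0 : 0 ≤ 1 + β t + G (v + s • h) := by
    have := hL.nonneg t; have := hG.nonneg (v + s • h); positivity
  calc |dirDeriv Lx Lv t (x + s • φ) (v + s • h) φ h|
      ≤ ‖Lx t (x + s • φ) (v + s • h)‖ * ‖φ‖ + ‖Lv t (x + s • φ) (v + s • h)‖ * ‖h‖ :=
        (abs_add_le _ _).trans
          (add_le_add (abs_real_inner_le_norm _ _) (abs_real_inner_le_norm _ _))
    _ ≤ A * (1 + β t + G (v + s • h)) * |R| + A * (1 + β t + G (v + s • h)) * |R| :=
        add_le_add (mul_le_mul hX (hR φ hφ) (norm_nonneg _) (by positivity))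
          (mul_le_mul hV (hR h hh) (norm_nonneg _) (by positivity))
    _ = A * |R| * 2 * (1 + β t + G (v + s • h)) := by ring
    _ ≤ A * |R| * 2 * ((1 + K + K * |c|) * (1 + β t + G v)) :=
        mul_le_mul_of_nonneg_left hB (by positivity)
    _ = _ := by ring

theorem hasDerivAt_line (hL : IsConvexLagrangian G β L Lx Lv) (t : ℝ) (x v φ h : Euc N) (s : ℝ) :
    HasDerivAt (fun s : ℝ => L t (x + s • φ) (v + s • h))
      (dirDeriv Lx Lv t (x + s • φ) (v + s • h) φ h) s := by
  have h1 := hL.hasDerivAt t (x + s • φ) (v + s • h) φ h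
  have h2 : HasDerivAt (fun r : ℝ => r - s) 1 s := (hasDerivAt_id s).sub_const s
  have h3 := HasDerivAt.comp (h₂ := fun r : ℝ => L t (x + s • φ + r • φ) (v + s • h + r • h)) s
    (by simpa using h1) h2
  simp only [mul_one] at h3
  refine h3.congr_of_eventuallyEq (Eventually.of_forall fun r => ?_)
  simp only [Function.comp]
  congr 1 <;> module

/-- Differentiation under the integral. Test directions are bounded, so `abs_dirDeriv_le` supplies
one integrable majorant for all parameters of modulus less than `1`. -/
theorem hasDerivAt_integral (hL : IsConvexLagrangian G β L Lx Lv) (hG : IsGFunction G)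
    (hΔ : Delta2 G) (hβ : IntegrableOn β (Icc a b)) {x v φ h : ℝ → Euc N} {R : ℝ}
    (hx : AEStronglyMeasurable x (volume.restrict (Icc a b)))
    (hv : AEStronglyMeasurable v (volume.restrict (Icc a b)))
    (hφ : Continuous φ) (hh : Continuous h)
    (hxR : ∀ t ∈ Icc a b, ‖x t‖ ≤ R) (hφR : ∀ t ∈ Icc a b, ‖φ t‖ ≤ R)
    (hhR : ∀ t ∈ Icc a b, ‖h t‖ ≤ R) (hGv : IntegrableOn (fun t => G (v t)) (Icc a b)) :
    IntegrableOn (fun t => dirDeriv Lx Lv t (x t) (v t) (φ t) (h t)) (Icc a b) ∧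
    HasDerivAt (fun s : ℝ => ∫ t in Icc a b, L t (x t + s • φ t) (v t + s • h t))
      (∫ t in Icc a b, dirDeriv Lx Lv t (x t) (v t) (φ t) (h t)) 0 := by
  obtain ⟨A, -, hA⟩ := hL.abs_dirDeriv_le hG hΔ R
  have hmeas : ∀ s : ℝ, AEStronglyMeasurable (fun t => x t + s • φ t) (volume.restrict (Icc a b)) ∧
      AEStronglyMeasurable (fun t => v t + s • h t) (volume.restrict (Icc a b)) := fun s =>
    ⟨hx.add (hφ.const_smul s).aestronglyMeasurable, hv.add (hh.const_smul s).aestronglyMeasurable⟩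
  have key := hasDerivAt_integral_of_dominated_loc_of_deriv_le
    (μ := volume.restrict (Icc a b)) (x₀ := (0 : ℝ)) (s := Metric.ball 0 1)
    (bound := fun t => A * (1 + β t + G (v t)))
    (F := fun s t => L t (x t + s • φ t) (v t + s • h t))
    (F' := fun s t => dirDeriv Lx Lv t (x t + s • φ t) (v t + s • h t) (φ t) (h t))
    (Metric.ball_mem_nhds 0 one_pos)
    (Eventually.of_forall fun s => aestronglyMeasurable_comp hL.cont (hmeas s).1 (hmeas s).2)
    (by simpa [IntegrableOn] using hL.integrable_energy hβ hx hv hxR hGv)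
    (by
      simpa using aestronglyMeasurable_comp
        (Ψ := fun t x v => dirDeriv Lx Lv t x v (φ t) (h t))
        (hL.continuous_dirDeriv_comp hφ hh) hx hv)
    (by
      filter_upwards [ae_restrict_mem measurableSet_Icc] with t ht s hs
      exact hA t _ _ _ _ (hxR t ht) (hφR t ht) (hhR t ht) s
        (by simpa using (mem_ball_zero_iff.1 hs).le))
    (integrable_bound hβ hGv A)
    (Eventually.of_forall fun t s _ => hL.hasDerivAt_line t _ _ _ _ s)
  simpa [IntegrableOn] using key

/-- The increment of the Lagrangian along a short segment is governed by the directional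
derivative, uniformly for bounded velocities. -/
theorem exists_increment_le (hL : IsConvexLagrangian G β L Lx Lv) (hG : IsGFunction G)
    (hΔ : Delta2 G) (a b R : ℝ) : ∃ A, 0 ≤ A ∧ ∀ ρ ε : ℝ, 0 < ε → ∃ δ > 0, ∀ t ∈ Icc a b,
      ∀ x v φ h, ‖x‖ ≤ R → ‖φ‖ ≤ R → ‖h‖ ≤ R → ∀ s, 0 < s → s < δ →
      L t (x + s • φ) (v + s • h) - L t x v ≤ s * (dirDeriv Lx Lv t x v φ h +
        if ‖v‖ ≤ ρ then ε else A * (1 + β t + G v)) := by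
  obtain ⟨A, hA0, hA⟩ := hL.abs_dirDeriv_le hG hΔ R
  refine ⟨2 * A, by positivity, fun ρ ε hε => ?_⟩
  -- For velocities bounded by `ρ` everything stays in a compact set, where the directional
  -- derivative is uniformly continuous. The constant `A` is fixed before `ρ` and `ε`, so that `ρ`
  -- can later be chosen in terms of it.
  let K : Set (ℝ × (Euc N × Euc N × Euc N × Euc N) × ℝ) := Icc a b ×ˢ
    ((Metric.closedBall 0 R ×ˢ Metric.closedBall 0 ρ ×ˢ Metric.closedBall 0 R ×ˢ
      Metric.closedBall 0 R) ×ˢ Icc 0 1)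
  have hK : IsCompact K := isCompact_Icc.prod (((isCompact_closedBall _ _).prod
    ((isCompact_closedBall _ _).prod ((isCompact_closedBall _ _).prod
    (isCompact_closedBall _ _)))).prod isCompact_Icc)
  have hcont : Continuous fun z : ℝ × (Euc N × Euc N × Euc N × Euc N) × ℝ =>
      dirDeriv Lx Lv z.1 (z.2.1.1 + z.2.2 • z.2.1.2.2.1) (z.2.1.2.1 + z.2.2 • z.2.1.2.2.2)
        z.2.1.2.2.1 z.2.1.2.2.2 :=
    hL.continuous_dirDeriv.comp (g := fun z : ℝ × Euc N × Euc N × Euc N × Euc N =>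
      dirDeriv Lx Lv z.1 z.2.1 z.2.2.1 z.2.2.2.1 z.2.2.2.2)
      (f := fun z : ℝ × (Euc N × Euc N × Euc N × Euc N) × ℝ =>
      (z.1, z.2.1.1 + z.2.2 • z.2.1.2.2.1, z.2.1.2.1 + z.2.2 • z.2.1.2.2.2,
        z.2.1.2.2.1, z.2.1.2.2.2)) (by fun_prop)
  have hu := hK.uniformContinuousOn_of_continuous hcont.continuousOn
  rw [Metric.uniformContinuousOn_iff] at hu
  obtain ⟨δ, hδ, hu⟩ := hu ε hε
  refine ⟨min δ 1, by positivity, fun t ht x v φ h hx hφ hh s hs0 hs => ?_⟩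
  rw [lt_min_iff] at hs
  obtain ⟨ξ, hξ, hmv⟩ := exists_hasDerivAt_eq_slope (fun s : ℝ => L t (x + s • φ) (v + s • h))
    (fun s => dirDeriv Lx Lv t (x + s • φ) (v + s • h) φ h) hs0
    (fun r _ => (hL.hasDerivAt_line t x v φ h r).continuousAt.continuousWithinAt)
    (fun r _ => hL.hasDerivAt_line t x v φ h r)
  simp only [zero_smul, add_zero, sub_zero] at hmv
  rw [eq_div_iff hs0.ne'] at hmv
  rw [← hmv, mul_comm]
  refine mul_le_mul_of_nonneg_left ?_ hs0.le
  -- For bounded velocities uniform continuity compares the intermediate point with the starting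
  -- point. For large ones both derivatives are estimated separately, which doubles the constant.
  split_ifs with hv
  · have hmem : ∀ r ∈ Icc (0 : ℝ) 1, (t, (x, v, φ, h), r) ∈ K := fun r hr =>
      ⟨ht, ⟨by simpa using hx, by simpa using hv, by simpa using hφ, by simpa using hh⟩, hr⟩
    have := hu _ (hmem ξ ⟨hξ.1.le, by linarith [hξ.2]⟩) _ (hmem 0 (by simp)) (by
      simp only [Prod.dist_eq, dist_self, Real.dist_eq]
      simpa [abs_of_pos hξ.1] using ⟨hδ, by linarith [hξ.2]⟩)
    simp only [zero_smul, add_zero, Real.dist_eq] at this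
    linarith [(abs_lt.1 this).2]
  · have h1 := hA t x v φ h hx hφ hh ξ (by rw [abs_of_pos hξ.1]; linarith [hξ.2])
    have h2 := hA t x v φ h hx hφ hh 0 (by simp)
    simp only [zero_smul, add_zero] at h2
    linarith [(abs_le.1 h1).2, (abs_le.1 h2).1]

end IsConvexLagrangian

/-! ### Primitives, absolute continuity and weak convergence -/

/-- The primitive of `v` vanishing at `a`. -/
def prim (a : ℝ) (v : ℝ → Euc N) (t : ℝ) : Euc N := ∫ s in a..t, v s

section AbsolutelyContinuous

variable {a b : ℝ}

theorem intervalIntegrable_of_mem {F : Type*} [NormedAddCommGroup F] {v : ℝ → F}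
    (hv : IntegrableOn v (Icc a b)) {s t : ℝ}
    (hs : s ∈ Icc a b) (ht : t ∈ Icc a b) : IntervalIntegrable v volume s t :=
  intervalIntegrable_iff.2 (hv.mono_set (uIoc_subset_uIcc.trans (uIcc_subset_Icc hs ht)))

theorem prim_sub_prim {v : ℝ → Euc N} (hv : IntegrableOn v (Icc a b)) {s t : ℝ}
    (hs : s ∈ Icc a b) (ht : t ∈ Icc a b) : prim a v t - prim a v s = ∫ r in s..t, v r := by
  have ha : a ∈ Icc a b := ⟨le_rfl, hs.1.trans hs.2⟩
  exact intervalIntegral.integral_interval_sub_left (intervalIntegrable_of_mem hv ha ht)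
    (intervalIntegrable_of_mem hv ha hs)

theorem setIntegral_Icc_eq {F : Type*} [NormedAddCommGroup F] [NormedSpace ℝ F] (hab : a ≤ b)
    (v : ℝ → F) : ∫ t in Icc a b, v t = ∫ t in a..b, v t := by
  rw [intervalIntegral.integral_of_le hab, integral_Icc_eq_integral_Ioc]

theorem norm_prim_le {v : ℝ → Euc N} (hv : IntegrableOn v (Icc a b)) {t : ℝ}
    (ht : t ∈ Icc a b) : ‖prim a v t‖ ≤ ∫ s in Icc a b, ‖v s‖ := by
  unfold prim
  rw [intervalIntegral.integral_of_le ht.1]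
  refine (norm_integral_le_integral_norm _).trans ?_
  exact setIntegral_mono_set hv.norm (Eventually.of_forall fun _ => norm_nonneg _)
    (LE.le.eventuallyLE (Ioc_subset_Icc_self.trans (Icc_subset_Icc_right ht.2)))

/-- The oscillation of the primitive is dominated by that of the primitive of the norm, so the
real-valued case suffices. -/
theorem prim_absolutelyContinuous (hab : a ≤ b) {v : ℝ → Euc N}
    (hv : IntegrableOn v (Icc a b)) : AbsolutelyContinuousOnInterval (prim a v) a b := by
  have h1 : IntervalIntegrable (fun t => ‖v t‖) volume a b :=
    intervalIntegrable_of_mem hv.norm ⟨le_rfl, hab⟩ ⟨hab, le_rfl⟩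
  have h2 := h1.absolutelyContinuousOnInterval_intervalIntegral (c := a) (by simp)
  refine squeeze_zero' (Eventually.of_forall fun E => Finset.sum_nonneg fun _ _ => dist_nonneg)
    ?_ h2
  refine eventually_inf_principal.2 (Eventually.of_forall fun E hE => ?_)
  refine Finset.sum_le_sum fun i hi => ?_
  obtain ⟨hx, hy⟩ := hE.1 i hi
  rw [uIcc_of_le hab] at hx hy
  rw [dist_comm, dist_comm (∫ s in a..(E.2 i).1, ‖v s‖), dist_eq_norm, Real.dist_eq,
    prim_sub_prim hv hx hy, intervalIntegral.integral_interval_sub_left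
      (intervalIntegrable_of_mem hv.norm ⟨le_rfl, hab⟩ hy)
      (intervalIntegrable_of_mem hv.norm ⟨le_rfl, hab⟩ hx)]
  exact intervalIntegral.norm_integral_le_abs_integral_norm

theorem ae_hasDerivAt_prim (hab : a ≤ b) {v : ℝ → Euc N} (hv : IntegrableOn v (Icc a b)) :
    ∀ᵐ t ∂volume.restrict (Icc a b), HasDerivAt (prim a v) (v t) t := by
  have h := (intervalIntegrable_of_mem hv ⟨le_rfl, hab⟩ ⟨hab, le_rfl⟩).ae_hasDerivAt_integral
  rw [ae_restrict_iff' measurableSet_Icc]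
  filter_upwards [h] with t ht hmem
  rw [uIcc_of_le hab] at ht
  exact ht hmem a ⟨le_rfl, hab⟩

theorem continuousOn_prim (hab : a ≤ b) {v : ℝ → Euc N} (hv : IntegrableOn v (Icc a b)) :
    ContinuousOn (prim a v) (Icc a b) := by
  have := (prim_absolutelyContinuous hab hv).continuousOn
  rwa [uIcc_of_le hab] at this

theorem hasDerivAt_prim {v : ℝ → Euc N} (hv : Continuous v) (t : ℝ) :
    HasDerivAt (prim a v) (v t) t :=
  (hv.integral_hasStrictDerivAt a t).hasDerivAt

theorem continuous_prim {v : ℝ → Euc N} (hv : Continuous v) : Continuous (prim a v) :=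
  continuous_iff_continuousAt.2 fun t => (hasDerivAt_prim hv t).continuousAt

theorem absolutelyContinuous_inner {p q : ℝ → Euc N} (hp : AbsolutelyContinuousOnInterval p a b)
    (hq : AbsolutelyContinuousOnInterval q a b) :
    AbsolutelyContinuousOnInterval (fun t => (inner ℝ (p t) (q t) : ℝ)) a b := by
  obtain ⟨P, hP⟩ := hp.exists_bound
  obtain ⟨Q, hQ⟩ := hq.exists_bound
  unfold AbsolutelyContinuousOnInterval at hp hq ⊢
  have hlim := (Tendsto.mul_const Q hp).add (Tendsto.const_mul P hq)
  simp only [zero_mul, mul_zero, add_zero] at hlim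
  refine squeeze_zero' (Eventually.of_forall fun E => Finset.sum_nonneg fun _ _ => dist_nonneg)
    ?_ hlim
  refine eventually_inf_principal.2 (Eventually.of_forall fun E hE => ?_)
  rw [Finset.sum_mul, Finset.mul_sum, ← Finset.sum_add_distrib]
  refine Finset.sum_le_sum fun i hi => ?_
  obtain ⟨hx, hy⟩ := hE.1 i hi
  generalize (E.2 i).1 = x at *
  generalize (E.2 i).2 = y at *
  have h1 : (inner ℝ (p x) (q x) : ℝ) - inner ℝ (p y) (q y)
      = inner ℝ (p x - p y) (q x) + inner ℝ (p y) (q x - q y) := by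
    rw [inner_sub_left, inner_sub_right]; ring
  rw [Real.dist_eq, h1, dist_eq_norm, dist_eq_norm]
  refine (abs_add_le _ _).trans (add_le_add ?_ ?_)
  · exact (abs_real_inner_le_norm _ _).trans
      (mul_le_mul_of_nonneg_left (hQ x hx) (norm_nonneg _))
  · exact (abs_real_inner_le_norm _ _).trans
      (mul_le_mul_of_nonneg_right (hP y hy) (norm_nonneg _))

/-- Integration by parts for primitives. -/
theorem integral_inner_prim_add (hab : a ≤ b) {p q : ℝ → Euc N} (hp : IntegrableOn p (Icc a b))
    (hq : IntegrableOn q (Icc a b)) :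
    ∫ t in Icc a b, (inner ℝ (p t) (prim a q t) + inner ℝ (prim a p t) (q t))
      = inner ℝ (prim a p b) (prim a q b) := by
  have hac := absolutelyContinuous_inner (prim_absolutelyContinuous hab hp)
    (prim_absolutelyContinuous hab hq)
  have h := hac.integral_deriv_eq_sub
  simp only [prim, intervalIntegral.integral_same, inner_zero_left, sub_zero] at h
  rw [prim, prim, ← h, ← setIntegral_Icc_eq hab]
  refine integral_congr_ae ?_
  filter_upwards [ae_hasDerivAt_prim hab hp, ae_hasDerivAt_prim hab hq] with t h1 h2
  have h3 := (h1.inner ℝ h2).deriv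
  simp only [prim] at h3
  rw [h3, add_comm]
  rfl

/-- A continuous function is uniformly approximated on a compact interval by functions of the
form `c + prim k` with `k` continuous. -/
theorem exists_prim_approx {h : ℝ → Euc N} (hh : Continuous h) (a b : ℝ) {ε : ℝ} (hε : 0 < ε) :
    ∃ (c : Euc N) (k : ℝ → Euc N), Continuous k ∧ ∀ t ∈ Icc a b, ‖h t - (c + prim a k t)‖ ≤ ε := by
  -- The averages below look forward by `τ < 1`, so uniform continuity is needed on `[a, b + 1]`.
  have hu := (isCompact_Icc (a := a) (b := b + 1)).uniformContinuousOn_of_continuous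
    hh.continuousOn
  rw [Metric.uniformContinuousOn_iff] at hu
  obtain ⟨δ, hδ, hu⟩ := hu ε hε
  obtain ⟨τ, hτ0, hτ⟩ : ∃ τ : ℝ, 0 < τ ∧ τ < min δ 1 := exists_between (by positivity)
  rw [lt_min_iff] at hτ
  -- These are the data of the Steklov average `τ⁻¹ ∫_t^{t+τ} h`: its value at `a` and its
  -- derivative.
  refine ⟨τ⁻¹ • ∫ s in a..a + τ, h s, fun t => τ⁻¹ • (h (t + τ) - h t), by fun_prop,
    fun t ht => ?_⟩
  have hi : ∀ x y, IntervalIntegrable h volume x y := fun x y => hh.intervalIntegrable x y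
  have h1 : prim a (fun t => τ⁻¹ • (h (t + τ) - h t)) t
      = τ⁻¹ • ((∫ s in t..t + τ, h s) - ∫ s in a..a + τ, h s) := by
    unfold prim
    rw [intervalIntegral.integral_smul, intervalIntegral.integral_sub
      (Continuous.intervalIntegrable (by fun_prop) _ _) (hi _ _),
      intervalIntegral.integral_comp_add_right]
    congr 1
    rw [← intervalIntegral.integral_add_adjacent_intervals (hi (a + τ) t) (hi t (t + τ)),
      ← intervalIntegral.integral_add_adjacent_intervals (hi a (a + τ)) (hi (a + τ) t)]
    abel
  have h2 : h t - (τ⁻¹ • (∫ s in a..a + τ, h s) + prim a (fun t => τ⁻¹ • (h (t + τ) - h t)) t)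
      = τ⁻¹ • ∫ s in t..t + τ, (h t - h s) := by
    rw [h1, intervalIntegral.integral_sub (by simp) (hi _ _), intervalIntegral.integral_const,
      add_sub_cancel_left, smul_sub, smul_sub, smul_smul, inv_mul_cancel₀ hτ0.ne', one_smul]
    abel
  rw [h2, norm_smul, norm_inv, Real.norm_of_nonneg hτ0.le, inv_mul_le_iff₀ hτ0, mul_comm]
  have h3 := intervalIntegral.norm_integral_le_of_norm_le_const (a := t) (b := t + τ)
    (f := fun s => h t - h s) (C := ε) (fun s hs => by
      rw [uIoc_of_le (by linarith)] at hs
      rw [← dist_eq_norm]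
      refine (hu t ⟨ht.1, by linarith [ht.2]⟩ s ⟨by linarith [ht.1, hs.1], by
        linarith [ht.2, hs.2]⟩ ?_).le
      rw [Real.dist_eq, abs_sub_comm, abs_of_nonneg (by linarith [hs.1])]
      linarith [hs.2])
  rwa [add_sub_cancel_left, abs_of_pos hτ0] at h3

/-- If primitives converge pointwise and the functions are bounded in `L¹`, then they converge
weakly against continuous functions. -/
theorem tendsto_integral_inner_of_prim (hab : a ≤ b) {p : ℕ → ℝ → Euc N} {q : ℝ → Euc N}
    (hp : ∀ n, IntegrableOn (p n) (Icc a b)) (hq : IntegrableOn q (Icc a b)) {C : ℝ}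
    (hC : ∀ n, ∫ t in Icc a b, ‖p n t‖ ≤ C)
    (hlim : ∀ t ∈ Icc a b, Tendsto (fun n => prim a (p n) t) atTop (𝓝 (prim a q t)))
    {h : ℝ → Euc N} (hh : Continuous h) :
    Tendsto (fun n => ∫ t in Icc a b, inner ℝ (p n t) (h t)) atTop
      (𝓝 (∫ t in Icc a b, inner ℝ (q t) (h t))) := by
  have hint : ∀ {r k : ℝ → Euc N}, IntegrableOn r (Icc a b) → ContinuousOn k (Icc a b) →
      IntegrableOn (fun t => (inner ℝ (r t) (k t) : ℝ)) (Icc a b) := by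
    intro r k hr hk
    obtain ⟨B, hB⟩ := isCompact_Icc.exists_bound_of_continuousOn hk
    refine (hr.norm.mul_const B).mono'
      (hr.aestronglyMeasurable.inner (hk.aestronglyMeasurable measurableSet_Icc)) ?_
    filter_upwards [ae_restrict_mem measurableSet_Icc] with t ht
    exact (norm_inner_le_norm _ _).trans (mul_le_mul_of_nonneg_left (hB t ht) (norm_nonneg _))
  have hb : b ∈ Icc a b := ⟨hab, le_rfl⟩
  -- Against `c + prim k`, integration by parts leaves only the primitives of `p n`, whose pointwise
  -- convergence and common bound permit dominated convergence.
  have hsmooth : ∀ (c : Euc N) (k : ℝ → Euc N), Continuous k →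
      Tendsto (fun n => ∫ t in Icc a b, inner ℝ (p n t) (c + prim a k t)) atTop
      (𝓝 (∫ t in Icc a b, inner ℝ (q t) (c + prim a k t))) := by
    intro c k hk
    have hkI : IntegrableOn k (Icc a b) := hk.continuousOn.integrableOn_Icc
    have hform : ∀ {r : ℝ → Euc N}, IntegrableOn r (Icc a b) →
        ∫ t in Icc a b, inner ℝ (r t) (c + prim a k t)
          = inner ℝ (prim a r b) (c + prim a k b) - ∫ t in Icc a b, inner ℝ (prim a r t) (k t) := by
      intro r hr
      have h1 := integral_inner_prim_add hab hr hkI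
      rw [integral_add (hint hr (continuous_prim hk).continuousOn) (by
        simpa only [real_inner_comm, IntegrableOn] using hint hkI (continuousOn_prim hab hr))] at h1
      simp_rw [inner_add_right]
      rw [integral_add (hr.inner_const c) (hint hr (continuous_prim hk).continuousOn), ← h1]
      have h2 : ∫ t in Icc a b, inner ℝ (r t) c = (inner ℝ (prim a r b) c : ℝ) := by
        simp_rw [real_inner_comm c]
        rw [integral_inner hr, setIntegral_Icc_eq hab]
        rfl
      rw [h2]
      ring
    simp_rw [hform (hp _), hform hq]
    refine ((hlim b hb).inner tendsto_const_nhds).sub ?_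
    obtain ⟨B, hB⟩ := isCompact_Icc.exists_bound_of_continuousOn (s := Icc a b) hk.continuousOn
    refine tendsto_integral_of_dominated_convergence (fun _ => C * B) (fun n => ?_)
      (integrable_const _) (fun n => ?_) ?_
    · exact ((continuousOn_prim hab (hp n)).aestronglyMeasurable measurableSet_Icc).inner
        hk.aestronglyMeasurable
    · filter_upwards [ae_restrict_mem measurableSet_Icc] with t ht
      refine (norm_inner_le_norm _ _).trans ?_
      have h1 := (norm_prim_le (hp n) ht).trans (hC n)
      exact mul_le_mul h1 (hB t ht) (norm_nonneg _) ((norm_nonneg _).trans h1)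
    · filter_upwards [ae_restrict_mem measurableSet_Icc] with t ht
      exact (hlim t ht).inner tendsto_const_nhds
  rw [Metric.tendsto_atTop]
  intro ε hε
  -- One positive constant dominating all the `L¹` norms, including that of `q`, so that replacing
  -- `h` by its approximation costs at most `ε / 4` on each side.
  set C' := max C 0 + (∫ t in Icc a b, ‖q t‖) + 1 with hC'
  have hq0 : 0 ≤ ∫ t in Icc a b, ‖q t‖ := integral_nonneg fun _ => norm_nonneg _
  have hC'0 : 0 < C' := by positivity
  obtain ⟨c, k, hk, happ⟩ := exists_prim_approx hh a b (ε := ε / (4 * C')) (by positivity)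
  obtain ⟨n₀, hn₀⟩ := Metric.tendsto_atTop.1 (hsmooth c k hk) (ε / 2) (by positivity)
  refine ⟨n₀, fun n hn => ?_⟩
  have herr : ∀ {r : ℝ → Euc N}, IntegrableOn r (Icc a b) → ∫ t in Icc a b, ‖r t‖ ≤ C' →
      |(∫ t in Icc a b, inner ℝ (r t) (h t)) - ∫ t in Icc a b, inner ℝ (r t) (c + prim a k t)|
        ≤ ε / 4 := by
    intro r hr hrC
    have hk' : ContinuousOn (fun t => c + prim a k t) (Icc a b) :=
      (continuous_const.add (continuous_prim hk)).continuousOn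
    rw [← integral_sub (hint hr hh.continuousOn) (hint hr hk')]
    calc |∫ t in Icc a b, ((inner ℝ (r t) (h t) : ℝ) - inner ℝ (r t) (c + prim a k t))|
        ≤ ∫ t in Icc a b, ‖r t‖ * (ε / (4 * C')) := by
          refine norm_integral_le_of_norm_le (f := fun t =>
            (inner ℝ (r t) (h t) : ℝ) - inner ℝ (r t) (c + prim a k t)) (hr.norm.mul_const _) ?_
          filter_upwards [ae_restrict_mem measurableSet_Icc] with t ht
          rw [← inner_sub_right]
          exact (norm_inner_le_norm _ _).trans
            (mul_le_mul_of_nonneg_left (happ t ht) (norm_nonneg _))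
      _ = (∫ t in Icc a b, ‖r t‖) * (ε / (4 * C')) := integral_mul_const _ _
      _ ≤ C' * (ε / (4 * C')) := mul_le_mul_of_nonneg_right hrC (by positivity)
      _ = ε / 4 := by field_simp
  have h1 := herr (hp n) ((hC n).trans (by rw [hC']; linarith [le_max_left C 0]))
  have h2 := herr hq (by rw [hC']; linarith [le_max_right C 0])
  have h3 := hn₀ n hn
  rw [Real.dist_eq] at h3 ⊢
  rw [abs_le] at h1 h2
  rw [abs_lt] at h3 ⊢
  constructor <;> linarith [h1.1, h1.2, h2.1, h2.2, h3.1, h3.2]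

end AbsolutelyContinuous

/-! ### Compactness of curves with bounded modular -/

section Compactness

variable {a b : ℝ} {G : Euc N → ℝ}

theorem sum_abs_integral_le (hab : a ≤ b) {φ : ℝ → ℝ} (hφ : IntegrableOn φ (Icc a b))
    (h0 : ∀ t, 0 ≤ φ t) {E : ℕ × (ℕ → ℝ × ℝ)}
    (hE : E ∈ AbsolutelyContinuousOnInterval.disjWithin a b) :
    ∑ i ∈ Finset.range E.1, |∫ t in (E.2 i).1..(E.2 i).2, φ t| ≤ ∫ t in Icc a b, φ t := by
  have hsub : ∀ i ∈ Finset.range E.1, uIoc (E.2 i).1 (E.2 i).2 ⊆ Icc a b := fun i hi => by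
    have h1 := hE.1 i hi
    rw [uIcc_of_le hab] at h1
    exact uIoc_subset_uIcc.trans (uIcc_subset_Icc h1.1 h1.2)
  have h1 : ∀ i ∈ Finset.range E.1, |∫ t in (E.2 i).1..(E.2 i).2, φ t|
      = ∫ t in uIoc (E.2 i).1 (E.2 i).2, φ t := fun i _ => by
    rw [intervalIntegral.abs_integral_eq_abs_integral_uIoc,
      abs_of_nonneg (integral_nonneg fun t => h0 t)]
  rw [Finset.sum_congr rfl h1, ← integral_biUnion_finset _ (fun _ _ => measurableSet_uIoc) hE.2
    (fun i hi => hφ.mono_set (hsub i hi))]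
  exact setIntegral_mono_set hφ (Eventually.of_forall h0)
    (LE.le.eventuallyLE (iUnion₂_subset hsub))

/-- The de la Vallée Poussin form of superlinearity. With `η` small it yields equicontinuity and
equi-absolute continuity from a modular bound. -/
theorem IsGFunction.exists_norm_le (hG : IsGFunction G) {η : ℝ} (hη : 0 < η) :
    ∃ c, 0 ≤ c ∧ ∀ v, ‖v‖ ≤ η * G v + c := by
  obtain ⟨c, hc, h⟩ := hG.mul_norm_le η⁻¹
  refine ⟨η * c, by positivity, fun v => ?_⟩
  have := mul_le_mul_of_nonneg_left (h v) hη.le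
  rw [← mul_assoc, mul_inv_cancel₀ hη.ne', one_mul] at this
  linarith

theorem IsGFunction.integral_norm_le (hG : IsGFunction G) (hab : a ≤ b) :
    ∃ c, 0 ≤ c ∧ ∀ v : ℝ → Euc N, IntegrableOn v (Icc a b) →
      IntegrableOn (fun t => G (v t)) (Icc a b) →
      ∫ t in Icc a b, ‖v t‖ ≤ (∫ t in Icc a b, G (v t)) + c := by
  obtain ⟨c, hc, h⟩ := hG.mul_norm_le 1
  refine ⟨c * (b - a), mul_nonneg hc (sub_nonneg.2 hab), fun v hv hGv => ?_⟩
  have h1 : ∫ t in Icc a b, ‖v t‖ ≤ ∫ t in Icc a b, (G (v t) + c) :=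
    integral_mono hv.norm (hGv.add (integrable_const c)) fun t => by simpa using h (v t)
  rw [integral_add hGv (integrable_const c)] at h1
  simpa [hab, mul_comm] using h1

theorem IsGFunction.integrableOn_of_modular (hG : IsGFunction G) {v : ℝ → Euc N}
    (hv : AEStronglyMeasurable v (volume.restrict (Icc a b)))
    (hGv : IntegrableOn (fun t => G (v t)) (Icc a b)) : IntegrableOn v (Icc a b) := by
  obtain ⟨c, hc, h⟩ := hG.mul_norm_le 1
  refine (hGv.add (integrable_const c)).mono' hv (Eventually.of_forall fun t => ?_)
  simpa using h (v t)

/-- The modular part is small through `η`, uniformly in the function, and the remainder is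
proportional to the length of the interval. -/
theorem IsGFunction.norm_prim_sub_le (hG : IsGFunction G) {η c M : ℝ} (hη : 0 < η)
    (hc : ∀ v, ‖v‖ ≤ η * G v + c) {v : ℝ → Euc N} (hv : IntegrableOn v (Icc a b))
    (hGv : IntegrableOn (fun t => G (v t)) (Icc a b)) (hM : ∫ t in Icc a b, G (v t) ≤ M)
    {s t : ℝ} (hs : s ∈ Icc a b) (ht : t ∈ Icc a b) :
    ‖prim a v t - prim a v s‖ ≤ η * M + c * |t - s| := by
  wlog hst : s ≤ t generalizing s t
  · rw [norm_sub_rev, abs_sub_comm]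
    exact this ht hs (le_of_not_ge hst)
  have hGi := intervalIntegrable_of_mem hGv hs ht
  rw [prim_sub_prim hv hs ht]
  calc ‖∫ r in s..t, v r‖ ≤ ∫ r in s..t, (η * G (v r) + c) :=
        intervalIntegral.norm_integral_le_of_norm_le hst
          (Eventually.of_forall fun r _ => hc _) ((hGi.const_mul η).add (by simp))
    _ = η * (∫ r in s..t, G (v r)) + c * |t - s| := by
        rw [intervalIntegral.integral_add (hGi.const_mul η) (by simp),
          intervalIntegral.integral_const_mul, intervalIntegral.integral_const,
          abs_of_nonneg (sub_nonneg.2 hst), smul_eq_mul, mul_comm c]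
    _ ≤ η * M + c * |t - s| := by
        refine add_le_add (mul_le_mul_of_nonneg_left (le_trans ?_ hM) hη.le) le_rfl
        rw [intervalIntegral.integral_of_le hst]
        exact setIntegral_mono_set hGv (Eventually.of_forall fun r => hG.nonneg _)
          (LE.le.eventuallyLE (Ioc_subset_Icc_self.trans (Icc_subset_Icc hs.1 ht.2)))

/-- Arzelà-Ascoli: the estimate for increments with `η = 1` gives a common bound, and choosing `η`
first and the length afterwards gives equicontinuity. -/
theorem IsGFunction.exists_subseq_tendstoUniformlyOn (hG : IsGFunction G) (hab : a ≤ b)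
    {v : ℕ → ℝ → Euc N} (hv : ∀ n, Continuous (v n)) {M : ℝ}
    (hM : ∀ n, ∫ t in Icc a b, G (v n t) ≤ M) :
    ∃ u : ℝ → Euc N, Continuous u ∧ ∃ σ : ℕ → ℕ, StrictMono σ ∧
      TendstoUniformlyOn (fun n => prim a (v (σ n))) u atTop (Icc a b) := by
  have hvi : ∀ n, IntegrableOn (v n) (Icc a b) := fun n => (hv n).continuousOn.integrableOn_Icc
  have hGi : ∀ n, IntegrableOn (fun t => G (v n t)) (Icc a b) := fun n =>
    (hG.continuous.comp (hv n)).continuousOn.integrableOn_Icc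
  have hM0 : 0 ≤ M := (integral_nonneg fun t => hG.nonneg _).trans (hM 0)
  let U : ℕ → BoundedContinuousFunction (Icc a b) (Euc N) := fun n =>
    BoundedContinuousFunction.mkOfCompact
      ⟨fun t => prim a (v n) t, (continuous_prim (hv n)).comp continuous_subtype_val⟩
  have hUapp : ∀ n t, U n t = prim a (v n) t := fun n t => rfl
  obtain ⟨c₁, hc₁, hle₁⟩ := hG.exists_norm_le one_pos
  have hcomp : IsCompact (closure (range U)) := by
    refine BoundedContinuousFunction.arzela_ascoli
      (Metric.closedBall 0 (1 * M + c₁ * (b - a))) (isCompact_closedBall _ _) (range U) ?_ ?_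
    · rintro _ t ⟨n, rfl⟩
      rw [mem_closedBall_zero_iff, hUapp]
      have h1 := hG.norm_prim_sub_le one_pos hle₁ (hvi n) (hGi n) (hM n) ⟨le_rfl, hab⟩ t.2
      have h2 : prim a (v n) a = 0 := by simp [prim]
      rw [h2, sub_zero] at h1
      refine h1.trans (add_le_add le_rfl (mul_le_mul_of_nonneg_left ?_ hc₁))
      rw [abs_of_nonneg (sub_nonneg.2 t.2.1)]
      linarith [t.2.2]
    · intro t₀
      rw [Metric.equicontinuousAt_iff]
      intro ε hε
      obtain ⟨c, hc, hle⟩ := hG.exists_norm_le (η := ε / (2 * (M + 1))) (by positivity)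
      refine ⟨ε / (2 * (c + 1)), by positivity, ?_⟩
      rintro t ht ⟨_, n, rfl⟩
      rw [dist_eq_norm]
      change ‖prim a (v n) t₀ - prim a (v n) t‖ < ε
      have h1 := hG.norm_prim_sub_le (by positivity) hle (hvi n) (hGi n) (hM n) t.2 t₀.2
      rw [Subtype.dist_eq, Real.dist_eq, abs_sub_comm] at ht
      have h2 : ε / (2 * (M + 1)) * M < ε / 2 := by
        rw [div_mul_eq_mul_div, div_lt_div_iff₀ (by positivity) (by positivity)]
        nlinarith
      have h3 : c * |(t₀ : ℝ) - t| ≤ ε / 2 := by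
        calc c * |(t₀ : ℝ) - t| ≤ (c + 1) * (ε / (2 * (c + 1))) :=
              mul_le_mul (by linarith) ht.le (abs_nonneg _) (by positivity)
          _ = ε / 2 := by field_simp
      linarith
  obtain ⟨w, -, σ, hσ, hw⟩ := hcomp.tendsto_subseq (x := U) fun n =>
    subset_closure (mem_range_self n)
  refine ⟨IccExtend hab w, w.continuous.Icc_extend', σ, hσ, ?_⟩
  rw [Metric.tendstoUniformlyOn_iff]
  intro ε hε
  filter_upwards [(tendsto_iff_dist_tendsto_zero.1 hw).eventually_lt_const hε] with n hn t ht
  rw [IccExtend_of_mem hab _ ht, dist_comm]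
  exact lt_of_le_of_lt (BoundedContinuousFunction.dist_coe_le_dist (f := U (σ n)) (g := w)
    ⟨t, ht⟩) hn

/-- The absolute continuity estimate holds with the same constants for all primitives. For a fixed
finite family of intervals it passes to the pointwise limit. -/
theorem IsGFunction.absolutelyContinuous_of_tendsto (hG : IsGFunction G) (hab : a ≤ b)
    {v : ℕ → ℝ → Euc N} (hv : ∀ n, Continuous (v n)) {M : ℝ}
    (hM : ∀ n, ∫ t in Icc a b, G (v n t) ≤ M) {u : ℝ → Euc N}
    (hu : ∀ t ∈ Icc a b, Tendsto (fun n => prim a (v n) t) atTop (𝓝 (u t))) :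
    AbsolutelyContinuousOnInterval u a b := by
  have hvi : ∀ n, IntegrableOn (v n) (Icc a b) := fun n => (hv n).continuousOn.integrableOn_Icc
  have hGi : ∀ n, IntegrableOn (fun t => G (v n t)) (Icc a b) := fun n =>
    (hG.continuous.comp (hv n)).continuousOn.integrableOn_Icc
  have hM0 : 0 ≤ M := (integral_nonneg fun t => hG.nonneg _).trans (hM 0)
  rw [absolutelyContinuousOnInterval_iff]
  intro ε hε
  obtain ⟨c, hc, hle⟩ := hG.exists_norm_le (η := ε / (4 * (M + 1))) (by positivity)
  set η := ε / (4 * (M + 1)) with hη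
  have hη0 : 0 < η := by positivity
  refine ⟨ε / (4 * (c + 1)), by positivity, fun E hE hlen => ?_⟩
  have hmem : ∀ i ∈ Finset.range E.1, (E.2 i).1 ∈ Icc a b ∧ (E.2 i).2 ∈ Icc a b := by
    intro i hi
    have := hE.1 i hi
    rwa [uIcc_of_le hab] at this
  have hn : ∀ n, ∑ i ∈ Finset.range E.1,
      dist (prim a (v n) (E.2 i).1) (prim a (v n) (E.2 i).2) ≤ ε / 2 := by
    intro n
    calc ∑ i ∈ Finset.range E.1, dist (prim a (v n) (E.2 i).1) (prim a (v n) (E.2 i).2)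
        ≤ ∑ i ∈ Finset.range E.1, (η * |∫ t in (E.2 i).1..(E.2 i).2, G (v n t)|
            + c * dist (E.2 i).1 (E.2 i).2) := by
          refine Finset.sum_le_sum fun i hi => ?_
          obtain ⟨hx, hy⟩ := hmem i hi
          rw [dist_comm, dist_eq_norm, prim_sub_prim (hvi n) hx hy]
          have hGii := intervalIntegrable_of_mem (hGi n) hx hy
          have h1 : ‖∫ t in (E.2 i).1..(E.2 i).2, v n t‖
              ≤ |∫ t in (E.2 i).1..(E.2 i).2, (η * G (v n t) + c)| :=
            intervalIntegral.norm_integral_le_abs_of_norm_le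
              (Eventually.of_forall fun t => hle (v n t))
              ((hGii.const_mul η).add (by simp))
          rw [intervalIntegral.integral_add (hGii.const_mul η) (by simp),
            intervalIntegral.integral_const_mul, intervalIntegral.integral_const] at h1
          refine h1.trans ((abs_add_le _ _).trans (le_of_eq ?_))
          rw [abs_mul, abs_of_pos hη0, smul_eq_mul, abs_mul, abs_of_nonneg hc, dist_comm,
            Real.dist_eq, mul_comm c]
      _ = η * ∑ i ∈ Finset.range E.1, |∫ t in (E.2 i).1..(E.2 i).2, G (v n t)|
            + c * ∑ i ∈ Finset.range E.1, dist (E.2 i).1 (E.2 i).2 := by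
          rw [Finset.sum_add_distrib, Finset.mul_sum, Finset.mul_sum]
      _ ≤ η * M + c * (ε / (4 * (c + 1))) := by
          refine add_le_add (mul_le_mul_of_nonneg_left ?_ hη0.le)
            (mul_le_mul_of_nonneg_left hlen.le hc)
          exact (sum_abs_integral_le hab (hGi n) (fun t => hG.nonneg _) hE).trans (hM n)
      _ ≤ ε / 4 + ε / 4 := by
          refine add_le_add ?_ ?_
          · rw [hη, div_mul_eq_mul_div, div_le_div_iff₀ (by positivity) (by positivity)]
            nlinarith
          · rw [mul_div_assoc', div_le_div_iff₀ (by positivity) (by positivity)]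
            nlinarith
      _ = ε / 2 := by ring
  have hlim : Tendsto (fun n => ∑ i ∈ Finset.range E.1,
      dist (prim a (v n) (E.2 i).1) (prim a (v n) (E.2 i).2)) atTop
      (𝓝 (∑ i ∈ Finset.range E.1, dist (u (E.2 i).1) (u (E.2 i).2))) :=
    tendsto_finsetSum _ fun i hi => (hu _ (hmem i hi).1).dist (hu _ (hmem i hi).2)
  linarith [le_of_tendsto' hlim hn]

/-- The averaged modular of the difference quotients of a primitive is controlled by the modular
of the function. -/
theorem IsGFunction.integral_slope_prim_le (hG : IsGFunction G) {v : ℝ → Euc N}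
    (hv : Continuous v) {M τ : ℝ} (hM : ∫ t in Icc a b, G (v t) ≤ M) (hτ : 0 < τ)
    (hτb : τ ≤ b - a) :
    ∫ t in a..b - τ, G (τ⁻¹ • (prim a v (t + τ) - prim a v t)) ≤ M := by
  have hGv : Continuous fun t => G (v t) := hG.continuous.comp hv
  let Γ : ℝ → ℝ := fun t => ∫ s in a..t, G (v s)
  have hi : ∀ x y, IntervalIntegrable (fun t => G (v t)) volume x y :=
    fun x y => hGv.intervalIntegrable x y
  have hΓc : Continuous Γ := continuous_iff_continuousAt.2 fun t =>
    (hGv.integral_hasStrictDerivAt a t).hasDerivAt.continuousAt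
  have hΓi : ∀ x y, IntervalIntegrable Γ volume x y := fun x y => hΓc.intervalIntegrable x y
  have hpc := continuous_prim (a := a) hv
  have h1 : ∫ t in a..b - τ, G (τ⁻¹ • (prim a v (t + τ) - prim a v t))
      ≤ ∫ t in a..b - τ, τ⁻¹ * (Γ (t + τ) - Γ t) := by
    refine intervalIntegral.integral_mono_on (by linarith) ?_ ?_ fun t ht => ?_
    · exact (hG.continuous.comp (by fun_prop)).intervalIntegrable _ _
    · exact Continuous.intervalIntegrable (by fun_prop) _ _
    · have h2 := hG.map_average_le (s := t) (t := t + τ) (by linarith)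
        hv.continuousOn.integrableOn_Icc hGv.continuousOn.integrableOn_Icc
      rw [add_sub_cancel_left] at h2
      have h3 : prim a v (t + τ) - prim a v t = ∫ r in t..t + τ, v r :=
        intervalIntegral.integral_interval_sub_left (hv.intervalIntegrable _ _)
          (hv.intervalIntegrable _ _)
      have h4 : Γ (t + τ) - Γ t = ∫ r in t..t + τ, G (v r) :=
        intervalIntegral.integral_interval_sub_left (hi _ _) (hi _ _)
      rwa [h3, h4]
  -- After a shift of variable only the two boundary layers of length `τ` remain. The left one is
  -- nonnegative and is dropped; the right one is at most `τ * M`.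
  have h5 : ∫ t in a..b - τ, τ⁻¹ * (Γ (t + τ) - Γ t)
      = τ⁻¹ * ((∫ t in b - τ..b, Γ t) - ∫ t in a..a + τ, Γ t) := by
    rw [intervalIntegral.integral_const_mul, intervalIntegral.integral_sub
      (Continuous.intervalIntegrable (by fun_prop) _ _) (hΓi _ _),
      intervalIntegral.integral_comp_add_right, sub_add_cancel]
    rw [← intervalIntegral.integral_add_adjacent_intervals (hΓi (a + τ) (b - τ)) (hΓi (b - τ) b),
      ← intervalIntegral.integral_add_adjacent_intervals (hΓi a (a + τ)) (hΓi (a + τ) (b - τ))]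
    ring
  have hΓ0 : 0 ≤ ∫ t in a..a + τ, Γ t := intervalIntegral.integral_nonneg (by linarith)
    fun t ht => intervalIntegral.integral_nonneg ht.1 fun s _ => hG.nonneg _
  have hΓM : ∫ t in b - τ..b, Γ t ≤ τ * M := by
    have h6 : ∫ t in b - τ..b, Γ t ≤ ∫ t in b - τ..b, M := by
      refine intervalIntegral.integral_mono_on (by linarith) (hΓi _ _) (by simp) fun t ht => ?_
      refine le_trans ?_ hM
      simp only [Γ]
      rw [intervalIntegral.integral_of_le (by linarith [ht.1])]
      exact setIntegral_mono_set hGv.continuousOn.integrableOn_Icc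
        (Eventually.of_forall fun r => hG.nonneg _)
        (LE.le.eventuallyLE (Ioc_subset_Icc_self.trans (Icc_subset_Icc le_rfl ht.2)))
    simpa using h6
  rw [h5] at h1
  refine h1.trans ?_
  rw [inv_mul_le_iff₀ hτ]
  linarith

/-- Difference quotients replace weak compactness. For a fixed step their modular is at most `M` by
Jensen's inequality and passes to the limit in `n`; Fatou's lemma then lets the step tend to `0`,
using differentiability almost everywhere of the limit. -/
theorem IsGFunction.lintegral_deriv_le_of_tendsto (hG : IsGFunction G) (hab : a < b)
    {v : ℕ → ℝ → Euc N} (hv : ∀ n, Continuous (v n)) {M : ℝ}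
    (hM : ∀ n, ∫ t in Icc a b, G (v n t) ≤ M) {u : ℝ → Euc N} (huc : Continuous u)
    (hu : ∀ t ∈ Icc a b, Tendsto (fun n => prim a (v n) t) atTop (𝓝 (u t))) :
    ∫⁻ t in Icc a b, ENNReal.ofReal (G (deriv u t)) ≤ ENNReal.ofReal M := by
  have hvi : ∀ n, IntegrableOn (v n) (Icc a b) := fun n => (hv n).continuousOn.integrableOn_Icc
  have hGi : ∀ n, IntegrableOn (fun t => G (v n t)) (Icc a b) := fun n =>
    (hG.continuous.comp (hv n)).continuousOn.integrableOn_Icc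
  have hac := hG.absolutelyContinuous_of_tendsto hab.le hv hM hu
  have hslope : ∀ τ : ℝ, 0 < τ → τ ≤ b - a →
      ∫ t in a..b - τ, G (τ⁻¹ • (u (t + τ) - u t)) ≤ M := by
    intro τ hτ hτb
    obtain ⟨c, hc, hle⟩ := hG.integral_norm_le hab.le
    have hbound : ∀ n, ∀ t ∈ Icc a b, ‖prim a (v n) t‖ ≤ M + c := fun n t ht =>
      (norm_prim_le (hvi n) ht).trans ((hle _ (hvi n) (hGi n)).trans (by linarith [hM n]))
    have hsub : Icc a (b - τ) ⊆ Icc a b := Icc_subset_Icc_right (by linarith)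
    have hlim := tendsto_integral_comp (N := N) (l := atTop) (a := a) (b := b - τ) (R := M + c)
      (Ψ := fun _ x y => G (τ⁻¹ • (x - y)))
      (x := fun n t => prim a (v n) (t + τ)) (v := fun n t => prim a (v n) t)
      (x₀ := fun t => u (t + τ)) (v₀ := u)
      (hG.continuous.comp (by fun_prop))
      (fun n => ((continuous_prim (hv n)).comp (continuous_add_const τ)).aestronglyMeasurable)
      (fun n => (continuous_prim (hv n)).aestronglyMeasurable)
      (Eventually.of_forall fun n t ht => hbound n _ ⟨by linarith [ht.1], by linarith [ht.2]⟩)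
      (Eventually.of_forall fun n t ht => hbound n _ (hsub ht))
      (fun t ht => hu _ ⟨by linarith [ht.1], by linarith [ht.2]⟩)
      (by
        filter_upwards [ae_restrict_mem measurableSet_Icc] with t ht
        exact hu t (hsub ht))
    rw [setIntegral_Icc_eq (by linarith)] at hlim
    refine le_of_tendsto' hlim fun n => ?_
    rw [setIntegral_Icc_eq (by linarith)]
    exact hG.integral_slope_prim_le (hv n) (hM n) hτ hτb
  let τ : ℕ → ℝ := fun k => ((k : ℝ) + 1)⁻¹
  have hτ0 : ∀ k, 0 < τ k := fun k => by positivity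
  have hτlim : Tendsto τ atTop (𝓝 0) := by
    have := tendsto_one_div_add_atTop_nhds_zero_nat (𝕜 := ℝ)
    simpa [τ] using this
  let q : ℕ → ℝ → ENNReal := fun k => (Icc a (b - τ k)).indicator
    fun t => ENNReal.ofReal (G ((τ k)⁻¹ • (u (t + τ k) - u t)))
  have hqc : ∀ k, Continuous fun t => G ((τ k)⁻¹ • (u (t + τ k) - u t)) := fun k =>
    hG.continuous.comp (by fun_prop)
  have hqm : ∀ k, Measurable (q k) := fun k =>
    (ENNReal.measurable_ofReal.comp (hqc k).measurable).indicator measurableSet_Icc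
  have hqle : ∀ k, ∫⁻ t in Icc a b, q k t ≤ ENNReal.ofReal M := by
    intro k
    have hsub : Icc a (b - τ k) ⊆ Icc a b := Icc_subset_Icc_right (by linarith [hτ0 k])
    rw [lintegral_indicator measurableSet_Icc, Measure.restrict_restrict measurableSet_Icc,
      inter_eq_left.2 hsub]
    by_cases hk : τ k ≤ b - a
    · rw [← ofReal_integral_eq_lintegral_ofReal (hqc k).continuousOn.integrableOn_Icc
        (Eventually.of_forall fun t => hG.nonneg _)]
      refine ENNReal.ofReal_le_ofReal ?_
      rw [setIntegral_Icc_eq (by linarith)]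
      exact hslope _ (hτ0 k) hk
    · rw [Icc_eq_empty (by linarith)]
      simp
  have hlim : ∀ᵐ t ∂volume.restrict (Icc a b),
      ENNReal.ofReal (G (deriv u t)) = liminf (fun k => q k t) atTop := by
    have hd := hac.boundedVariationOn.ae_differentiableAt_of_mem_uIcc
    rw [uIcc_of_le hab.le] at hd
    -- Away from `b`, the point `t` lies in `[a, b - τ k]` for all large `k`, so the indicator is
    -- eventually `1`.
    have hb : ∀ᵐ t : ℝ, t ≠ b := by simp [ae_iff, measure_singleton]
    rw [ae_restrict_iff' measurableSet_Icc]
    filter_upwards [hd, hb] with t ht htb hmem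
    refine (Tendsto.liminf_eq ?_).symm
    have h1 : Tendsto (fun k => (τ k)⁻¹ • (u (t + τ k) - u t)) atTop (𝓝 (deriv u t)) := by
      have h2 := hasDerivAt_iff_tendsto_slope_zero.1 (ht hmem).hasDerivAt
      refine h2.comp (tendsto_nhdsWithin_iff.2 ⟨hτlim, Eventually.of_forall fun k => ?_⟩)
      exact (hτ0 k).ne'
    refine ((ENNReal.continuous_ofReal.tendsto _).comp
      ((hG.continuous.tendsto _).comp h1)).congr' ?_
    have hpos : 0 < b - t := sub_pos.2 (lt_of_le_of_ne hmem.2 htb)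
    filter_upwards [hτlim.eventually_lt_const hpos] with k hk
    have hmem' : t ∈ Icc a (b - τ k) := ⟨hmem.1, by linarith⟩
    simp [q, indicator_of_mem hmem']
  rw [lintegral_congr_ae hlim]
  refine (lintegral_liminf_le hqm).trans ?_
  exact liminf_le_of_le (by isBoundedDefault) fun c hc => by
    obtain ⟨k, hk⟩ := hc.exists
    exact hk.trans (hqle k)

theorem eq_add_prim_deriv (hab : a ≤ b) {u : ℝ → Euc N}
    (hac : AbsolutelyContinuousOnInterval u a b) (hint : IntegrableOn (deriv u) (Icc a b))
    {t : ℝ} (ht : t ∈ Icc a b) : u t = u a + prim a (deriv u) t := by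
  have hac' := hac.sub (prim_absolutelyContinuous hab hint)
  obtain ⟨C, hC⟩ := hac'.const_of_ae_hasDerivAt_zero (by
    have h1 := ae_hasDerivAt_prim hab hint
    rw [ae_restrict_iff' measurableSet_Icc] at h1
    rw [uIcc_of_le hab]
    have h2 := hac.boundedVariationOn.ae_differentiableAt_of_mem_uIcc
    rw [uIcc_of_le hab] at h2
    filter_upwards [h1, h2] with s hs₁ hs₂ hmem
    simpa using (hs₂ hmem).hasDerivAt.sub (hs₁ hmem))
  rw [uIcc_of_le hab] at hC
  have h1 := hC t ht
  have h2 := hC a ⟨le_rfl, hab⟩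
  simp only [Pi.sub_apply] at h1 h2
  have h3 : prim a (deriv u) a = 0 := by simp [prim]
  rw [h3, sub_zero] at h2
  rw [h2, ← h1]
  abel

end Compactness

/-! ### Modular approximation by continuous velocities of zero mean -/

section Approximation

variable {a b : ℝ} {G : Euc N → ℝ}

/-- The radial projection onto the ball of radius `R`. -/
def ballProj (R : ℝ) (y : Euc N) : Euc N := (R / max R ‖y‖) • y

theorem continuous_ballProj {R : ℝ} (hR : 0 < R) : Continuous (ballProj (N := N) R) := by
  unfold ballProj
  refine Continuous.smul (Continuous.div continuous_const (continuous_const.max continuous_norm)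
    fun y => ?_) continuous_id
  exact (lt_max_of_lt_left hR).ne'

theorem norm_ballProj_le {R : ℝ} (hR : 0 < R) (y : Euc N) : ‖ballProj R y‖ ≤ R := by
  have h : 0 < max R ‖y‖ := lt_max_of_lt_left hR
  rw [ballProj, norm_smul, norm_div, Real.norm_of_nonneg hR.le, Real.norm_of_nonneg h.le,
    div_mul_eq_mul_div, div_le_iff₀ h]
  exact mul_le_mul_of_nonneg_left (le_max_right _ _) hR.le

theorem ballProj_of_norm_le {R : ℝ} (hR : 0 < R) {y : Euc N} (hy : ‖y‖ ≤ R) :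
    ballProj R y = y := by
  rw [ballProj, max_eq_left hy, div_self hR.ne', one_smul]

/-- A bounded function with zero mean is an almost everywhere limit of uniformly bounded
continuous functions with zero mean. -/
theorem exists_continuous_tendsto_ae (hab : a < b) {w : ℝ → Euc N} {R : ℝ} (hR : 0 < R)
    (hw : AEStronglyMeasurable w (volume.restrict (Icc a b))) (hwR : ∀ t, ‖w t‖ ≤ R)
    (hw0 : ∫ t in Icc a b, w t = 0) :
    ∃ z : ℕ → ℝ → Euc N, (∀ n, Continuous (z n)) ∧ (∀ n, ∫ t in Icc a b, z n t = 0) ∧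
      (∀ n t, ‖z n t‖ ≤ R + R) ∧
      ∀ᵐ t ∂volume.restrict (Icc a b), Tendsto (fun n => z n t) atTop (𝓝 (w t)) := by
  have hwi : IntegrableOn w (Icc a b) := Integrable.of_bound hw R (Eventually.of_forall hwR)
  have happ : ∀ n : ℕ, ∃ g : BoundedContinuousFunction ℝ (Euc N),
      ∫ t in Icc a b, ‖w t - g t‖ ≤ 1 / ((n : ℝ) + 1) ∧
      Integrable g (volume.restrict (Icc a b)) := fun n =>
    hwi.exists_boundedContinuous_integral_sub_le (by positivity)
  choose g hg hgi using happ
  have hme : TendstoInMeasure (volume.restrict (Icc a b)) (fun n t => g n t) atTop w := by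
    refine tendstoInMeasure_of_tendsto_eLpNorm (p := 1) one_ne_zero
      (fun n => (hgi n).aestronglyMeasurable) hw ?_
    have h1 : ∀ n, eLpNorm ((fun t => g n t) - w) 1 (volume.restrict (Icc a b))
        ≤ ENNReal.ofReal (1 / ((n : ℝ) + 1)) := fun n => by
      rw [eLpNorm_one_eq_lintegral_enorm, ← ofReal_integral_norm_eq_lintegral_enorm
        ((hgi n).sub hwi)]
      refine ENNReal.ofReal_le_ofReal (le_trans (le_of_eq ?_) (hg n))
      exact integral_congr_ae (Eventually.of_forall fun t => norm_sub_rev _ _)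
    refine tendsto_of_tendsto_of_tendsto_of_le_of_le tendsto_const_nhds ?_
      (fun _ => bot_le) h1
    have := (ENNReal.continuous_ofReal.tendsto _).comp
      (tendsto_one_div_add_atTop_nhds_zero_nat (𝕜 := ℝ))
    simpa [Function.comp_def] using this
  obtain ⟨σ, -, hσ⟩ := hme.exists_seq_tendsto_ae
  -- Projecting onto the ball restores the uniform bound and does not disturb the limit, which
  -- already lies in the ball. Subtracting the mean restores zero mean, at the price of the bound `R
  -- + R`.
  let y : ℕ → ℝ → Euc N := fun n t => ballProj R (g (σ n) t)
  have hyc : ∀ n, Continuous (y n) := fun n => (continuous_ballProj hR).comp (g (σ n)).continuous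
  have hyR : ∀ n t, ‖y n t‖ ≤ R := fun n t => norm_ballProj_le hR _
  have hylim : ∀ᵐ t ∂volume.restrict (Icc a b), Tendsto (fun n => y n t) atTop (𝓝 (w t)) := by
    filter_upwards [hσ] with t ht
    have := ((continuous_ballProj hR).tendsto (w t)).comp ht
    rwa [ballProj_of_norm_le hR (hwR t)] at this
  let m : ℕ → Euc N := fun n => (b - a)⁻¹ • ∫ t in Icc a b, y n t
  have hba : 0 < b - a := sub_pos.2 hab
  have hmlim : Tendsto m atTop (𝓝 0) := by
    have h1 : Tendsto (fun n => ∫ t in Icc a b, y n t) atTop (𝓝 (∫ t in Icc a b, w t)) :=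
      tendsto_integral_of_dominated_convergence (fun _ => R)
        (fun n => (hyc n).aestronglyMeasurable) (integrable_const R)
        (fun n => Eventually.of_forall (hyR n)) hylim
    rw [hw0] at h1
    simpa using h1.const_smul (b - a)⁻¹
  have hvol : (volume.restrict (Icc a b)).real univ = b - a := by
    simp [measureReal_def, ENNReal.toReal_ofReal hba.le]
  have hmR : ∀ n, ‖m n‖ ≤ R := fun n => by
    have h1 := norm_integral_le_of_norm_le_const (μ := volume.restrict (Icc a b))
      (Eventually.of_forall (hyR n))
    rw [hvol] at h1
    rw [norm_smul, norm_inv, Real.norm_of_nonneg hba.le, inv_mul_le_iff₀ hba]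
    linarith
  refine ⟨fun n t => y n t - m n, fun n => (hyc n).sub continuous_const, fun n => ?_,
    fun n t => (norm_sub_le _ _).trans (add_le_add (hyR n t) (hmR n)), ?_⟩
  · rw [integral_sub (hyc n).continuousOn.integrableOn_Icc (integrable_const _), integral_const,
      hvol, smul_smul, mul_inv_cancel₀ hba.ne', one_smul, sub_self]
  · filter_upwards [hylim] with t ht
    simpa using ht.sub hmlim

/-- Approximation in the modular sense, tested on a Carathéodory integrand vanishing along the
function to be approximated. -/
theorem IsGFunction.exists_integral_lt (hG : IsGFunction G) (hΔ : Delta2 G) (hab : a < b)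
    {w : ℝ → Euc N} (hw : AEStronglyMeasurable w (volume.restrict (Icc a b)))
    (hGw : IntegrableOn (fun t => G (w t)) (Icc a b)) (hw0 : ∫ t in Icc a b, w t = 0)
    {ψ : ℝ → Euc N → ℝ}
    (hψm : ∀ z : ℝ → Euc N, AEStronglyMeasurable z (volume.restrict (Icc a b)) →
      AEStronglyMeasurable (fun t => ψ t (z t)) (volume.restrict (Icc a b)))
    (hψc : ∀ t, Continuous (ψ t)) (hψ0 : ∀ t, ψ t (w t) = 0)
    {D : ℝ → ℝ} (hD : IntegrableOn D (Icc a b)) {A : ℝ} (hA : 0 ≤ A)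
    (hψb : ∀ t ∈ Icc a b, ∀ z, |ψ t z| ≤ D t + A * G z)
    {𝒟 : Set (ℝ → Euc N)} (h𝒟c : ∀ z ∈ 𝒟, Continuous z)
    (h𝒟 : ∀ z : ℝ → Euc N, Continuous z → ∫ t in Icc a b, z t = 0 → ∀ ε > 0, ∃ z' ∈ 𝒟,
      ∀ t ∈ Icc a b, ‖z t - z' t‖ ≤ ε) {ε : ℝ} (hε : 0 < ε) :
    ∃ z ∈ 𝒟, ∫ t in Icc a b, ψ t (z t) < ε := by
  -- The growth bound on `ψ` makes an integrable majorant of `G (z n t)` sufficient for dominated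
  -- convergence. Each of the three approximation stages only has to provide such a majorant and a
  -- limit almost everywhere.
  have hlimit : ∀ (z : ℕ → ℝ → Euc N) (z₀ : ℝ → Euc N) (D' : ℝ → ℝ),
      (∀ n, AEStronglyMeasurable (z n) (volume.restrict (Icc a b))) →
      IntegrableOn D' (Icc a b) → (∀ n, ∀ t ∈ Icc a b, G (z n t) ≤ D' t) →
      (∀ᵐ t ∂volume.restrict (Icc a b), Tendsto (fun n => z n t) atTop (𝓝 (z₀ t))) →
      Tendsto (fun n => ∫ t in Icc a b, ψ t (z n t)) atTop (𝓝 (∫ t in Icc a b, ψ t (z₀ t))) := by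
    intro z z₀ D' hzm hD' hzD hz
    refine tendsto_integral_of_dominated_convergence (fun t => D t + A * D' t)
      (fun n => hψm _ (hzm n)) (hD.add (hD'.const_mul A)) (fun n => ?_) ?_
    · filter_upwards [ae_restrict_mem measurableSet_Icc] with t ht
      exact (hψb t ht _).trans
        (add_le_add le_rfl (mul_le_mul_of_nonneg_left (hzD n t ht) hA))
    · filter_upwards [hz] with t ht
      exact ((hψc t).tendsto _).comp ht
  have hbdd : ∀ R : ℝ, ∃ c, ∀ z : Euc N, ‖z‖ ≤ R → G z ≤ c := fun R => by
    obtain ⟨c, hc⟩ :=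
      (isCompact_closedBall (0 : Euc N) R).bddAbove_image hG.continuous.continuousOn
    exact ⟨c, fun z hz => hc (mem_image_of_mem _ (by simpa using hz))⟩
  have hba : 0 < b - a := sub_pos.2 hab
  have hvol : (volume.restrict (Icc a b)).real univ = b - a := by
    simp [measureReal_def, ENNReal.toReal_ofReal hba.le]
  have hwi := hG.integrableOn_of_modular hw hGw
  -- truncation
  obtain ⟨w₁, R, hR, hw₁, hw₁R, hw₁0, hw₁ε⟩ : ∃ (w₁ : ℝ → Euc N) (R : ℝ), 0 < R ∧
      AEStronglyMeasurable w₁ (volume.restrict (Icc a b)) ∧ (∀ t, ‖w₁ t‖ ≤ R) ∧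
      ∫ t in Icc a b, w₁ t = 0 ∧ ∫ t in Icc a b, ψ t (w₁ t) < ε := by
    let g := hw.mk w
    let y : ℕ → ℝ → Euc N := fun n => {t | ‖g t‖ ≤ n}.indicator g
    have hgm : StronglyMeasurable g := hw.stronglyMeasurable_mk
    have hset : ∀ n : ℕ, MeasurableSet {t | ‖g t‖ ≤ n} := fun n =>
      measurableSet_le hgm.norm.measurable measurable_const
    have hym : ∀ n, AEStronglyMeasurable (y n) (volume.restrict (Icc a b)) := fun n =>
      (hgm.indicator (hset n)).aestronglyMeasurable
    have hyn : ∀ n t, ‖y n t‖ ≤ n := fun n t => by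
      by_cases ht : t ∈ {t | ‖g t‖ ≤ n}
      · simpa [y, indicator_of_mem ht] using ht
      · simp [y, indicator_of_notMem ht]
    have hyg : ∀ n t, ‖y n t‖ ≤ ‖g t‖ := fun n t => norm_indicator_le_norm_self _ _
    have hylim : ∀ t, Tendsto (fun n => y n t) atTop (𝓝 (g t)) := fun t => by
      refine tendsto_const_nhds.congr' ?_
      filter_upwards [eventually_ge_atTop ⌈‖g t‖⌉₊] with n hn
      have ht : t ∈ {t | ‖g t‖ ≤ n} := (Nat.le_ceil _).trans (Nat.cast_le.2 hn)
      exact (indicator_of_mem ht g).symm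
    have hgw : g =ᵐ[volume.restrict (Icc a b)] w := hw.ae_eq_mk.symm
    have hgi : IntegrableOn g (Icc a b) := hwi.congr hgw.symm
    have hGg : IntegrableOn (fun t => G (g t)) (Icc a b) :=
      hGw.congr (hgw.symm.mono fun t ht => by simp only [ht])
    let m : ℕ → Euc N := fun n => (b - a)⁻¹ • ∫ t in Icc a b, y n t
    have hmlim : Tendsto m atTop (𝓝 0) := by
      have h1 : Tendsto (fun n => ∫ t in Icc a b, y n t) atTop (𝓝 (∫ t in Icc a b, g t)) :=
        tendsto_integral_of_dominated_convergence (fun t => ‖g t‖) hym hgi.norm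
          (fun n => Eventually.of_forall (hyg n)) (Eventually.of_forall hylim)
      rw [integral_congr_ae hgw, hw0] at h1
      simpa using h1.const_smul (b - a)⁻¹
    obtain ⟨cm, hcm⟩ := hmlim.norm.bddAbove_range
    have hmcm : ∀ n, ‖m n‖ ≤ cm := fun n => hcm (mem_range_self n)
    obtain ⟨c, hc⟩ := hbdd cm
    obtain ⟨K, hK, hadd⟩ := hG.add_le hΔ
    have hlim := hlimit (fun n t => y n t - m n) g (fun t => K * (G (g t) + c))
      (fun n => (hym n).sub aestronglyMeasurable_const)
      ((hGg.add (integrable_const c)).const_mul K)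
      (fun n t _ => by
        rw [sub_eq_add_neg]
        refine (hadd _ _).trans (mul_le_mul_of_nonneg_left (add_le_add ?_ ?_) hK.le)
        · by_cases ht : t ∈ {t | ‖g t‖ ≤ n}
          · simp [y, indicator_of_mem ht]
          · simpa [y, indicator_of_notMem ht, hG.zero] using hG.nonneg (g t)
        · rw [hG.even]
          exact hc _ (hmcm n))
      (Eventually.of_forall fun t => by simpa using (hylim t).sub hmlim)
    have hz : ∫ t in Icc a b, ψ t (g t) = 0 := by
      rw [← integral_zero ℝ ℝ]
      refine integral_congr_ae (hgw.mono fun t ht => ?_)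
      simp only [ht, hψ0]
    rw [hz] at hlim
    obtain ⟨n, hn⟩ := (hlim.eventually_lt_const hε).exists
    have hcm0 : 0 ≤ cm := (norm_nonneg _).trans (hmcm 0)
    refine ⟨fun t => y n t - m n, n + cm + 1, by positivity,
      (hym n).sub aestronglyMeasurable_const, fun t => ?_, ?_, hn⟩
    · exact (norm_sub_le _ _).trans (by linarith [hyn n t, hmcm n])
    · have hyi : IntegrableOn (y n) (Icc a b) :=
        hgi.norm.mono' (hym n) (Eventually.of_forall (hyg n))
      rw [integral_sub hyi (integrable_const _), integral_const, hvol, smul_smul,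
        mul_inv_cancel₀ hba.ne', one_smul, sub_self]
  -- continuity
  obtain ⟨z, hzc, hz0, hzR, hzlim⟩ := exists_continuous_tendsto_ae hab hR hw₁ hw₁R hw₁0
  obtain ⟨c, hc⟩ := hbdd (R + R)
  obtain ⟨n, hn⟩ := ((hlimit z w₁ (fun _ => c) (fun n => (hzc n).aestronglyMeasurable)
    (integrable_const c) (fun n t _ => hc _ (hzR n t)) hzlim).eventually_lt_const hw₁ε).exists
  -- density
  choose d hd𝒟 hd using fun k : ℕ => h𝒟 (z n) (hzc n) (hz0 n) (1 / ((k : ℝ) + 1)) (by positivity)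
  obtain ⟨c', hc'⟩ := hbdd (R + R + 1)
  have hdlim := hlimit d (z n) (fun _ => c') (fun k => (h𝒟c _ (hd𝒟 k)).aestronglyMeasurable)
    (integrable_const c')
    (fun k t ht => hc' _ (by
      have h1 : 1 / ((k : ℝ) + 1) ≤ 1 := by
        rw [div_le_one (by positivity)]; linarith [(Nat.cast_nonneg k : (0 : ℝ) ≤ k)]
      have h2 := norm_sub_norm_le (d k t) (z n t)
      rw [norm_sub_rev] at h2
      linarith [hd k t ht, hzR n t]))
    (by
      filter_upwards [ae_restrict_mem measurableSet_Icc] with t ht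
      rw [tendsto_iff_norm_sub_tendsto_zero]
      refine squeeze_zero (fun _ => norm_nonneg _) (fun k => ?_)
        tendsto_one_div_add_atTop_nhds_zero_nat
      rw [norm_sub_rev]
      exact hd k t ht)
  obtain ⟨k, hk⟩ := (hdlim.eventually_lt_const hn).exists
  exact ⟨d k, hd𝒟 k, hk⟩

end Approximation

/-! ### Convergence of tangent minorants and lower semicontinuity of the energy -/

namespace IsConvexLagrangian

variable {G : Euc N → ℝ} {β : ℝ → ℝ} {L : ℝ → Euc N → Euc N → ℝ}
  {Lx Lv : ℝ → Euc N → Euc N → Euc N} {a b : ℝ}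

/-- Uniform convergence of a superposition along a uniformly convergent sequence. -/
theorem _root_.AnisoMP.eventually_norm_comp_sub_le {F : Type*} [NormedAddCommGroup F]
    {Ψ : ℝ → Euc N → Euc N → F}
    (hΨ : Continuous fun z : ℝ × Euc N × Euc N => Ψ z.1 z.2.1 z.2.2) {R : ℝ}
    {x : ℕ → ℝ → Euc N} {x₀ z : ℝ → Euc N} (hz : ∀ t ∈ Icc a b, ‖z t‖ ≤ R)
    (hxR : ∀ n, ∀ t ∈ Icc a b, ‖x n t‖ ≤ R) (hx₀R : ∀ t ∈ Icc a b, ‖x₀ t‖ ≤ R)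
    (hx : TendstoUniformlyOn x x₀ atTop (Icc a b)) {ε : ℝ} (hε : 0 < ε) :
    ∀ᶠ n in atTop, ∀ t ∈ Icc a b, ‖Ψ t (x n t) (z t) - Ψ t (x₀ t) (z t)‖ ≤ ε := by
  have hu := (isCompact_Icc.prod ((isCompact_closedBall (0 : Euc N) R).prod
    (isCompact_closedBall (0 : Euc N) R))).uniformContinuousOn_of_continuous
    (s := Icc a b ×ˢ _) hΨ.continuousOn
  rw [Metric.uniformContinuousOn_iff] at hu
  obtain ⟨δ, hδ, hu⟩ := hu ε hε
  filter_upwards [Metric.tendstoUniformlyOn_iff.1 hx δ hδ] with n hn t ht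
  rw [← dist_eq_norm]
  refine (hu (t, x n t, z t) ⟨ht, by simpa using hxR n t ht, by simpa using hz t ht⟩
    (t, x₀ t, z t) ⟨ht, by simpa using hx₀R t ht, by simpa using hz t ht⟩ ?_).le
  simp only [Prod.dist_eq, dist_self]
  have h1 := hn t ht
  rw [dist_comm] at h1
  simpa [hδ] using h1

/-- Passage to the limit in the tangent minorants. -/
theorem tendsto_integral_tangent (hL : IsConvexLagrangian G β L Lx Lv)
    {x p : ℕ → ℝ → Euc N} {x₀ p₀ z : ℝ → Euc N} {R C : ℝ}
    (hxc : ∀ n, Continuous (x n)) (hx₀c : Continuous x₀) (hzc : Continuous z)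
    (hxR : ∀ n, ∀ t ∈ Icc a b, ‖x n t‖ ≤ R) (hx₀R : ∀ t ∈ Icc a b, ‖x₀ t‖ ≤ R)
    (hx : TendstoUniformlyOn x x₀ atTop (Icc a b))
    (hp : ∀ n, IntegrableOn (p n) (Icc a b)) (hp₀ : IntegrableOn p₀ (Icc a b))
    (hC : ∀ n, ∫ t in Icc a b, ‖p n t‖ ≤ C)
    (hweak : ∀ h : ℝ → Euc N, Continuous h → Tendsto (fun n => ∫ t in Icc a b,
      inner ℝ (p n t) (h t)) atTop (𝓝 (∫ t in Icc a b, inner ℝ (p₀ t) (h t)))) :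
    Tendsto (fun n => ∫ t in Icc a b, (L t (x n t) (z t)
        + inner ℝ (Lv t (x n t) (z t)) (p n t - z t))) atTop
      (𝓝 (∫ t in Icc a b, (L t (x₀ t) (z t) + inner ℝ (Lv t (x₀ t) (z t)) (p₀ t - z t)))) := by
  obtain ⟨B, hB⟩ := isCompact_Icc.exists_bound_of_continuousOn (s := Icc a b) hzc.continuousOn
  set R' := max R B
  have hxR' : ∀ n, ∀ t ∈ Icc a b, ‖x n t‖ ≤ R' := fun n t ht =>
    (hxR n t ht).trans (le_max_left _ _)
  have hx₀R' : ∀ t ∈ Icc a b, ‖x₀ t‖ ≤ R' := fun t ht => (hx₀R t ht).trans (le_max_left _ _)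
  have hzR' : ∀ t ∈ Icc a b, ‖z t‖ ≤ R' := fun t ht => (hB t ht).trans (le_max_right _ _)
  -- The tangent at `z` is split into a part without `p n`, handled by uniform convergence of
  -- positions, and a pairing of the uniformly convergent `Lv t (x n t) (z t)` with the weakly
  -- convergent `p n`.
  let Ψ : ℝ → Euc N → Euc N → ℝ := fun t x v => L t x v - inner ℝ (Lv t x v) v
  have hΨ : Continuous fun z : ℝ × Euc N × Euc N => Ψ z.1 z.2.1 z.2.2 :=
    hL.cont.sub (hL.cont_v.inner continuous_snd.snd)
  have hLvc : ∀ y : ℝ → Euc N, Continuous y → Continuous fun t => Lv t (y t) (z t) := fun y hy =>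
    hL.cont_v.comp (f := fun t => (t, y t, z t)) (by fun_prop)
  have hinn : ∀ {y r : ℝ → Euc N}, Continuous y → IntegrableOn r (Icc a b) →
      IntegrableOn (fun t => (inner ℝ (y t) (r t) : ℝ)) (Icc a b) := by
    intro y r hy hr
    obtain ⟨B, hB⟩ := isCompact_Icc.exists_bound_of_continuousOn (s := Icc a b) hy.continuousOn
    refine (hr.norm.const_mul B).mono'
      (hy.aestronglyMeasurable.inner hr.aestronglyMeasurable) ?_
    filter_upwards [ae_restrict_mem measurableSet_Icc] with t ht
    exact (norm_inner_le_norm _ _).trans (mul_le_mul_of_nonneg_right (hB t ht) (norm_nonneg _))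
  have hform : ∀ {y r : ℝ → Euc N}, Continuous y → (∀ t ∈ Icc a b, ‖y t‖ ≤ R') →
      IntegrableOn r (Icc a b) →
      ∫ t in Icc a b, (L t (y t) (z t) + inner ℝ (Lv t (y t) (z t)) (r t - z t))
        = (∫ t in Icc a b, Ψ t (y t) (z t)) + ∫ t in Icc a b, inner ℝ (Lv t (y t) (z t)) (r t) := by
    intro y r hy hyR hr
    rw [← integral_add (integrable_comp hΨ hy.aestronglyMeasurable hzc.aestronglyMeasurable hyR
      hzR') (hinn (hLvc y hy) hr)]
    congr 1
    ext t
    simp only [Ψ, inner_sub_right]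
    ring
  rw [hform hx₀c hx₀R' hp₀]
  simp_rw [fun n => hform (hxc n) (hxR' n) (hp n)]
  refine Tendsto.add ?_ ?_
  · exact tendsto_integral_comp hΨ (fun n => (hxc n).aestronglyMeasurable)
      (fun n => hzc.aestronglyMeasurable) (Eventually.of_forall hxR')
      (Eventually.of_forall fun _ => hzR') (fun t ht => hx.tendsto_at ht)
      (Eventually.of_forall fun t => tendsto_const_nhds)
  · have h1 := hweak _ (hLvc x₀ hx₀c)
    simp_rw [real_inner_comm (Lv _ (x₀ _) (z _))] at h1
    have h2 : Tendsto (fun n => (∫ t in Icc a b, (inner ℝ (Lv t (x n t) (z t)) (p n t) : ℝ))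
        - ∫ t in Icc a b, inner ℝ (Lv t (x₀ t) (z t)) (p n t)) atTop (𝓝 0) := by
      rw [Metric.tendsto_atTop']
      intro ε hε
      set C' := max C 0 + 1
      have hC' : 0 < C' := by positivity
      obtain ⟨n₀, hn₀⟩ := eventually_atTop.1 (eventually_norm_comp_sub_le hL.cont_v hzR' hxR'
        hx₀R' hx (ε := ε / (2 * C')) (by positivity))
      refine ⟨n₀, fun n hn => ?_⟩
      rw [dist_zero_right, ← integral_sub (hinn (hLvc _ (hxc n)) (hp n))
        (hinn (hLvc _ hx₀c) (hp n))]
      calc ‖∫ t in Icc a b, ((inner ℝ (Lv t (x n t) (z t)) (p n t) : ℝ)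
            - inner ℝ (Lv t (x₀ t) (z t)) (p n t))‖
          ≤ ∫ t in Icc a b, ε / (2 * C') * ‖p n t‖ := by
            refine norm_integral_le_of_norm_le ((hp n).norm.const_mul _) ?_
            filter_upwards [ae_restrict_mem measurableSet_Icc] with t ht
            rw [← inner_sub_left]
            exact (norm_inner_le_norm _ _).trans
              (mul_le_mul_of_nonneg_right (hn₀ n hn.le t ht) (norm_nonneg _))
        _ = ε / (2 * C') * ∫ t in Icc a b, ‖p n t‖ := integral_const_mul _ _
        _ ≤ ε / (2 * C') * C' := by
            refine mul_le_mul_of_nonneg_left ((hC n).trans ?_) (by positivity)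
            exact (le_max_left C 0).trans (by simp [C'])
        _ = ε / 2 := by field_simp
        _ < ε := by linarith
    simpa using h2.add h1

/-- Approximation of a function of finite modular by functions of a dense class, in energy. -/
theorem exists_approx (hL : IsConvexLagrangian G β L Lx Lv) (hG : IsGFunction G)
    (hΔ : Delta2 G) (hab : a < b) (hβ : IntegrableOn β (Icc a b))
    {x p : ℝ → Euc N} {R : ℝ} (hxc : Continuous x) (hxR : ∀ t ∈ Icc a b, ‖x t‖ ≤ R)
    (hpm : AEStronglyMeasurable p (volume.restrict (Icc a b)))
    (hGp : IntegrableOn (fun t => G (p t)) (Icc a b)) (hp0 : ∫ t in Icc a b, p t = 0)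
    {𝒟 : Set (ℝ → Euc N)} (h𝒟c : ∀ z ∈ 𝒟, Continuous z)
    (h𝒟 : ∀ z : ℝ → Euc N, Continuous z → ∫ t in Icc a b, z t = 0 → ∀ ε > 0, ∃ z' ∈ 𝒟,
      ∀ t ∈ Icc a b, ‖z t - z' t‖ ≤ ε) {ε : ℝ} (hε : 0 < ε) :
    ∃ z ∈ 𝒟, |(∫ t in Icc a b, L t (x t) (z t)) - ∫ t in Icc a b, L t (x t) (p t)| ≤ ε ∧
      |∫ t in Icc a b, inner ℝ (Lv t (x t) (z t)) (p t - z t)| ≤ ε ∧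
      ∫ t in Icc a b, ‖z t - p t‖ ≤ ε := by
  -- All three error terms are added into one nonnegative integrand vanishing at `p t`, so that a
  -- single `z` makes them small together.
  let ψ : ℝ → Euc N → ℝ := fun t z => |L t (x t) z - L t (x t) (p t)|
    + |inner ℝ (Lv t (x t) z) (p t - z)| + ‖z - p t‖
  obtain ⟨A, hA0, hA⟩ := hL.growth R
  obtain ⟨K, hK, hadd⟩ := hG.add_le hΔ
  obtain ⟨c, hc0, hc⟩ := hG.mul_norm_le 1
  have hpi := hG.integrableOn_of_modular hpm hGp
  have hGsub : ∀ v w : Euc N, G (v - w) ≤ K * (G v + G w) := fun v w => by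
    rw [sub_eq_add_neg, ← hG.even w]
    exact hadd v (-w)
  have hxm := hxc.aestronglyMeasurable (μ := volume.restrict (Icc a b))
  have hLp := hL.integrable_energy hβ hxm hpm hxR hGp
  have hmeasL : ∀ z : ℝ → Euc N, AEStronglyMeasurable z (volume.restrict (Icc a b)) →
      AEStronglyMeasurable (fun t => L t (x t) (z t)) (volume.restrict (Icc a b)) ∧
      AEStronglyMeasurable (fun t => (inner ℝ (Lv t (x t) (z t)) (p t - z t) : ℝ))
        (volume.restrict (Icc a b)) := fun z hz =>
    ⟨aestronglyMeasurable_comp hL.cont hxm hz,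
      (aestronglyMeasurable_comp hL.cont_v hxm hz).inner (hpm.sub hz)⟩
  have hcontt : ∀ t, Continuous (fun z => L t (x t) z) ∧ Continuous (fun z => Lv t (x t) z) :=
    fun t => ⟨hL.cont.comp (f := fun z => (t, x t, z)) (by fun_prop),
      hL.cont_v.comp (f := fun z => (t, x t, z)) (by fun_prop)⟩
  obtain ⟨z, hz𝒟, hz⟩ := hG.exists_integral_lt hΔ hab hpm hGp hp0 (ψ := ψ)
    (fun z hz => (((hmeasL z hz).1.sub hLp.aestronglyMeasurable).norm.add
      (hmeasL z hz).2.norm).add (hz.sub hpm).norm)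
    (fun t => by
      have h1 := (hcontt t).1
      have h2 := (hcontt t).2
      fun_prop)
    (fun t => by simp [ψ])
    (D := fun t => A * (1 + β t + G (p t)) + 2 * (A * (1 + β t)) + (K + 1) * G (p t) + 2 * c)
    ((((integrable_bound hβ hGp A).add ((((integrable_const (1 : ℝ)).add hβ).const_mul A).const_mul
      2)).add (hGp.const_mul (K + 1))).add (integrable_const _))
    (A := 2 * A + (K + 1)) (by positivity)
    (fun t ht z => by
      obtain ⟨h1, -, -, h2⟩ := hA t (x t) z (hxR t ht)
      obtain ⟨h3, -, -, -⟩ := hA t (x t) (p t) (hxR t ht)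
      have h4 := h2 (p t - z)
      have h5 := hGsub (p t) z
      have h6 := norm_sub_le z (p t)
      have h7 := hc z
      have h8 := hc (p t)
      have h9 := abs_sub (L t (x t) z) (L t (x t) (p t))
      rw [abs_of_nonneg (by positivity)]
      simp only [ψ]
      linarith)
    h𝒟c h𝒟 hε
  have hzm := (h𝒟c z hz𝒟).aestronglyMeasurable (μ := volume.restrict (Icc a b))
  have hGz : IntegrableOn (fun t => G (z t)) (Icc a b) :=
    (hG.continuous.comp (h𝒟c z hz𝒟)).continuousOn.integrableOn_Icc
  have hzi : IntegrableOn z (Icc a b) := (h𝒟c z hz𝒟).continuousOn.integrableOn_Icc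
  have hLz := hL.integrable_energy hβ hxm hzm hxR hGz
  have hGs : IntegrableOn (fun t => G (p t - z t)) (Icc a b) := by
    refine ((hGp.add hGz).const_mul K).mono'
      (hG.continuous.comp_aestronglyMeasurable (hpm.sub hzm)) (Eventually.of_forall fun t => ?_)
    rw [Real.norm_of_nonneg (hG.nonneg _)]
    exact hGsub _ _
  have hin := hL.integrable_inner_velocity hβ hxm hzm hxR hGz (hpm.sub hzm) hGs
  have h1 : IntegrableOn (fun t => |L t (x t) (z t) - L t (x t) (p t)|) (Icc a b) :=
    (hLz.sub hLp).norm
  have h2 : IntegrableOn (fun t => |(inner ℝ (Lv t (x t) (z t)) (p t - z t) : ℝ)|) (Icc a b) :=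
    hin.norm
  have h3 : IntegrableOn (fun t => ‖z t - p t‖) (Icc a b) := (hzi.sub hpi).norm
  have hsum : ∫ t in Icc a b, ψ t (z t) = (∫ t in Icc a b, |L t (x t) (z t) - L t (x t) (p t)|)
      + (∫ t in Icc a b, |inner ℝ (Lv t (x t) (z t)) (p t - z t)|)
      + ∫ t in Icc a b, ‖z t - p t‖ := by
    have h12 : IntegrableOn (fun t => |L t (x t) (z t) - L t (x t) (p t)|
      + |(inner ℝ (Lv t (x t) (z t)) (p t - z t) : ℝ)|) (Icc a b) := h1.add h2
    rw [← integral_add h1 h2, ← integral_add h12 h3]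
  rw [hsum] at hz
  have n1 : 0 ≤ ∫ t in Icc a b, |L t (x t) (z t) - L t (x t) (p t)| :=
    integral_nonneg fun _ => abs_nonneg _
  have n2 : 0 ≤ ∫ t in Icc a b, |(inner ℝ (Lv t (x t) (z t)) (p t - z t) : ℝ)| :=
    integral_nonneg fun _ => abs_nonneg _
  have n3 : 0 ≤ ∫ t in Icc a b, ‖z t - p t‖ := integral_nonneg fun _ => norm_nonneg _
  refine ⟨z, hz𝒟, ?_, ?_, by linarith⟩
  · rw [← integral_sub hLz hLp]
    exact abs_integral_le_integral_abs.trans (by linarith)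
  · exact abs_integral_le_integral_abs.trans (by linarith)

/-- Lower semicontinuity of the energy. -/
theorem eventually_energy_ge (hL : IsConvexLagrangian G β L Lx Lv) (hG : IsGFunction G)
    (hΔ : Delta2 G) (hab : a < b) (hβ : IntegrableOn β (Icc a b))
    {x p : ℕ → ℝ → Euc N} {x₀ p₀ : ℝ → Euc N} {R C : ℝ}
    (hxc : ∀ n, Continuous (x n)) (hx₀c : Continuous x₀)
    (hxR : ∀ n, ∀ t ∈ Icc a b, ‖x n t‖ ≤ R) (hx₀R : ∀ t ∈ Icc a b, ‖x₀ t‖ ≤ R)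
    (hx : TendstoUniformlyOn x x₀ atTop (Icc a b))
    (hp : ∀ n, Continuous (p n))
    (hp₀m : AEStronglyMeasurable p₀ (volume.restrict (Icc a b)))
    (hGp₀ : IntegrableOn (fun t => G (p₀ t)) (Icc a b)) (hp₀0 : ∫ t in Icc a b, p₀ t = 0)
    (hC : ∀ n, ∫ t in Icc a b, ‖p n t‖ ≤ C)
    (hweak : ∀ h : ℝ → Euc N, Continuous h → Tendsto (fun n => ∫ t in Icc a b,
      inner ℝ (p n t) (h t)) atTop (𝓝 (∫ t in Icc a b, inner ℝ (p₀ t) (h t)))) {ε : ℝ}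
    (hε : 0 < ε) :
    ∀ᶠ n in atTop, (∫ t in Icc a b, L t (x₀ t) (p₀ t)) - ε
      ≤ ∫ t in Icc a b, L t (x n t) (p n t) := by
  have hpi : ∀ n, IntegrableOn (p n) (Icc a b) := fun n => (hp n).continuousOn.integrableOn_Icc
  -- Tangents are taken at a continuous `z` near `p₀`, because weak convergence is available only
  -- against continuous functions. The energy of `z` and the tangent term each cost `ε / 4`.
  obtain ⟨z, ⟨hzc, -⟩, hz1, hz2, -⟩ := hL.exists_approx hG hΔ hab hβ hx₀c hx₀R hp₀m hGp₀ hp₀0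
    (𝒟 := {z | Continuous z ∧ ∫ t in Icc a b, z t = 0}) (fun z hz => hz.1)
    (fun z hz hz0 ε hε => ⟨z, ⟨hz, hz0⟩, fun t _ => by simpa using hε.le⟩)
    (ε := ε / 4) (by positivity)
  have hlim := hL.tendsto_integral_tangent hxc hx₀c hzc hxR hx₀R hx hpi
    (hG.integrableOn_of_modular hp₀m hGp₀) hC hweak
  have hzm := hzc.aestronglyMeasurable (μ := volume.restrict (Icc a b))
  have hGz : IntegrableOn (fun t => G (z t)) (Icc a b) :=
    (hG.continuous.comp hzc).continuousOn.integrableOn_Icc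
  have hLz := hL.integrable_energy hβ hx₀c.aestronglyMeasurable hzm hx₀R hGz
  obtain ⟨K, hK, hadd⟩ := hG.add_le hΔ
  have hGs : IntegrableOn (fun t => G (p₀ t - z t)) (Icc a b) := by
    refine ((hGp₀.add hGz).const_mul K).mono'
      (hG.continuous.comp_aestronglyMeasurable (hp₀m.sub hzm)) (Eventually.of_forall fun t => ?_)
    rw [Real.norm_of_nonneg (hG.nonneg _), sub_eq_add_neg]
    have := hadd (p₀ t) (-z t)
    rwa [hG.even] at this
  have hin := hL.integrable_inner_velocity hβ hx₀c.aestronglyMeasurable hzm hx₀R hGz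
    (hp₀m.sub hzm) hGs
  have hsplit : ∫ t in Icc a b, (L t (x₀ t) (z t) + inner ℝ (Lv t (x₀ t) (z t)) (p₀ t - z t))
      = (∫ t in Icc a b, L t (x₀ t) (z t))
        + ∫ t in Icc a b, inner ℝ (Lv t (x₀ t) (z t)) (p₀ t - z t) := integral_add hLz hin
  have hlow : (∫ t in Icc a b, L t (x₀ t) (p₀ t)) - ε / 2 - ε / 4
      < ∫ t in Icc a b, (L t (x₀ t) (z t) + inner ℝ (Lv t (x₀ t) (z t)) (p₀ t - z t)) := by
    rw [hsplit]
    linarith [(abs_le.1 hz1).1, (abs_le.1 hz2).1]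
  filter_upwards [hlim.eventually_const_lt hlow] with n hn
  have hle : ∫ t in Icc a b, (L t (x n t) (z t) + inner ℝ (Lv t (x n t) (z t)) (p n t - z t))
      ≤ ∫ t in Icc a b, L t (x n t) (p n t) := by
    have c1 : Continuous fun t => L t (x n t) (z t) + inner ℝ (Lv t (x n t) (z t)) (p n t - z t) :=
      by
        have h1 := hL.cont.comp (f := fun t => (t, x n t, z t)) (by have := hxc n; fun_prop)
        have h2 := hL.cont_v.comp (f := fun t => (t, x n t, z t)) (by have := hxc n; fun_prop)
        exact h1.add (h2.inner ((hp n).sub hzc))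
    have c2 : Continuous fun t => L t (x n t) (p n t) :=
      hL.cont.comp (f := fun t => (t, x n t, p n t))
        (by have := hxc n; have := hp n; fun_prop)
    exact integral_mono c1.continuousOn.integrableOn_Icc c2.continuousOn.integrableOn_Icc
      fun t => hL.tangent t _ _ _
  linarith

end IsConvexLagrangian

/-! ### Limits of Galerkin critical points -/

/-- The first variation, at the curve `x` with velocity `v` and in the direction `φ` with velocity
`h`, of the action with Lagrangian gradients `Lx`, `Lv` and force `f`. -/
def firstVariation (Lx Lv : ℝ → Euc N → Euc N → Euc N) (f : ℝ → Euc N) (a b : ℝ)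
    (x v φ h : ℝ → Euc N) : ℝ :=
  (∫ t in Icc a b, dirDeriv Lx Lv t (x t) (v t) (φ t) (h t)) + ∫ t in Icc a b, inner ℝ (f t) (φ t)

/-- A uniformly convergent sequence of Galerkin critical points of bounded modular, for a class
`𝒟` of test velocities dense among continuous functions with zero mean. -/
structure IsGalerkinSequence (G : Euc N → ℝ) (Lx Lv : ℝ → Euc N → Euc N → Euc N)
    (f : ℝ → Euc N) (a b M : ℝ) (𝒟 : Set (ℝ → Euc N)) (v : ℕ → ℝ → Euc N)
    (u w : ℝ → Euc N) : Prop where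
  cont : ∀ n, Continuous (v n)
  modular_le : ∀ n, ∫ t in Icc a b, G (v n t) ≤ M
  critical : ∀ z ∈ 𝒟, ∀ᶠ n in atTop,
    firstVariation Lx Lv f a b (prim a (v n)) (v n) (prim a z) z = 0
  critical_self : ∀ n, firstVariation Lx Lv f a b (prim a (v n)) (v n) (prim a (v n)) (v n) = 0
  test_cont : ∀ z ∈ 𝒟, Continuous z
  test_mean : ∀ z ∈ 𝒟, ∫ t in Icc a b, z t = 0
  test_neg : ∀ z ∈ 𝒟, -z ∈ 𝒟
  test_dense : ∀ z : ℝ → Euc N, Continuous z → ∫ t in Icc a b, z t = 0 → ∀ ε > 0, ∃ z' ∈ 𝒟,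
      ∀ t ∈ Icc a b, ‖z t - z' t‖ ≤ ε
  cont_limit : Continuous u
  tendsto : TendstoUniformlyOn (fun n => prim a (v n)) u atTop (Icc a b)
  aesm : AEStronglyMeasurable w (volume.restrict (Icc a b))
  modular_limit : IntegrableOn (fun t => G (w t)) (Icc a b)
  mean_limit : ∫ t in Icc a b, w t = 0
  eq_prim : ∀ t ∈ Icc a b, u t = prim a w t

namespace IsGalerkinSequence

variable {G : Euc N → ℝ} {β : ℝ → ℝ} {L : ℝ → Euc N → Euc N → ℝ}
  {Lx Lv : ℝ → Euc N → Euc N → Euc N} {a b : ℝ} {f : ℝ → Euc N} {M : ℝ} {𝒟 : Set (ℝ → Euc N)}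
  {v : ℕ → ℝ → Euc N} {u w : ℝ → Euc N}

theorem integrable (hS : IsGalerkinSequence G Lx Lv f a b M 𝒟 v u w) (n : ℕ) :
    IntegrableOn (v n) (Icc a b) := (hS.cont n).continuousOn.integrableOn_Icc

theorem integrable_modular (hS : IsGalerkinSequence G Lx Lv f a b M 𝒟 v u w)
    (hG : IsGFunction G) (n : ℕ) : IntegrableOn (fun t => G (v n t)) (Icc a b) :=
  (hG.continuous.comp (hS.cont n)).continuousOn.integrableOn_Icc

theorem exists_norm_bound (hS : IsGalerkinSequence G Lx Lv f a b M 𝒟 v u w)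
    (hG : IsGFunction G) (hab : a < b) : ∃ C, 0 ≤ C ∧
      (∀ n, ∫ t in Icc a b, ‖v n t‖ ≤ C) ∧ (∀ n, ∀ t ∈ Icc a b, ‖prim a (v n) t‖ ≤ C) ∧
      ∀ t ∈ Icc a b, ‖u t‖ ≤ C := by
  obtain ⟨c, hc, hle⟩ := hG.integral_norm_le hab.le
  have h1 : ∀ n, ∫ t in Icc a b, ‖v n t‖ ≤ M + c := fun n =>
    (hle _ (hS.integrable n) (hS.integrable_modular hG n)).trans (by linarith [hS.modular_le n])
  have h2 : ∀ n, ∀ t ∈ Icc a b, ‖prim a (v n) t‖ ≤ M + c := fun n t ht =>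
    (norm_prim_le (hS.integrable n) ht).trans (h1 n)
  refine ⟨M + c, ?_, h1, h2, fun t ht => ?_⟩
  · exact (integral_nonneg fun _ => norm_nonneg _).trans (h1 0)
  · exact le_of_tendsto' (hS.tendsto.tendsto_at ht).norm fun n => h2 n t ht

theorem tendsto_weak (hS : IsGalerkinSequence G Lx Lv f a b M 𝒟 v u w)
    (hG : IsGFunction G) (hab : a < b) (h : ℝ → Euc N) (hh : Continuous h) :
    Tendsto (fun n => ∫ t in Icc a b, inner ℝ (v n t) (h t)) atTop
      (𝓝 (∫ t in Icc a b, inner ℝ (w t) (h t))) := by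
  obtain ⟨C, -, hC, -, -⟩ := hS.exists_norm_bound hG hab
  refine tendsto_integral_inner_of_prim hab.le hS.integrable
    (hG.integrableOn_of_modular hS.aesm hS.modular_limit) hC (fun t ht => ?_) hh
  rw [← hS.eq_prim t ht]
  exact hS.tendsto.tendsto_at ht

theorem continuous_energy (hS : IsGalerkinSequence G Lx Lv f a b M 𝒟 v u w)
    (hL : IsConvexLagrangian G β L Lx Lv) (n : ℕ) :
    Continuous fun t => L t (prim a (v n) t) (v n t) :=
  hL.cont.comp (f := fun t => (t, prim a (v n) t, v n t))
    (by have := hS.cont n; have := continuous_prim (a := a) (hS.cont n); fun_prop)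

/-- Take a test velocity `z` near `w` whose energy is nearly that of `w`. Convexity bounds the
energy of `v n` by that of `z` minus `∫ ⟨Lv, z - v n⟩`, and the Galerkin equation rewrites this
integral through `Lx + f` paired with a difference of positions. That difference is uniformly small,
while `Lx + f` is only bounded in `L¹`. -/
theorem eventually_energy_le (hS : IsGalerkinSequence G Lx Lv f a b M 𝒟 v u w)
    (hL : IsConvexLagrangian G β L Lx Lv) (hG : IsGFunction G)
    (hΔ : Delta2 G) (hab : a < b) (hβ : IntegrableOn β (Icc a b)) (hf : IntegrableOn f (Icc a b))
    {ε : ℝ} (hε : 0 < ε) :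
    ∀ᶠ n in atTop, ∫ t in Icc a b, L t (prim a (v n) t) (v n t)
      ≤ (∫ t in Icc a b, L t (u t) (w t)) + ε := by
  obtain ⟨C, hC0, hC, hCp, hCu⟩ := hS.exists_norm_bound hG hab
  obtain ⟨A, hA0, hA⟩ := hL.growth C
  have hwi := hG.integrableOn_of_modular hS.aesm hS.modular_limit
  have hb1 : IntegrableOn (fun t => 1 + β t) (Icc a b) := (integrable_const (1 : ℝ)).add hβ
  -- A bound, independent of `n`, for the `L¹` norm of `Lx + f` along the sequence.
  set Q := A * ((∫ t in Icc a b, (1 + β t)) + M) + (∫ t in Icc a b, ‖f t‖) with hQ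
  have hf0 : 0 ≤ ∫ t in Icc a b, ‖f t‖ := integral_nonneg fun _ => norm_nonneg _
  have hM0 : 0 ≤ M := (integral_nonneg fun t => hG.nonneg _).trans (hS.modular_le 0)
  have hβ0 : 0 ≤ ∫ t in Icc a b, (1 + β t) :=
    integral_nonneg fun t => by have := hL.nonneg t; positivity
  have hQ0 : 0 ≤ Q := by positivity
  set η := ε / (4 * (Q + 1)) with hη
  have hη0 : 0 < η := by positivity
  have hηQ : 2 * η * Q ≤ ε / 2 := by
    rw [hη, mul_div_assoc', div_mul_eq_mul_div, div_le_div_iff₀ (by positivity) (by positivity)]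
    nlinarith
  obtain ⟨z, hz𝒟, hz1, -, hz3⟩ := hL.exists_approx hG hΔ hab hβ hS.cont_limit hCu hS.aesm
    hS.modular_limit hS.mean_limit hS.test_cont hS.test_dense (ε := min (ε / 4) η)
    (by positivity)
  have hzc := hS.test_cont z hz𝒟
  have hzi : IntegrableOn z (Icc a b) := hzc.continuousOn.integrableOn_Icc
  have hGz : IntegrableOn (fun t => G (z t)) (Icc a b) :=
    (hG.continuous.comp hzc).continuousOn.integrableOn_Icc
  have hZc := continuous_prim (a := a) hzc
  have hZu : ∀ t ∈ Icc a b, ‖prim a z t - u t‖ ≤ η := by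
    intro t ht
    have h1 : prim a z t - u t = prim a (fun s => z s - w s) t := by
      rw [hS.eq_prim t ht]
      exact (intervalIntegral.integral_sub
        (intervalIntegrable_of_mem hzi ⟨le_rfl, hab.le⟩ ht)
        (intervalIntegrable_of_mem hwi ⟨le_rfl, hab.le⟩ ht)).symm
    rw [h1]
    exact (norm_prim_le (hzi.sub hwi) ht).trans (hz3.trans (min_le_right _ _))
  obtain ⟨B, hB⟩ := isCompact_Icc.exists_bound_of_continuousOn (s := Icc a b) hzc.continuousOn
  have hlim : Tendsto (fun n => ∫ t in Icc a b, L t (prim a (v n) t) (z t)) atTop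
      (𝓝 (∫ t in Icc a b, L t (u t) (z t))) :=
    tendsto_integral_comp (R := max C B) hL.cont
      (fun n => (continuous_prim (hS.cont n)).aestronglyMeasurable)
      (fun n => hzc.aestronglyMeasurable)
      (Eventually.of_forall fun n t ht => (hCp n t ht).trans (le_max_left _ _))
      (Eventually.of_forall fun n t ht => (hB t ht).trans (le_max_right _ _))
      (fun t ht => hS.tendsto.tendsto_at ht) (Eventually.of_forall fun t => tendsto_const_nhds)
  have hlt : ∫ t in Icc a b, L t (u t) (z t) < (∫ t in Icc a b, L t (u t) (w t)) + ε / 2 := by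
    linarith [(abs_le.1 (hz1.trans (min_le_left _ _))).2]
  filter_upwards [hlim.eventually_lt_const hlt, hS.critical z hz𝒟,
    Metric.tendstoUniformlyOn_iff.1 hS.tendsto η hη0] with n hn hcr hun
  have hpc := continuous_prim (a := a) (hS.cont n)
  have hvc := hS.cont n
  have hcomp : ∀ {F : Type} [TopologicalSpace F] {Ψ : ℝ → Euc N → Euc N → F},
      (Continuous fun z : ℝ × Euc N × Euc N => Ψ z.1 z.2.1 z.2.2) →
      Continuous fun t => Ψ t (prim a (v n) t) (v n t) := fun hΨ =>
    hΨ.comp (f := fun t => (t, prim a (v n) t, v n t)) (by fun_prop)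
  have hLxc := hcomp hL.cont_x
  have hLvc := hcomp hL.cont_v
  have hLzc : Continuous fun t => L t (prim a (v n) t) (z t) :=
    hL.cont.comp (f := fun t => (t, prim a (v n) t, z t)) (by fun_prop)
  have hfin : ∀ {y : ℝ → Euc N}, Continuous y →
      IntegrableOn (fun t => (inner ℝ (f t) (y t) : ℝ)) (Icc a b) := by
    intro y hy
    obtain ⟨B, hB⟩ := isCompact_Icc.exists_bound_of_continuousOn (s := Icc a b) hy.continuousOn
    refine (hf.norm.mul_const B).mono'
      (hf.aestronglyMeasurable.inner hy.aestronglyMeasurable) ?_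
    filter_upwards [ae_restrict_mem measurableSet_Icc] with t ht
    exact (norm_inner_le_norm _ _).trans (mul_le_mul_of_nonneg_left (hB t ht) (norm_nonneg _))
  have hself := hS.critical_self n
  unfold firstVariation at hcr hself
  have hd1 : IntegrableOn (fun t => dirDeriv Lx Lv t (prim a (v n) t) (v n t) (prim a z t) (z t))
      (Icc a b) := ((hLxc.inner hZc).add (hLvc.inner hzc)).continuousOn.integrableOn_Icc
  have hd2 : IntegrableOn (fun t => dirDeriv Lx Lv t (prim a (v n) t) (v n t) (prim a (v n) t)
      (v n t)) (Icc a b) := ((hLxc.inner hpc).add (hLvc.inner hvc)).continuousOn.integrableOn_Icc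
  -- The Galerkin equation tested with `v n` is subtracted from the one tested with `z`.
  have hcomb : (∫ t in Icc a b, inner ℝ (Lx t (prim a (v n) t) (v n t) + f t)
        (prim a z t - prim a (v n) t))
      + ∫ t in Icc a b, inner ℝ (Lv t (prim a (v n) t) (v n t)) (z t - v n t) = 0 := by
    have h0 : (∫ t in Icc a b, inner ℝ (Lx t (prim a (v n) t) (v n t) + f t)
        (prim a z t - prim a (v n) t))
      + ∫ t in Icc a b, inner ℝ (Lv t (prim a (v n) t) (v n t)) (z t - v n t)
      = ((∫ t in Icc a b, dirDeriv Lx Lv t (prim a (v n) t) (v n t) (prim a z t) (z t))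
          + ∫ t in Icc a b, inner ℝ (f t) (prim a z t))
        - ((∫ t in Icc a b, dirDeriv Lx Lv t (prim a (v n) t) (v n t) (prim a (v n) t) (v n t))
          + ∫ t in Icc a b, inner ℝ (f t) (prim a (v n) t)) := by
      have e1 : IntegrableOn (fun t => dirDeriv Lx Lv t (prim a (v n) t) (v n t) (prim a z t) (z t)
        + inner ℝ (f t) (prim a z t)) (Icc a b) := hd1.add (hfin hZc)
      have e2 : IntegrableOn (fun t => dirDeriv Lx Lv t (prim a (v n) t) (v n t)
        (prim a (v n) t) (v n t) + inner ℝ (f t) (prim a (v n) t)) (Icc a b) :=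
        hd2.add (hfin hpc)
      rw [← integral_add hd1 (hfin hZc), ← integral_add hd2 (hfin hpc),
        ← integral_sub e1 e2, ← integral_add ?_ ?_]
      · refine integral_congr_ae (Eventually.of_forall fun t => ?_)
        simp only [dirDeriv, inner_add_left, inner_sub_right]
        ring
      · have h1 : IntegrableOn (fun t => (inner ℝ (Lx t (prim a (v n) t) (v n t))
            (prim a z t - prim a (v n) t) : ℝ)) (Icc a b) :=
          (hLxc.inner (hZc.sub hpc)).continuousOn.integrableOn_Icc
        simp only [inner_add_left]
        exact h1.add (hfin (hZc.sub hpc))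
      · exact (hLvc.inner (hzc.sub hvc)).continuousOn.integrableOn_Icc
    rw [h0, hcr, hself, sub_zero]
  have htan : (∫ t in Icc a b, L t (prim a (v n) t) (v n t))
      + ∫ t in Icc a b, inner ℝ (Lv t (prim a (v n) t) (v n t)) (z t - v n t)
      ≤ ∫ t in Icc a b, L t (prim a (v n) t) (z t) := by
    have i1 : IntegrableOn (fun t => L t (prim a (v n) t) (v n t)) (Icc a b) :=
      (hS.continuous_energy hL n).continuousOn.integrableOn_Icc
    have i2 : IntegrableOn (fun t => (inner ℝ (Lv t (prim a (v n) t) (v n t)) (z t - v n t) : ℝ))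
      (Icc a b) := (hLvc.inner (hzc.sub hvc)).continuousOn.integrableOn_Icc
    rw [← integral_add i1 i2]
    exact integral_mono (i1.add i2) hLzc.continuousOn.integrableOn_Icc
      fun t => hL.tangent t _ _ _
  -- Both `prim a z` and `prim a (v n)` are within `η` of `u`, which accounts for the factor `2 *
  -- η`.
  have hbound : |∫ t in Icc a b, inner ℝ (Lx t (prim a (v n) t) (v n t) + f t)
      (prim a z t - prim a (v n) t)| ≤ 2 * η * Q := by
    have hGi := hS.integrable_modular hG n
    have hBi := IsConvexLagrangian.integrable_bound hβ hGi A
    calc |∫ t in Icc a b, inner ℝ (Lx t (prim a (v n) t) (v n t) + f t)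
          (prim a z t - prim a (v n) t)|
        ≤ ∫ t in Icc a b, (A * (1 + β t + G (v n t)) + ‖f t‖) * (2 * η) := by
          have hBf : IntegrableOn (fun t => (A * (1 + β t + G (v n t)) + ‖f t‖) * (2 * η))
            (Icc a b) := (hBi.add hf.norm).mul_const _
          rw [← Real.norm_eq_abs]
          refine norm_integral_le_of_norm_le hBf ?_
          filter_upwards [ae_restrict_mem measurableSet_Icc] with t ht
          refine (norm_inner_le_norm _ _).trans ?_
          refine mul_le_mul ((norm_add_le _ _).trans
            (add_le_add (hA t _ _ (hCp n t ht)).2.1 le_rfl)) ?_ (norm_nonneg _) ?_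
          · have h1 := hun t ht
            rw [dist_eq_norm] at h1
            have h2 := norm_add_le (prim a z t - u t) (u t - prim a (v n) t)
            rw [sub_add_sub_cancel] at h2
            linarith [hZu t ht]
          · have := hL.nonneg t; have := hG.nonneg (v n t); positivity
      _ = ((∫ t in Icc a b, A * (1 + β t + G (v n t))) + ∫ t in Icc a b, ‖f t‖) * (2 * η) := by
          rw [integral_mul_const, integral_add hBi hf.norm]
      _ = (A * ((∫ t in Icc a b, (1 + β t)) + ∫ t in Icc a b, G (v n t))
            + ∫ t in Icc a b, ‖f t‖) * (2 * η) := by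
          rw [integral_const_mul, integral_add hb1 hGi]
      _ ≤ Q * (2 * η) := by
          have := hS.modular_le n
          rw [hQ]
          gcongr
      _ = 2 * η * Q := by ring
  linarith [(abs_le.1 hbound).2, (abs_le.1 hbound).1]

/-- Weak convergence of velocities alone gives only the lower bound; criticality gives the upper
one. This convergence stands in for strong convergence of the velocities. -/
theorem tendsto_energy (hS : IsGalerkinSequence G Lx Lv f a b M 𝒟 v u w)
    (hL : IsConvexLagrangian G β L Lx Lv) (hG : IsGFunction G)
    (hΔ : Delta2 G) (hab : a < b) (hβ : IntegrableOn β (Icc a b))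
    (hf : IntegrableOn f (Icc a b)) :
    Tendsto (fun n => ∫ t in Icc a b, L t (prim a (v n) t) (v n t)) atTop
      (𝓝 (∫ t in Icc a b, L t (u t) (w t))) := by
  obtain ⟨C, hC0, hC, hCp, hCu⟩ := hS.exists_norm_bound hG hab
  rw [Metric.tendsto_nhds]
  intro ε hε
  filter_upwards [hS.eventually_energy_le hL hG hΔ hab hβ hf (half_pos hε),
    hL.eventually_energy_ge hG hΔ hab hβ (fun n => continuous_prim (hS.cont n)) hS.cont_limit hCp
      hCu hS.tendsto hS.cont hS.aesm hS.modular_limit hS.mean_limit hC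
      (hS.tendsto_weak hG hab) (half_pos hε)] with n h1 h2
  rw [Real.dist_eq, abs_lt]
  constructor <;> linarith

/-- The modulars of the velocities of a Galerkin sequence are asymptotically equi-integrable. -/
theorem eventually_tail_le (hS : IsGalerkinSequence G Lx Lv f a b M 𝒟 v u w)
    (hL : IsConvexLagrangian G β L Lx Lv) (hG : IsGFunction G)
    (hΔ : Delta2 G) (hab : a < b) (hβ : IntegrableOn β (Icc a b)) (hf : IntegrableOn f (Icc a b))
    {ε : ℝ} (hε : 0 < ε) :
    ∃ ρ : ℝ, ∀ᶠ n in atTop,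
      IntegrableOn (fun t => if ‖v n t‖ ≤ ρ then 0 else 1 + β t + G (v n t)) (Icc a b) ∧
      ∫ t in Icc a b, (if ‖v n t‖ ≤ ρ then 0 else 1 + β t + G (v n t)) ≤ ε := by
  obtain ⟨C, hC0, hC, hCp, hCu⟩ := hS.exists_norm_bound hG hab
  have hM0 : 0 ≤ M := (integral_nonneg fun t => hG.nonneg _).trans (hS.modular_le 0)
  have hwi := hG.integrableOn_of_modular hS.aesm hS.modular_limit
  obtain ⟨A, hA0, hA⟩ := hL.coercive C
  -- The convexity defect relative to `z` will have integral below `3 * ε'`: the energy difference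
  -- and the tangent term contribute at most `ε'` each, and the rest gives strictness. After
  -- multiplication by `A` this is at most `ε / 4`.
  set ε' := ε / (12 * (A + 1)) with hε'
  have hε'0 : 0 < ε' := by positivity
  have hAε : A * (3 * ε') ≤ ε / 4 := by
    rw [hε', mul_div_assoc', mul_div_assoc', div_le_div_iff₀ (by positivity) (by positivity)]
    nlinarith
  obtain ⟨z, hz𝒟, hz1, hz2, -⟩ := hL.exists_approx hG hΔ hab hβ hS.cont_limit hCu hS.aesm
    hS.modular_limit hS.mean_limit hS.test_cont hS.test_dense hε'0
  have hzc := hS.test_cont z hz𝒟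
  have hzm := hzc.aestronglyMeasurable (μ := volume.restrict (Icc a b))
  have hGz : IntegrableOn (fun t => G (z t)) (Icc a b) :=
    (hG.continuous.comp hzc).continuousOn.integrableOn_Icc
  obtain ⟨B, hB⟩ := isCompact_Icc.exists_bound_of_continuousOn (s := Icc a b) hzc.continuousOn
  obtain ⟨c₁, hc₁, hle₁⟩ := exists_bound_comp hL.cont a b (max C B)
  obtain ⟨c₂, hc₂, hle₂⟩ := exists_bound_comp hL.cont_v a b (max C B)
  -- tail of `β`
  obtain ⟨k, hk⟩ : ∃ k : ℕ, ∫ t in Icc a b, max (β t - k) 0 ≤ ε / 4 := by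
    have hlim : Tendsto (fun k : ℕ => ∫ t in Icc a b, max (β t - k) 0) atTop
        (𝓝 (∫ t in Icc a b, (0 : ℝ))) := by
      refine tendsto_integral_of_dominated_convergence β (fun k => ?_) hβ (fun k => ?_) ?_
      · exact ((hβ.aestronglyMeasurable.sub aestronglyMeasurable_const).sup
          aestronglyMeasurable_const)
      · refine Eventually.of_forall fun t => ?_
        rw [Real.norm_of_nonneg (le_max_right _ _)]
        exact max_le (by linarith [(Nat.cast_nonneg k : (0 : ℝ) ≤ k)]) (hL.nonneg t)
      · refine Eventually.of_forall fun t => tendsto_const_nhds.congr' ?_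
        filter_upwards [eventually_ge_atTop ⌈β t⌉₊] with k hk
        have : β t ≤ k := (Nat.le_ceil _).trans (Nat.cast_le.2 hk)
        rw [max_eq_right (by linarith)]
    rw [integral_zero] at hlim
    obtain ⟨k, hk⟩ := (hlim.eventually_lt_const (by positivity : 0 < ε / 4)).exists
    exact ⟨k, hk.le⟩
  have hkI : IntegrableOn (fun t => max (β t - k) 0) (Icc a b) :=
    (hβ.sub (integrable_const (k : ℝ))).sup (integrable_const 0)
  set η := ε / (4 * (M + 1)) with hη
  have hη0 : 0 < η := by positivity
  have hηM : η * M ≤ ε / 4 := by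
    rw [hη, div_mul_eq_mul_div, div_le_div_iff₀ (by positivity) (by positivity)]
    nlinarith
  -- Coercivity bounds `G (v n)` by `A` times the defect plus `A` times the tangent at `z` plus a
  -- constant. The tangent is affine in `v n`, with constant part collected in `c₃` and slope `A *
  -- c₂`.
  set c₃ := A * (c₁ + c₂ * |B| + A) with hc₃
  set Q := 1 + k + c₃ + A * c₂ with hQ
  have hQ0 : 0 ≤ Q := by positivity
  obtain ⟨c, hc0, hc⟩ := hG.mul_norm_le (Q / η + 1)
  -- Beyond norm `1` the constants are absorbed into `Q * ‖v‖`. Beyond norm `c` the additive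
  -- constant in the superlinear bound is absorbed, leaving `Q * ‖v‖ ≤ η * G v`.
  refine ⟨max 1 c, ?_⟩
  -- the convexity defects
  have hlim1 := hS.tendsto_energy hL hG hΔ hab hβ hf
  have hlim2 := hL.tendsto_integral_tangent (fun n => continuous_prim (a := a) (hS.cont n))
    hS.cont_limit hzc hCp hCu hS.tendsto hS.integrable hwi hC (hS.tendsto_weak hG hab)
  obtain ⟨K, hK, hadd⟩ := hG.add_le hΔ
  have hGs : IntegrableOn (fun t => G (w t - z t)) (Icc a b) := by
    refine ((hS.modular_limit.add hGz).const_mul K).mono'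
      (hG.continuous.comp_aestronglyMeasurable (hS.aesm.sub hzm)) (Eventually.of_forall fun t => ?_)
    rw [Real.norm_of_nonneg (hG.nonneg _), sub_eq_add_neg]
    have := hadd (w t) (-z t)
    rwa [hG.even] at this
  have hLz := hL.integrable_energy hβ hS.cont_limit.aestronglyMeasurable hzm hCu hGz
  have hin := hL.integrable_inner_velocity hβ hS.cont_limit.aestronglyMeasurable hzm hCu hGz
    (hS.aesm.sub hzm) hGs
  have hsplit : ∫ t in Icc a b, (L t (u t) (z t) + inner ℝ (Lv t (u t) (z t)) (w t - z t))
      = (∫ t in Icc a b, L t (u t) (z t))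
        + ∫ t in Icc a b, inner ℝ (Lv t (u t) (z t)) (w t - z t) := integral_add hLz hin
  have hlt : (∫ t in Icc a b, L t (u t) (w t))
      - ∫ t in Icc a b, (L t (u t) (z t) + inner ℝ (Lv t (u t) (z t)) (w t - z t)) < 3 * ε' := by
    rw [hsplit]
    linarith [(abs_le.1 hz1).1, (abs_le.1 hz2).1]
  filter_upwards [(hlim1.sub hlim2).eventually_lt_const hlt] with n hn
  have hpc := continuous_prim (a := a) (hS.cont n)
  have hvc := hS.cont n
  have i1 : IntegrableOn (fun t => L t (prim a (v n) t) (v n t)) (Icc a b) :=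
    (hS.continuous_energy hL n).continuousOn.integrableOn_Icc
  have i2 : IntegrableOn (fun t => L t (prim a (v n) t) (z t)
      + inner ℝ (Lv t (prim a (v n) t) (z t)) (v n t - z t)) (Icc a b) := by
    have h1 := hL.cont.comp (f := fun t => (t, prim a (v n) t, z t)) (by fun_prop)
    have h2 := hL.cont_v.comp (f := fun t => (t, prim a (v n) t, z t)) (by fun_prop)
    exact (h1.add (h2.inner (hvc.sub hzc))).continuousOn.integrableOn_Icc
  have hGi := hS.integrable_modular hG n
  -- The majorant of the tail has three parts, each with integral at most `ε / 4`: the convexity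
  -- defect, the tail of `β`, and a small multiple of the modular.
  let bound : ℝ → ℝ := fun t => A * (L t (prim a (v n) t) (v n t) - (L t (prim a (v n) t) (z t)
      + inner ℝ (Lv t (prim a (v n) t) (z t)) (v n t - z t))) + max (β t - k) 0 + η * G (v n t)
  have hboundI : IntegrableOn bound (Icc a b) :=
    (((i1.sub i2).const_mul A).add hkI).add (hGi.const_mul η)
  have hpt : ∀ t ∈ Icc a b, (if ‖v n t‖ ≤ max 1 c then 0 else 1 + β t + G (v n t)) ≤ bound t := by
    intro t ht
    have hE := hL.tangent t (prim a (v n) t) (v n t) (z t)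
    have hE' : 0 ≤ A * (L t (prim a (v n) t) (v n t) - (L t (prim a (v n) t) (z t)
      + inner ℝ (Lv t (prim a (v n) t) (z t)) (v n t - z t))) :=
      mul_nonneg hA0 (by linarith)
    have hβm : β t ≤ k + max (β t - k) 0 := by linarith [le_max_left (β t - k) 0]
    have hm0 : 0 ≤ max (β t - k) 0 := le_max_right _ _
    have hGn := hG.nonneg (v n t)
    simp only [bound]
    split_ifs with hv
    · positivity
    · rw [not_le, max_lt_iff] at hv
      have h1 := hA t _ (v n t) (hCp n t ht)
      have hxR := (hCp n t ht).trans (le_max_left C B)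
      have hzR := (hB t ht).trans (le_max_right C B)
      have h2 := (le_abs_self _).trans (hle₁ t ht _ _ hxR hzR)
      have h3 : inner ℝ (Lv t (prim a (v n) t) (z t)) (v n t - z t) ≤ c₂ * (‖v n t‖ + |B|) :=
        (real_inner_le_norm _ _).trans (mul_le_mul (hle₂ t ht _ _ hxR hzR)
          ((norm_sub_le _ _).trans (add_le_add le_rfl ((hB t ht).trans (le_abs_self B))))
          (norm_nonneg _) hc₂)
      have h4 : G (v n t) ≤ A * (L t (prim a (v n) t) (v n t) - (L t (prim a (v n) t) (z t)
          + inner ℝ (Lv t (prim a (v n) t) (z t)) (v n t - z t))) + (c₃ + A * c₂ * ‖v n t‖) := by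
        refine h1.trans ?_
        have h5 := mul_le_mul_of_nonneg_left (add_le_add h2 h3) hA0
        rw [hc₃]
        linarith
      have h6 : 1 + k + c₃ + A * c₂ * ‖v n t‖ ≤ Q * ‖v n t‖ := by
        have : 0 ≤ 1 + k + c₃ := by positivity
        rw [hQ]
        nlinarith [hv.1]
      have h7 : Q * ‖v n t‖ ≤ η * G (v n t) := by
        have h8 := hc (v n t)
        have h9 : Q / η * ‖v n t‖ ≤ G (v n t) := by linarith [hv.2]
        have h10 := mul_le_mul_of_nonneg_left h9 hη0.le
        rwa [← mul_assoc, mul_div_cancel₀ _ hη0.ne'] at h10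
      linarith
  have hmeas : AEStronglyMeasurable (fun t => if ‖v n t‖ ≤ max 1 c then 0
      else 1 + β t + G (v n t)) (volume.restrict (Icc a b)) := by
    refine AEMeasurable.aestronglyMeasurable ?_
    have hset : MeasurableSet {t | ‖v n t‖ ≤ max 1 c} :=
      measurableSet_le hvc.norm.measurable measurable_const
    have h1 : AEMeasurable (fun t => 1 + β t + G (v n t)) (volume.restrict (Icc a b)) :=
      ((hβ.aemeasurable.const_add 1).add hGi.aemeasurable)
    have h2 := h1.indicator hset.compl
    refine h2.congr (Eventually.of_forall fun t => ?_)
    simp only [indicator, mem_compl_iff, mem_ofPred_eq]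
    split_ifs <;> rfl
  have hint : IntegrableOn (fun t => if ‖v n t‖ ≤ max 1 c then 0 else 1 + β t + G (v n t))
      (Icc a b) := by
    refine hboundI.mono' hmeas ?_
    filter_upwards [ae_restrict_mem measurableSet_Icc] with t ht
    rw [Real.norm_of_nonneg]
    · exact hpt t ht
    · have := hL.nonneg t; have := hG.nonneg (v n t)
      split_ifs <;> positivity
  refine ⟨hint, ?_⟩
  have hfinal : ∫ t in Icc a b, (if ‖v n t‖ ≤ max 1 c then 0 else 1 + β t + G (v n t))
      ≤ ∫ t in Icc a b, bound t := setIntegral_mono_on hint hboundI measurableSet_Icc hpt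
  have hsum : ∫ t in Icc a b, bound t = A * ((∫ t in Icc a b, L t (prim a (v n) t) (v n t))
      - ∫ t in Icc a b, (L t (prim a (v n) t) (z t)
        + inner ℝ (Lv t (prim a (v n) t) (z t)) (v n t - z t)))
      + (∫ t in Icc a b, max (β t - k) 0) + η * ∫ t in Icc a b, G (v n t) := by
    have e1 : IntegrableOn (fun t => A * (L t (prim a (v n) t) (v n t)
        - (L t (prim a (v n) t) (z t) + inner ℝ (Lv t (prim a (v n) t) (z t)) (v n t - z t))))
        (Icc a b) := (i1.sub i2).const_mul A
    have e2 : IntegrableOn (fun t => A * (L t (prim a (v n) t) (v n t)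
        - (L t (prim a (v n) t) (z t) + inner ℝ (Lv t (prim a (v n) t) (z t)) (v n t - z t)))
        + max (β t - k) 0) (Icc a b) := e1.add hkI
    rw [← integral_sub i1 i2, ← integral_const_mul, ← integral_const_mul,
      ← integral_add e1 hkI, ← integral_add e2 (hGi.const_mul η)]
  have h1 := mul_le_mul_of_nonneg_left hn.le hA0
  have h2 := mul_le_mul_of_nonneg_left (hS.modular_le n) hη0.le
  rw [hsum] at hfinal
  linarith

end IsGalerkinSequence

namespace IsGalerkinSequence

variable {G : Euc N → ℝ} {β : ℝ → ℝ} {L : ℝ → Euc N → Euc N → ℝ}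
  {Lx Lv : ℝ → Euc N → Euc N → Euc N} {a b : ℝ} {f : ℝ → Euc N} {M : ℝ} {𝒟 : Set (ℝ → Euc N)}
  {v : ℕ → ℝ → Euc N} {u w : ℝ → Euc N}

/-- Upper bound for the increments of the limit energy in the direction of a test velocity. -/
theorem exists_energy_increment_le (hS : IsGalerkinSequence G Lx Lv f a b M 𝒟 v u w)
    (hL : IsConvexLagrangian G β L Lx Lv) (hG : IsGFunction G)
    (hΔ : Delta2 G) (hab : a < b) (hβ : IntegrableOn β (Icc a b)) (hf : IntegrableOn f (Icc a b))
    {h : ℝ → Euc N} (hh : h ∈ 𝒟) {ε : ℝ} (hε : 0 < ε) :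
    ∃ δ > 0, ∀ s, 0 < s → s < δ →
      (∫ t in Icc a b, L t (u t + s • prim a h t) (w t + s • h t))
        - ∫ t in Icc a b, L t (u t) (w t)
      ≤ s * (-(∫ t in Icc a b, inner ℝ (f t) (prim a h t)) + ε) := by
  obtain ⟨C, hC0, hC, hCp, hCu⟩ := hS.exists_norm_bound hG hab
  have hhc := hS.test_cont h hh
  have hφc := continuous_prim (a := a) hhc
  have hhi : IntegrableOn h (Icc a b) := hhc.continuousOn.integrableOn_Icc
  obtain ⟨B₁, hB₁⟩ := isCompact_Icc.exists_bound_of_continuousOn (s := Icc a b) hhc.continuousOn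
  obtain ⟨B₂, hB₂⟩ := isCompact_Icc.exists_bound_of_continuousOn (s := Icc a b) hφc.continuousOn
  set R := max C (max B₁ B₂)
  obtain ⟨A, hA0, hA⟩ := hL.exists_increment_le hG hΔ a b R
  have hba : 0 < b - a := sub_pos.2 hab
  obtain ⟨ρ, hρ⟩ := hS.eventually_tail_le hL hG hΔ hab hβ hf
    (ε := ε / (4 * (A + 1))) (by positivity)
  have hAε : A * (ε / (4 * (A + 1))) ≤ ε / 4 := by
    rw [mul_div_assoc', div_le_div_iff₀ (by positivity) (by positivity)]
    nlinarith
  obtain ⟨δ, hδ, hinc⟩ := hA ρ (ε / (4 * (b - a))) (by positivity)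
  refine ⟨δ, hδ, fun s hs0 hsδ => ?_⟩
  -- Where `‖v n t‖ ≤ ρ` the increment differs from its linear part by a small slope; elsewhere the
  -- error is `A` times the equi-integrable tail. Each contributes at most `ε / 4`, and criticality
  -- evaluates the linear part through the force.
  have hincr : ∀ᶠ n in atTop,
      (∫ t in Icc a b, L t (prim a (v n) t + s • prim a h t) (v n t + s • h t))
        - ∫ t in Icc a b, L t (prim a (v n) t) (v n t)
      ≤ s * (-(∫ t in Icc a b, inner ℝ (f t) (prim a h t)) + ε / 2) := by
    filter_upwards [hρ, hS.critical h hh] with n hn hcr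
    obtain ⟨htI, htail⟩ := hn
    have hvc := hS.cont n
    have hpc := continuous_prim (a := a) hvc
    have i1 : IntegrableOn (fun t => L t (prim a (v n) t + s • prim a h t) (v n t + s • h t))
        (Icc a b) := (hL.cont.comp (f := fun t => (t, prim a (v n) t + s • prim a h t,
          v n t + s • h t)) (by fun_prop)).continuousOn.integrableOn_Icc
    have i2 : IntegrableOn (fun t => L t (prim a (v n) t) (v n t)) (Icc a b) :=
      (hS.continuous_energy hL n).continuousOn.integrableOn_Icc
    have i3 : IntegrableOn (fun t => dirDeriv Lx Lv t (prim a (v n) t) (v n t) (prim a h t) (h t))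
        (Icc a b) := (hL.continuous_dirDeriv.comp (f := fun t => (t, prim a (v n) t, v n t,
          prim a h t, h t)) (by fun_prop)).continuousOn.integrableOn_Icc
    have i4 : IntegrableOn (fun _ : ℝ => ε / (4 * (b - a))) (Icc a b) := integrable_const _
    have i5 : IntegrableOn (fun t => ε / (4 * (b - a))
        + A * (if ‖v n t‖ ≤ ρ then 0 else 1 + β t + G (v n t))) (Icc a b) :=
      i4.add (htI.const_mul A)
    have i6 : IntegrableOn (fun t => dirDeriv Lx Lv t (prim a (v n) t) (v n t) (prim a h t) (h t)
        + (ε / (4 * (b - a)) + A * (if ‖v n t‖ ≤ ρ then 0 else 1 + β t + G (v n t))))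
        (Icc a b) := i3.add i5
    unfold firstVariation at hcr
    rw [← integral_sub i1 i2]
    calc ∫ t in Icc a b, (L t (prim a (v n) t + s • prim a h t) (v n t + s • h t)
          - L t (prim a (v n) t) (v n t))
        ≤ ∫ t in Icc a b, s * (dirDeriv Lx Lv t (prim a (v n) t) (v n t) (prim a h t) (h t)
          + (ε / (4 * (b - a)) + A * (if ‖v n t‖ ≤ ρ then 0 else 1 + β t + G (v n t)))) := by
          refine setIntegral_mono_on (i1.sub i2) (i6.const_mul s) measurableSet_Icc
            fun t ht => ?_
          refine (hinc t ht _ _ _ _ ((hCp n t ht).trans (le_max_left _ _))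
            ((hB₂ t ht).trans ((le_max_right _ _).trans (le_max_right _ _)))
            ((hB₁ t ht).trans ((le_max_left _ _).trans (le_max_right _ _))) s hs0 hsδ).trans ?_
          refine mul_le_mul_of_nonneg_left (add_le_add le_rfl ?_) hs0.le
          have : 0 < ε / (4 * (b - a)) := by positivity
          split_ifs <;> linarith
      _ = s * ((∫ t in Icc a b, dirDeriv Lx Lv t (prim a (v n) t) (v n t) (prim a h t) (h t))
          + ((b - a) * (ε / (4 * (b - a)))
            + A * ∫ t in Icc a b, (if ‖v n t‖ ≤ ρ then 0 else 1 + β t + G (v n t)))) := by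
          rw [integral_const_mul, integral_add i3 i5, integral_add i4 (htI.const_mul A),
            integral_const_mul]
          simp [hab.le]
      _ ≤ s * (-(∫ t in Icc a b, inner ℝ (f t) (prim a h t)) + ε / 2) := by
          refine mul_le_mul_of_nonneg_left ?_ hs0.le
          have h1 := mul_le_mul_of_nonneg_left htail hA0
          have h2 : (b - a) * (ε / (4 * (b - a))) = ε / 4 := by field_simp
          rw [h2]
          linarith
  obtain ⟨c, hc, hle⟩ := hG.integral_norm_le hab.le
  -- Lower semicontinuity is applied to the shifted curves and the upper energy bound to the
  -- unshifted ones. An upper bound for increments along the sequence thus passes to the limit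
  -- without convergence of the gradients.
  have hshift := hL.eventually_energy_ge hG hΔ hab hβ
    (x := fun n t => prim a (v n) t + s • prim a h t) (p := fun n t => v n t + s • h t)
    (x₀ := fun t => u t + s • prim a h t) (p₀ := fun t => w t + s • h t)
    (R := C + |s| * |B₂|) (C := C + ∫ t in Icc a b, ‖s • h t‖)
    (fun n => (continuous_prim (hS.cont n)).add (hφc.const_smul s))
    (hS.cont_limit.add (hφc.const_smul s))
    (fun n t ht => (norm_add_le _ _).trans (add_le_add (hCp n t ht) (by
      rw [norm_smul, Real.norm_eq_abs]
      exact mul_le_mul_of_nonneg_left ((hB₂ t ht).trans (le_abs_self _)) (abs_nonneg _))))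
    (fun t ht => (norm_add_le _ _).trans (add_le_add (hCu t ht) (by
      rw [norm_smul, Real.norm_eq_abs]
      exact mul_le_mul_of_nonneg_left ((hB₂ t ht).trans (le_abs_self _)) (abs_nonneg _))))
    (by
      rw [Metric.tendstoUniformlyOn_iff]
      intro ε hε
      filter_upwards [Metric.tendstoUniformlyOn_iff.1 hS.tendsto ε hε] with n hn t ht
      simpa using hn t ht)
    (fun n => (hS.cont n).add (hhc.const_smul s))
    (hS.aesm.add (hhc.const_smul s).aestronglyMeasurable)
    (by
      obtain ⟨K, hK, hadd⟩ := hG.add_le hΔ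
      have hGh : IntegrableOn (fun t => G (s • h t)) (Icc a b) :=
        (hG.continuous.comp (hhc.const_smul s)).continuousOn.integrableOn_Icc
      refine ((hS.modular_limit.add hGh).const_mul K).mono'
        (hG.continuous.comp_aestronglyMeasurable
          (hS.aesm.add (hhc.const_smul s).aestronglyMeasurable)) (Eventually.of_forall fun t => ?_)
      rw [Real.norm_of_nonneg (hG.nonneg _)]
      exact hadd _ _)
    (by
      have hsi : IntegrableOn (fun t => s • h t) (Icc a b) := hhi.smul s
      rw [integral_add (hG.integrableOn_of_modular hS.aesm hS.modular_limit) hsi,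
        hS.mean_limit, integral_smul, hS.test_mean h hh, smul_zero, add_zero])
    (fun n => by
      have i1 : IntegrableOn (fun t => ‖v n t + s • h t‖) (Icc a b) :=
        ((hS.integrable n).add (hhi.smul s)).norm
      have i2 : IntegrableOn (fun t => ‖s • h t‖) (Icc a b) := (hhi.smul s).norm
      have i3 := (hS.integrable n).norm
      calc ∫ t in Icc a b, ‖v n t + s • h t‖ ≤ ∫ t in Icc a b, (‖v n t‖ + ‖s • h t‖) :=
            integral_mono i1 (i3.add i2) fun t => norm_add_le _ _
        _ = (∫ t in Icc a b, ‖v n t‖) + ∫ t in Icc a b, ‖s • h t‖ := integral_add i3 i2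
        _ ≤ _ := add_le_add (hC n) le_rfl)
    (fun k hk => by
      obtain ⟨B₃, hB₃⟩ := isCompact_Icc.exists_bound_of_continuousOn (s := Icc a b)
        hk.continuousOn
      have hin : ∀ {y : ℝ → Euc N}, IntegrableOn y (Icc a b) →
          IntegrableOn (fun t => (inner ℝ (y t) (k t) : ℝ)) (Icc a b) := by
        intro y hy
        refine (hy.norm.mul_const B₃).mono'
          (hy.aestronglyMeasurable.inner hk.aestronglyMeasurable) ?_
        filter_upwards [ae_restrict_mem measurableSet_Icc] with t ht
        exact (norm_inner_le_norm _ _).trans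
          (mul_le_mul_of_nonneg_left (hB₃ t ht) (norm_nonneg _))
      have hi3 : IntegrableOn (fun t => (inner ℝ (s • h t) (k t) : ℝ)) (Icc a b) :=
        hin (hhi.smul s)
      have h1 := (hS.tendsto_weak hG hab k hk).add_const
        (∫ t in Icc a b, (inner ℝ (s • h t) (k t) : ℝ))
      simp_rw [inner_add_left]
      rw [integral_add (hin (hG.integrableOn_of_modular hS.aesm hS.modular_limit)) hi3]
      refine h1.congr fun n => ?_
      rw [integral_add (hin (hS.integrable n)) hi3])
    (ε := s * (ε / 4)) (by positivity)
  have hen := hS.eventually_energy_le hL hG hΔ hab hβ hf (ε := s * (ε / 4)) (by positivity)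
  have hen' := hL.eventually_energy_ge hG hΔ hab hβ (fun n => continuous_prim (hS.cont n))
    hS.cont_limit hCp hCu hS.tendsto hS.cont hS.aesm hS.modular_limit hS.mean_limit hC
      (hS.tendsto_weak hG hab) (ε := s * (ε / 4)) (by positivity)
  obtain ⟨n, h1, h2, h3⟩ := (hincr.and (hshift.and hen)).exists
  linarith

/-- The bound for increments is divided by `s` and `s` tends to `0` from the right. One inequality
is enough because the test velocities are closed under negation. -/
theorem firstVariation_limit_le (hS : IsGalerkinSequence G Lx Lv f a b M 𝒟 v u w)
    (hL : IsConvexLagrangian G β L Lx Lv) (hG : IsGFunction G)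
    (hΔ : Delta2 G) (hab : a < b) (hβ : IntegrableOn β (Icc a b)) (hf : IntegrableOn f (Icc a b))
    {h : ℝ → Euc N} (hh : h ∈ 𝒟) : firstVariation Lx Lv f a b u w (prim a h) h ≤ 0 := by
  obtain ⟨C, hC0, hC, hCp, hCu⟩ := hS.exists_norm_bound hG hab
  have hhc := hS.test_cont h hh
  have hφc := continuous_prim (a := a) hhc
  obtain ⟨B₁, hB₁⟩ := isCompact_Icc.exists_bound_of_continuousOn (s := Icc a b) hhc.continuousOn
  obtain ⟨B₂, hB₂⟩ := isCompact_Icc.exists_bound_of_continuousOn (s := Icc a b) hφc.continuousOn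
  obtain ⟨-, hder⟩ := hL.hasDerivAt_integral hG hΔ hβ (R := max C (max B₁ B₂))
    hS.cont_limit.aestronglyMeasurable hS.aesm hφc hhc
    (fun t ht => (hCu t ht).trans (le_max_left _ _))
    (fun t ht => (hB₂ t ht).trans ((le_max_right _ _).trans (le_max_right _ _)))
    (fun t ht => (hB₁ t ht).trans ((le_max_left _ _).trans (le_max_right _ _)))
    hS.modular_limit
  refine le_of_forall_pos_le_add fun ε hε => ?_
  obtain ⟨δ, hδ, hinc⟩ := hS.exists_energy_increment_le hL hG hΔ hab hβ hf hh hε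
  have hslope := (hasDerivAt_iff_tendsto_slope.1 hder).mono_left
    (nhdsWithin_mono 0 (fun s (hs : s ∈ Ioi (0 : ℝ)) => ne_of_gt hs))
  have hle : ∫ t in Icc a b, dirDeriv Lx Lv t (u t) (w t) (prim a h t) (h t)
      ≤ -(∫ t in Icc a b, inner ℝ (f t) (prim a h t)) + ε := by
    refine le_of_tendsto hslope ?_
    filter_upwards [Ioo_mem_nhdsGT hδ] with s hs
    rw [slope_def_field]
    simp only [zero_smul, add_zero, sub_zero]
    rw [div_le_iff₀ hs.1]
    linarith [hinc s hs.1 hs.2]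
  unfold firstVariation
  linarith

/-- The limit of a Galerkin sequence is a critical point with respect to the test velocities. -/
theorem firstVariation_limit_eq_zero (hS : IsGalerkinSequence G Lx Lv f a b M 𝒟 v u w)
    (hL : IsConvexLagrangian G β L Lx Lv) (hG : IsGFunction G)
    (hΔ : Delta2 G) (hab : a < b) (hβ : IntegrableOn β (Icc a b)) (hf : IntegrableOn f (Icc a b))
    {h : ℝ → Euc N} (hh : h ∈ 𝒟) : firstVariation Lx Lv f a b u w (prim a h) h = 0 := by
  refine le_antisymm (hS.firstVariation_limit_le hL hG hΔ hab hβ hf hh) ?_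
  have h1 := hS.firstVariation_limit_le hL hG hΔ hab hβ hf (hS.test_neg h hh)
  have h2 : prim a (-h) = -prim a h := by
    ext1 t
    simp [prim, intervalIntegral.integral_neg]
  rw [h2] at h1
  have h3 : firstVariation Lx Lv f a b u w (-prim a h) (-h)
      = -firstVariation Lx Lv f a b u w (prim a h) h := by
    unfold firstVariation dirDeriv
    simp only [Pi.neg_apply, inner_neg_right, integral_neg, neg_add]
    congr 1
    rw [← integral_neg]
    exact integral_congr_ae (Eventually.of_forall fun t => (neg_add _ _).symm)
  rw [h3] at h1
  linarith

/-- Carries the lower bound on the Galerkin levels to the limit, which later excludes the zero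
curve. -/
theorem tendsto_action (hS : IsGalerkinSequence G Lx Lv f a b M 𝒟 v u w)
    (hL : IsConvexLagrangian G β L Lx Lv) (hG : IsGFunction G)
    (hΔ : Delta2 G) (hab : a < b) (hβ : IntegrableOn β (Icc a b))
    (hf : IntegrableOn f (Icc a b)) :
    Tendsto (fun n => (∫ t in Icc a b, L t (prim a (v n) t) (v n t))
        + ∫ t in Icc a b, inner ℝ (f t) (prim a (v n) t)) atTop
      (𝓝 ((∫ t in Icc a b, L t (u t) (w t)) + ∫ t in Icc a b, inner ℝ (f t) (u t))) := by
  obtain ⟨C, hC0, hC, hCp, hCu⟩ := hS.exists_norm_bound hG hab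
  refine (hS.tendsto_energy hL hG hΔ hab hβ hf).add ?_
  refine tendsto_integral_of_dominated_convergence (fun t => ‖f t‖ * C) (fun n => ?_)
    (hf.norm.mul_const C) (fun n => ?_) ?_
  · exact hf.aestronglyMeasurable.inner (continuous_prim (hS.cont n)).aestronglyMeasurable
  · filter_upwards [ae_restrict_mem measurableSet_Icc] with t ht
    exact (norm_inner_le_norm _ _).trans (mul_le_mul_of_nonneg_left (hCp n t ht) (norm_nonneg _))
  · filter_upwards [ae_restrict_mem measurableSet_Icc] with t ht
    exact tendsto_const_nhds.inner (hS.tendsto.tendsto_at ht)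

end IsGalerkinSequence

/-! ### The du Bois-Reymond lemma -/

/-- The du Bois-Reymond lemma: if `∫ ⟨q, prim h⟩ + ⟨p, h⟩ = 0` for all continuous `h` with zero
mean, then `p` agrees almost everywhere with a primitive of `q`. -/
theorem ae_eq_prim_of_integral_eq_zero {a b : ℝ} (hab : a < b) {p q : ℝ → Euc N}
    (hp : IntegrableOn p (Icc a b)) (hq : IntegrableOn q (Icc a b))
    (h0 : ∀ h : ℝ → Euc N, Continuous h → ∫ t in Icc a b, h t = 0 →
      ∫ t in Icc a b, (inner ℝ (q t) (prim a h t) + inner ℝ (p t) (h t)) = 0) :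
    ∃ c : Euc N, ∀ᵐ t ∂volume.restrict (Icc a b), p t = c + prim a q t := by
  have hQc := continuousOn_prim hab.le hq
  have hQi : IntegrableOn (prim a q) (Icc a b) := hQc.integrableOn_Icc
  have hba : 0 < b - a := sub_pos.2 hab
  have hvol : (volume.restrict (Icc a b)).real univ = b - a := by
    simp [measureReal_def, ENNReal.toReal_ofReal hba.le]
  -- The constant is the mean of `p` minus the primitive of `q`. With it `r` has zero mean, so that
  -- `r` is orthogonal to constants as well as to zero-mean functions.
  let c : Euc N := (b - a)⁻¹ • ∫ t in Icc a b, (p t - prim a q t)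
  let r : ℝ → Euc N := fun t => p t - prim a q t - c
  have hri : IntegrableOn r (Icc a b) := (hp.sub hQi).sub (integrable_const c)
  have hr0 : ∫ t in Icc a b, r t = 0 := by
    have i1 : IntegrableOn (fun t => p t - prim a q t) (Icc a b) := hp.sub hQi
    simp only [r]
    rw [integral_sub i1 (integrable_const c), integral_const, hvol]
    simp only [c]
    rw [smul_smul, mul_inv_cancel₀ hba.ne', one_smul, sub_self]
  have hin : ∀ {y k : ℝ → Euc N}, IntegrableOn y (Icc a b) → Continuous k →
      IntegrableOn (fun t => (inner ℝ (y t) (k t) : ℝ)) (Icc a b) := by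
    intro y k hy hk
    obtain ⟨B, hB⟩ := isCompact_Icc.exists_bound_of_continuousOn (s := Icc a b) hk.continuousOn
    refine (hy.norm.mul_const B).mono'
      (hy.aestronglyMeasurable.inner hk.aestronglyMeasurable) ?_
    filter_upwards [ae_restrict_mem measurableSet_Icc] with t ht
    exact (norm_inner_le_norm _ _).trans (mul_le_mul_of_nonneg_left (hB t ht) (norm_nonneg _))
  have hmean : ∀ h : ℝ → Euc N, Continuous h → ∫ t in Icc a b, h t = 0 →
      ∫ t in Icc a b, inner ℝ (r t) (h t) = 0 := by
    intro h hh hh0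
    have hhi : IntegrableOn h (Icc a b) := hh.continuousOn.integrableOn_Icc
    have h1 := h0 h hh hh0
    have h2 := integral_inner_prim_add hab.le hq hhi
    have h3 : prim a h b = 0 := by rw [prim, ← setIntegral_Icc_eq hab.le, hh0]
    rw [h3, inner_zero_right] at h2
    have hφ := continuous_prim (a := a) hh
    have e1 := hin hq hφ
    have e2 := hin hp hh
    have e3 := hin hQi hh
    rw [integral_add e1 e2] at h1
    rw [integral_add e1 e3] at h2
    have h4 : ∫ t in Icc a b, (inner ℝ c (h t) : ℝ) = 0 := by
      rw [integral_inner hhi, hh0, inner_zero_right]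
    have h5 : ∫ t in Icc a b, inner ℝ (r t) (h t)
        = (∫ t in Icc a b, inner ℝ (p t) (h t)) - (∫ t in Icc a b, inner ℝ (prim a q t) (h t))
          - ∫ t in Icc a b, (inner ℝ c (h t) : ℝ) := by
      have e4 : IntegrableOn (fun t => (inner ℝ (p t) (h t) : ℝ) - inner ℝ (prim a q t) (h t))
        (Icc a b) := e2.sub e3
      rw [← integral_sub e2 e3, ← integral_sub e4 (hin (integrable_const c) hh)]
      simp only [r, inner_sub_left]
    rw [h5, h4]
    linarith
  -- Every continuous function splits into its mean and a zero-mean part, and `r` is orthogonal to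
  -- both.
  have hall : ∀ h : ℝ → Euc N, Continuous h → ∫ t in Icc a b, inner ℝ (r t) (h t) = 0 := by
    intro h hh
    let m : Euc N := (b - a)⁻¹ • ∫ t in Icc a b, h t
    have h1 := hmean (fun t => h t - m) (hh.sub continuous_const) (by
      rw [integral_sub hh.continuousOn.integrableOn_Icc (integrable_const m), integral_const, hvol]
      simp only [m]
      rw [smul_smul, mul_inv_cancel₀ hba.ne', one_smul, sub_self])
    simp only [inner_sub_right] at h1
    rw [integral_sub (hin hri hh) (hin hri continuous_const)] at h1
    have h2 : ∫ t in Icc a b, (inner ℝ (r t) m : ℝ) = 0 := by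
      simp_rw [real_inner_comm m]
      rw [integral_inner hri, hr0, inner_zero_right]
    linarith
  refine ⟨c, ?_⟩
  have hzero : ∀ᵐ t ∂volume.restrict (Icc a b), r t = 0 := by
    refine ae_eq_zero_of_integral_contDiff_smul_eq_zero
      (μ := volume.restrict (Icc a b)) (Integrable.locallyIntegrable hri) fun g hg _ => ?_
    refine ext_inner_left ℝ fun y => ?_
    have hgi : Integrable (fun t => g t • r t) (volume.restrict (Icc a b)) := by
      obtain ⟨B, hB⟩ := isCompact_Icc.exists_bound_of_continuousOn (s := Icc a b)
        hg.continuous.continuousOn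
      refine (hri.norm.const_mul B).mono'
        (hg.continuous.aestronglyMeasurable.smul hri.aestronglyMeasurable) ?_
      filter_upwards [ae_restrict_mem measurableSet_Icc] with t ht
      rw [norm_smul]
      exact mul_le_mul_of_nonneg_right (hB t ht) (norm_nonneg _)
    rw [inner_zero_right, ← integral_inner hgi, ← hall (fun t => g t • y)
      (hg.continuous.smul continuous_const)]
    refine integral_congr_ae (Eventually.of_forall fun t => ?_)
    simp only [inner_smul_right, real_inner_comm]
  filter_upwards [hzero] with t ht
  simp only [r] at ht
  rw [sub_sub, sub_eq_zero] at ht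
  rw [ht, add_comm]

/-! ### The action on finitely many parameters -/

/-- The action with Lagrangian `L` and force `f` of the curve with velocity `v` starting at `0`. -/
def action (L : ℝ → Euc N → Euc N → ℝ) (f : ℝ → Euc N) (a b : ℝ) (v : ℝ → Euc N) : ℝ :=
  (∫ t in Icc a b, L t (prim a v t) (v t)) + ∫ t in Icc a b, inner ℝ (f t) (prim a v t)

theorem prim_add {a : ℝ} {v w : ℝ → Euc N} (hv : Continuous v) (hw : Continuous w) :
    prim a (v + w) = prim a v + prim a w := by
  ext1 t
  exact intervalIntegral.integral_add (hv.intervalIntegrable _ _) (hw.intervalIntegrable _ _)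

theorem prim_smul (a s : ℝ) (v : ℝ → Euc N) : prim a (s • v) = s • prim a v := by
  ext1 t
  simp only [prim, Pi.smul_apply, intervalIntegral.integral_smul]

theorem integrableOn_inner {a b : ℝ} {f y : ℝ → Euc N} (hf : IntegrableOn f (Icc a b))
    (hy : ContinuousOn y (Icc a b)) :
    IntegrableOn (fun t => (inner ℝ (f t) (y t) : ℝ)) (Icc a b) := by
  obtain ⟨B, hB⟩ := isCompact_Icc.exists_bound_of_continuousOn (s := Icc a b) hy
  refine (hf.norm.mul_const B).mono'
    (hf.aestronglyMeasurable.inner (hy.aestronglyMeasurable measurableSet_Icc)) ?_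
  filter_upwards [ae_restrict_mem measurableSet_Icc] with t ht
  exact (norm_inner_le_norm _ _).trans (mul_le_mul_of_nonneg_left (hB t ht) (norm_nonneg _))

section FiniteDimensional

variable {E : Type*} [NormedAddCommGroup E] [NormedSpace ℝ E] [FiniteDimensional ℝ E]

/-- The linear map sending a parametrized continuous velocity to its primitive. -/
def primLinearMap (a : ℝ) (ι : E →ₗ[ℝ] (ℝ → Euc N)) (hι : ∀ v, Continuous (ι v)) :
    E →ₗ[ℝ] (ℝ → Euc N) where
  toFun v := prim a (ι v)
  map_add' v w := by rw [map_add, prim_add (hι v) (hι w)]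
  map_smul' s v := by rw [map_smul, prim_smul]; rfl

theorem continuous_eval_linearMap (ι : E →ₗ[ℝ] (ℝ → Euc N)) (t : ℝ) :
    Continuous fun v => ι v t :=
  ((LinearMap.proj t : (ℝ → Euc N) →ₗ[ℝ] Euc N).comp ι).continuous_of_finiteDimensional

variable {a b K : ℝ} {ι : E →ₗ[ℝ] (ℝ → Euc N)}

omit [FiniteDimensional ℝ E] in
theorem norm_prim_linearMap_le (hab : a ≤ b) (hι : ∀ v, Continuous (ι v))
    (hιK : ∀ v, ∀ t ∈ Icc a b, ‖ι v t‖ ≤ K * ‖v‖) (v : E) {t : ℝ} (ht : t ∈ Icc a b) :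
    ‖prim a (ι v) t‖ ≤ (b - a) * (K * ‖v‖) := by
  have hi : IntegrableOn (ι v) (Icc a b) := (hι v).continuousOn.integrableOn_Icc
  refine (norm_prim_le hi ht).trans ?_
  calc ∫ s in Icc a b, ‖ι v s‖ ≤ ∫ _ in Icc a b, K * ‖v‖ :=
        setIntegral_mono_on hi.norm (integrable_const _) measurableSet_Icc fun s hs => hιK v s hs
    _ = _ := by simp [hab]

/-- Integral functionals depend continuously on finitely many parameters of the velocity. -/
theorem continuous_integral_comp_prim (hab : a ≤ b) (hι : ∀ v, Continuous (ι v))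
    (hιK : ∀ v, ∀ t ∈ Icc a b, ‖ι v t‖ ≤ K * ‖v‖) {Ψ : ℝ → Euc N → Euc N → ℝ}
    (hΨ : Continuous fun z : ℝ × Euc N × Euc N => Ψ z.1 z.2.1 z.2.2) :
    Continuous fun v => ∫ t in Icc a b, Ψ t (prim a (ι v) t) (ι v t) := by
  refine continuous_iff_continuousAt.2 fun v => ?_
  have hev : ∀ᶠ w in 𝓝 v, ‖w‖ ≤ ‖v‖ + 1 :=
    (continuous_norm.tendsto v).eventually_le_const (lt_add_one _)
  refine tendsto_integral_comp (R := max ((b - a) * (|K| * (‖v‖ + 1))) (|K| * (‖v‖ + 1))) hΨ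
    (fun w => (continuous_prim (hι w)).aestronglyMeasurable)
    (fun w => (hι w).aestronglyMeasurable) ?_ ?_
    (fun t _ => (continuous_eval_linearMap (primLinearMap a ι hι) t).tendsto v)
    (Eventually.of_forall fun t => (continuous_eval_linearMap ι t).tendsto v)
  · filter_upwards [hev] with w hw t ht
    refine (norm_prim_linearMap_le hab hι hιK w ht).trans (le_trans ?_ (le_max_left _ _))
    refine mul_le_mul_of_nonneg_left ?_ (sub_nonneg.2 hab)
    exact mul_le_mul (le_abs_self K) hw (norm_nonneg _) (abs_nonneg _)
  · filter_upwards [hev] with w hw t ht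
    refine ((hιK w t ht).trans ?_).trans (le_max_right _ _)
    exact mul_le_mul (le_abs_self K) hw (norm_nonneg _) (abs_nonneg _)

/-- The force term as a linear functional of the parameters. -/
def forceLinearMap (a b : ℝ) (ι : E →ₗ[ℝ] (ℝ → Euc N)) (hι : ∀ v, Continuous (ι v))
    {f : ℝ → Euc N} (hf : IntegrableOn f (Icc a b)) : E →ₗ[ℝ] ℝ where
  toFun v := ∫ t in Icc a b, inner ℝ (f t) (prim a (ι v) t)
  map_add' v w := by
    rw [← integral_add (integrableOn_inner hf (continuous_prim (hι v)).continuousOn)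
      (integrableOn_inner hf (continuous_prim (hι w)).continuousOn)]
    simp only [map_add, prim_add (hι v) (hι w), Pi.add_apply, inner_add_right]
  map_smul' s v := by
    simp only [map_smul, prim_smul, Pi.smul_apply, inner_smul_right, integral_const_mul,
      RingHom.id_apply, smul_eq_mul]

variable {G : Euc N → ℝ} {β : ℝ → ℝ} {L : ℝ → Euc N → Euc N → ℝ}
  {Lx Lv : ℝ → Euc N → Euc N → Euc N} {f : ℝ → Euc N}

theorem IsConvexLagrangian.continuous_action (hL : IsConvexLagrangian G β L Lx Lv) (hab : a ≤ b)
    (hι : ∀ v, Continuous (ι v)) (hιK : ∀ v, ∀ t ∈ Icc a b, ‖ι v t‖ ≤ K * ‖v‖)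
    (hf : IntegrableOn f (Icc a b)) : Continuous fun v => action L f a b (ι v) :=
  (continuous_integral_comp_prim hab hι hιK hL.cont).add
    (forceLinearMap a b ι hι hf).continuous_of_finiteDimensional

theorem IsConvexLagrangian.continuous_dirDeriv_curve (hL : IsConvexLagrangian G β L Lx Lv)
    {x v φ h : ℝ → Euc N} (hx : Continuous x) (hv : Continuous v) (hφ : Continuous φ)
    (hh : Continuous h) : Continuous fun t => dirDeriv Lx Lv t (x t) (v t) (φ t) (h t) :=
  hL.continuous_dirDeriv.comp (f := fun t => (t, x t, v t, φ t, h t)) (by fun_prop)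

/-- The differential of the action at a given velocity, restricted to finitely many parameters. -/
def actionDifferential (hL : IsConvexLagrangian G β L Lx Lv) (a b : ℝ)
    (ι : E →ₗ[ℝ] (ℝ → Euc N)) (hι : ∀ v, Continuous (ι v))
    (hf : IntegrableOn f (Icc a b)) (v : E) : E →L[ℝ] ℝ :=
  LinearMap.toContinuousLinearMap
    { toFun := fun h => firstVariation Lx Lv f a b (prim a (ι v)) (ι v) (prim a (ι h)) (ι h)
      map_add' := fun h k => by
        have hi : ∀ h : E, IntegrableOn (fun t => dirDeriv Lx Lv t (prim a (ι v) t) (ι v t)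
            (prim a (ι h) t) (ι h t)) (Icc a b) := fun h =>
          (hL.continuous_dirDeriv_curve (continuous_prim (hι v)) (hι v) (continuous_prim (hι h))
            (hι h)).continuousOn.integrableOn_Icc
        have h1 := (forceLinearMap a b ι hι hf).map_add h k
        simp only [forceLinearMap, LinearMap.coe_mk, AddHom.coe_mk] at h1
        unfold firstVariation
        rw [h1, add_add_add_comm, ← integral_add (hi h) (hi k)]
        congr 1
        refine integral_congr_ae (Eventually.of_forall fun t => ?_)
        simp only [dirDeriv, map_add, prim_add (hι h) (hι k), Pi.add_apply, inner_add_right]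
        ring
      map_smul' := fun s h => by
        have h1 := (forceLinearMap a b ι hι hf).map_smul s h
        simp only [forceLinearMap, LinearMap.coe_mk, AddHom.coe_mk] at h1
        unfold firstVariation
        rw [h1, RingHom.id_apply, smul_add]
        congr 1
        rw [smul_eq_mul, ← integral_const_mul]
        refine integral_congr_ae (Eventually.of_forall fun t => ?_)
        simp only [dirDeriv, map_smul, prim_smul, Pi.smul_apply, inner_smul_right]
        ring }

theorem actionDifferential_apply (hL : IsConvexLagrangian G β L Lx Lv)
    (hι : ∀ v, Continuous (ι v)) (hf : IntegrableOn f (Icc a b)) (v h : E) :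
    actionDifferential hL a b ι hι hf v h
      = firstVariation Lx Lv f a b (prim a (ι v)) (ι v) (prim a (ι h)) (ι h) := rfl

theorem continuous_actionDifferential (hL : IsConvexLagrangian G β L Lx Lv) (hab : a ≤ b)
    (hι : ∀ v, Continuous (ι v)) (hιK : ∀ v, ∀ t ∈ Icc a b, ‖ι v t‖ ≤ K * ‖v‖)
    (hf : IntegrableOn f (Icc a b)) : Continuous (actionDifferential hL a b ι hι hf) := by
  refine continuous_clm_apply.2 fun h => ?_
  simp only [actionDifferential_apply, firstVariation]
  exact (continuous_integral_comp_prim hab hι hιK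
    (Ψ := fun t x v => dirDeriv Lx Lv t x v (prim a (ι h) t) (ι h t))
    (hL.continuous_dirDeriv_comp (continuous_prim (hι h)) (hι h))).add continuous_const

theorem hasDerivAt_action (hL : IsConvexLagrangian G β L Lx Lv) (hG : IsGFunction G)
    (hΔ : Delta2 G) (hβ : IntegrableOn β (Icc a b)) (hι : ∀ v, Continuous (ι v))
    (hf : IntegrableOn f (Icc a b)) (v h : E) :
    HasDerivAt (fun s : ℝ => action L f a b (ι (v + s • h)))
      (actionDifferential hL a b ι hι hf v h) 0 := by
  have hb : ∀ {y : ℝ → Euc N}, Continuous y → ∃ B, ∀ t ∈ Icc a b, ‖y t‖ ≤ B := fun hy =>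
    isCompact_Icc.exists_bound_of_continuousOn (s := Icc a b) hy.continuousOn
  obtain ⟨B₁, hB₁⟩ := hb (continuous_prim (a := a) (hι v))
  obtain ⟨B₂, hB₂⟩ := hb (continuous_prim (a := a) (hι h))
  obtain ⟨B₃, hB₃⟩ := hb (hι h)
  have h1 := (hL.hasDerivAt_integral hG hΔ hβ (R := max B₁ (max B₂ B₃))
    (continuous_prim (a := a) (hι v)).aestronglyMeasurable (hι v).aestronglyMeasurable
    (continuous_prim (a := a) (hι h)) (hι h)
    (fun t ht => (hB₁ t ht).trans (le_max_left _ _))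
    (fun t ht => (hB₂ t ht).trans ((le_max_left _ _).trans (le_max_right _ _)))
    (fun t ht => (hB₃ t ht).trans ((le_max_right _ _).trans (le_max_right _ _)))
    ((hG.continuous.comp (hι v)).continuousOn.integrableOn_Icc)).2
  let Λ := forceLinearMap a b ι hι hf
  have h2 : HasDerivAt (fun s : ℝ => Λ v + s * Λ h) (Λ h) 0 := by
    simpa using ((hasDerivAt_id (0 : ℝ)).mul_const (Λ h)).const_add (Λ v)
  refine (h1.add h2).congr_of_eventuallyEq (Eventually.of_forall fun s => ?_)
  have h3 : action L f a b (ι (v + s • h)) = (∫ t in Icc a b, L t (prim a (ι (v + s • h)) t)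
      (ι (v + s • h) t)) + Λ (v + s • h) := rfl
  have h4 : ∀ t, prim a (ι (v + s • h)) t = prim a (ι v) t + s • prim a (ι h) t := fun t => by
    have := congrFun ((primLinearMap a ι hι).map_add v (s • h)) t
    rw [map_smul] at this
    exact this
  simp only [h3, h4, Pi.add_apply]
  simp only [map_add, map_smul, Pi.add_apply, Pi.smul_apply, smul_eq_mul]

/-- On finitely many independent parameters the `L¹` norm controls the norm. -/
theorem exists_mul_norm_le_integral (hab : a < b) (hι : ∀ v, Continuous (ι v))
    (hιK : ∀ v, ∀ t ∈ Icc a b, ‖ι v t‖ ≤ K * ‖v‖)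
    (hιi : ∀ v, (∀ t ∈ Icc a b, ι v t = 0) → v = 0) :
    ∃ k > 0, ∀ v : E, k * ‖v‖ ≤ ∫ t in Icc a b, ‖ι v t‖ := by
  have hq : Continuous fun v : E => ∫ t in Icc a b, ‖ι v t‖ :=
    continuous_integral_comp_prim hab.le hι hιK (Ψ := fun _ _ v => ‖v‖) (by fun_prop)
  have hpos : ∀ v : E, v ≠ 0 → 0 < ∫ t in Icc a b, ‖ι v t‖ := by
    intro v hv
    have h0 : 0 ≤ ∫ t in Icc a b, ‖ι v t‖ := integral_nonneg fun _ => norm_nonneg _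
    refine lt_of_le_of_ne h0 fun h => hv (hιi v fun t ht => ?_)
    rw [setIntegral_Icc_eq hab.le] at h
    by_contra hne
    have := intervalIntegral.integral_pos hab (hι v).norm.continuousOn
      (fun _ _ => norm_nonneg _) ⟨t, ht, norm_pos_iff.2 hne⟩
    linarith
  have : ProperSpace E := FiniteDimensional.proper_real E
  rcases (Metric.sphere (0 : E) 1).eq_empty_or_nonempty with hs | hs
  · refine ⟨1, one_pos, fun v => ?_⟩
    have : v = 0 := by
      by_contra hv
      have : ‖v‖⁻¹ • v ∈ Metric.sphere (0 : E) 1 := by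
        rw [mem_sphere_zero_iff_norm, norm_smul, norm_inv, norm_norm,
          inv_mul_cancel₀ (norm_ne_zero_iff.2 hv)]
      rw [hs] at this
      exact this
    simp [this]
  · obtain ⟨v₀, hv₀, hmin⟩ := (isCompact_sphere (0 : E) 1).exists_isMinOn hs hq.continuousOn
    refine ⟨_, hpos v₀ (by rintro rfl; simp at hv₀), fun v => ?_⟩
    rcases eq_or_ne v 0 with rfl | hv
    · simp
    have hn := norm_pos_iff.2 hv
    have h1 := isMinOn_iff.1 hmin (‖v‖⁻¹ • v) (by
      rw [mem_sphere_zero_iff_norm, norm_smul, norm_inv, norm_norm,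
          inv_mul_cancel₀ hn.ne'])
    simp only [map_smul, Pi.smul_apply, norm_smul, norm_inv, norm_norm,
      integral_const_mul] at h1
    rw [mul_comm]
    calc _ ≤ ‖v‖ * (‖v‖⁻¹ * ∫ t in Icc a b, ‖ι v t‖) := mul_le_mul_of_nonneg_left h1 hn.le
      _ = _ := by rw [← mul_assoc, mul_inv_cancel₀ hn.ne', one_mul]

/-- A mountain pass critical point of the action with respect to finitely many parameters. -/
theorem exists_galerkin_critical (hL : IsConvexLagrangian G β L Lx Lv) (hG : IsGFunction G)
    (hΔ : Delta2 G) (hab : a < b) (hβ : IntegrableOn β (Icc a b)) (hf : IntegrableOn f (Icc a b))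
    (hι : ∀ v, Continuous (ι v)) (hιK : ∀ v, ∀ t ∈ Icc a b, ‖ι v t‖ ≤ K * ‖v‖)
    (hιi : ∀ v, (∀ t ∈ Icc a b, ι v t = 0) → v = 0)
    {κ μ c r c₀ c₁ : ℝ} (hκ : 0 < κ) (hμ : 0 ≤ μ) (hc₀ : 0 < c₀)
    (hAR : ∀ v : E, κ * ∫ t in Icc a b, G (ι v t) ≤ action L f a b (ι v)
      - μ * firstVariation Lx Lv f a b (prim a (ι v)) (ι v) (prim a (ι v)) (ι v) + c)
    (hbar : ∀ v : E, ∫ t in Icc a b, G (r⁻¹ • ι v t) = 1 → c₀ ≤ action L f a b (ι v))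
    (h0 : action L f a b (0 : ℝ → Euc N) ≤ 0) {e : E} (he : action L f a b (ι e) ≤ 0)
    (he1 : 1 ≤ ∫ t in Icc a b, G (r⁻¹ • ι e t))
    (hc₁ : ∀ s ∈ Icc (0 : ℝ) 1, action L f a b (s • ι e) ≤ c₁) :
    ∃ v : E, c₀ ≤ action L f a b (ι v) ∧ action L f a b (ι v) ≤ c₁ ∧
      ∀ h : E, firstVariation Lx Lv f a b (prim a (ι v)) (ι v) (prim a (ι h)) (ι h) = 0 := by
  obtain ⟨k, hk, hkle⟩ := exists_mul_norm_le_integral hab hι hιK hιi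
  obtain ⟨c', hc', hnorm⟩ := hG.integral_norm_le hab.le
  obtain ⟨v, hv1, hv2, hv3⟩ := mountainPass (J := fun v : E => action L f a b (ι v))
    (D := actionDifferential hL a b ι hι hf) (hL.continuous_action hab.le hι hιK hf)
    (continuous_actionDifferential hL hab.le hι hιK hf)
    (hasDerivAt_action hL hG hΔ hβ hι hf) hc₀ (by simpa using h0) he
    -- The scaled modular is continuous along the path, equals `0` at its start and is at least `1`
    -- at its end. By the intermediate value theorem the path crosses the set of unit modular.
    (fun γ hγ0 hγ1 => by
      have hcont : Continuous fun s => ∫ t in Icc a b, G (r⁻¹ • ι (γ s) t) :=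
        (continuous_integral_comp_prim hab.le hι hιK (Ψ := fun _ _ v => G (r⁻¹ • v))
          (hG.continuous.comp (by fun_prop))).comp γ.continuous
      obtain ⟨s, hs⟩ := mem_range_of_exists_le_of_exists_ge hcont
        (c := 1) ⟨0, by simp [hγ0, hG.zero]⟩ ⟨1, by rw [hγ1]; exact he1⟩
      exact ⟨s, hbar _ hs⟩)
    (by simpa only [map_smul] using hc₁)
    (by
      -- With this bound on the differential, the term `μ * D v v` uses up at most half of the lower
      -- bound `κ * k * ‖v‖` that the modular provides through the `L¹` norm. The other half bounds
      -- `‖v‖`.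
      refine ⟨κ * k / (2 * (μ + 1)), by positivity,
        2 * (c₁ + c + κ * c') / (κ * k), fun v hv hD => ?_⟩
      have h1 := hAR v
      have h2 := (actionDifferential hL a b ι hι hf v).le_opNorm v
      rw [actionDifferential_apply] at h2
      have h3 := hnorm (ι v) (hι v).continuousOn.integrableOn_Icc
        (hG.continuous.comp (hι v)).continuousOn.integrableOn_Icc
      have h4 := hkle v
      have h5 := neg_le_of_abs_le h2
      have h6 : ‖actionDifferential hL a b ι hι hf v‖ * ‖v‖ ≤ κ * k / (2 * (μ + 1)) * ‖v‖ :=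
        mul_le_mul_of_nonneg_right hD (norm_nonneg _)
      have h7 : μ * (κ * k / (2 * (μ + 1)) * ‖v‖) ≤ κ * k / 2 * ‖v‖ := by
        have : μ * (κ * k / (2 * (μ + 1))) ≤ κ * k / 2 := by
          rw [mul_div_assoc', div_le_div_iff₀ (by positivity) (by positivity)]
          nlinarith [mul_pos hκ hk]
        nlinarith [norm_nonneg v]
      rw [le_div_iff₀ (by positivity)]
      have h8 : κ * (k * ‖v‖) ≤ κ * ((∫ t in Icc a b, G (ι v t)) + c') :=
        mul_le_mul_of_nonneg_left (h4.trans h3) hκ.le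
      have h9 := mul_le_mul_of_nonneg_left (show -(firstVariation Lx Lv f a b (prim a (ι v)) (ι v)
        (prim a (ι v)) (ι v)) ≤ κ * k / (2 * (μ + 1)) * ‖v‖ by linarith) hμ
      nlinarith)
  refine ⟨v, hv1, hv2, fun h => ?_⟩
  rw [← actionDifferential_apply hL hι hf, hv3]
  rfl

end FiniteDimensional

/-! ### The Galerkin scheme on continuous velocities of zero mean -/

/-- The space of continuous velocities with zero mean on `[a, b]`. -/
def zeroMean (N : ℕ) {a b : ℝ} (hab : a ≤ b) : Submodule ℝ C(Icc a b, Euc N) where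
  carrier := {v | ∫ t in Icc a b, IccExtend hab v t = 0}
  zero_mem' := by
    simp only [mem_ofPred_eq]
    exact integral_eq_zero_of_ae (Eventually.of_forall fun _ => rfl)
  add_mem' := by
    intro v w hv hw
    have h1 : IntegrableOn (IccExtend hab v) (Icc a b) :=
      (v.continuous.Icc_extend').continuousOn.integrableOn_Icc
    have h2 : IntegrableOn (IccExtend hab w) (Icc a b) :=
      (w.continuous.Icc_extend').continuousOn.integrableOn_Icc
    simp only [mem_ofPred_eq] at hv hw ⊢
    have : ∀ t, IccExtend hab (v + w) t = IccExtend hab v t + IccExtend hab w t := fun _ => rfl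
    simp only [this]
    rw [integral_add h1 h2, hv, hw, add_zero]
  smul_mem' := by
    intro s v hv
    simp only [mem_ofPred_eq] at hv ⊢
    have : ∀ t, IccExtend hab (s • v) t = s • IccExtend hab v t := fun _ => rfl
    simp only [this]
    rw [integral_smul, hv, smul_zero]

instance {a b : ℝ} (hab : a ≤ b) : NormedAddCommGroup (zeroMean N hab) :=
  Submodule.normedAddCommGroup _

/-- The extension of a continuous velocity by constants. -/
def zeroMeanExtend {a b : ℝ} (hab : a ≤ b) : zeroMean N hab →ₗ[ℝ] (ℝ → Euc N) where
  toFun v := IccExtend hab (v : C(Icc a b, Euc N))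
  map_add' _ _ := rfl
  map_smul' _ _ := rfl

section

variable {a b : ℝ} (hab : a ≤ b)

theorem continuous_zeroMeanExtend (v : zeroMean N hab) : Continuous (zeroMeanExtend hab v) :=
  (v : C(Icc a b, Euc N)).continuous.Icc_extend'

theorem norm_zeroMeanExtend_le (v : zeroMean N hab) (t : ℝ) : ‖zeroMeanExtend hab v t‖ ≤ ‖v‖ :=
  (v : C(Icc a b, Euc N)).norm_coe_le_norm _

theorem zeroMeanExtend_eq_zero {v : zeroMean N hab}
    (hv : ∀ t ∈ Icc a b, zeroMeanExtend hab v t = 0) : v = 0 := by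
  refine Subtype.ext (ContinuousMap.ext fun t => ?_)
  have := hv t t.2
  rwa [show zeroMeanExtend hab v t = (v : C(Icc a b, Euc N)) t from IccExtend_val hab _ t] at this

/-- Restriction of a continuous function with zero mean. -/
theorem exists_zeroMeanExtend_eq {h : ℝ → Euc N} (hh : Continuous h)
    (h0 : ∫ t in Icc a b, h t = 0) :
    ∃ v : zeroMean N hab, ∀ t ∈ Icc a b, zeroMeanExtend hab v t = h t := by
  let v : C(Icc a b, Euc N) := ⟨fun t => h t, by fun_prop⟩
  have hv : ∀ t ∈ Icc a b, IccExtend hab v t = h t := fun t ht => IccExtend_of_mem hab v ht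
  refine ⟨⟨v, ?_⟩, hv⟩
  change ∫ t in Icc a b, IccExtend hab v t = 0
  rw [setIntegral_congr_fun measurableSet_Icc hv, h0]

theorem prim_congr {v w : ℝ → Euc N} (hvw : ∀ t ∈ Icc a b, v t = w t) {t : ℝ} (ht : t ∈ Icc a b) :
    prim a v t = prim a w t := by
  refine intervalIntegral.integral_congr fun s hs => hvw s ?_
  rw [uIcc_of_le ht.1] at hs
  exact ⟨hs.1, hs.2.trans ht.2⟩

theorem action_congr {L : ℝ → Euc N → Euc N → ℝ} {f v w : ℝ → Euc N}
    (hvw : ∀ t ∈ Icc a b, v t = w t) : action L f a b v = action L f a b w := by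
  unfold action
  congr 1 <;> refine setIntegral_congr_fun measurableSet_Icc fun t ht => ?_
  · simp only [prim_congr hvw ht, hvw t ht]
  · simp only [prim_congr hvw ht]

end

variable {G : Euc N → ℝ} {β : ℝ → ℝ} {L : ℝ → Euc N → Euc N → ℝ}
  {Lx Lv : ℝ → Euc N → Euc N → Euc N} {f : ℝ → Euc N} {a b : ℝ}

/-- Both partial gradients along the limit and the force are integrable, so the first variation is
continuous in the test velocity for the uniform norm; uniform density of the test class suffices. -/
theorem IsGalerkinSequence.firstVariation_eq_zero_of_continuous {M : ℝ} {𝒟 : Set (ℝ → Euc N)}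
    {v : ℕ → ℝ → Euc N} {u w : ℝ → Euc N} (hS : IsGalerkinSequence G Lx Lv f a b M 𝒟 v u w)
    (hL : IsConvexLagrangian G β L Lx Lv) (hG : IsGFunction G)
    (hΔ : Delta2 G) (hab : a < b) (hβ : IntegrableOn β (Icc a b)) (hf : IntegrableOn f (Icc a b))
    {h : ℝ → Euc N} (hh : Continuous h) (h0 : ∫ t in Icc a b, h t = 0) :
    firstVariation Lx Lv f a b u w (prim a h) h = 0 := by
  obtain ⟨C, hC0, hC, hCp, hCu⟩ := hS.exists_norm_bound hG hab
  obtain ⟨hX, hV⟩ := hL.integrable_gradients hβ hS.cont_limit.aestronglyMeasurable hS.aesm hCu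
    hS.modular_limit
  set Q := (b - a) * ((∫ t in Icc a b, ‖Lx t (u t) (w t)‖) + ∫ t in Icc a b, ‖f t‖)
    + ∫ t in Icc a b, ‖Lv t (u t) (w t)‖ with hQ
  have hba : 0 ≤ b - a := (sub_pos.2 hab).le
  have hQ0 : 0 ≤ Q := by
    have h1 : 0 ≤ ∫ t in Icc a b, ‖Lx t (u t) (w t)‖ := integral_nonneg fun _ => norm_nonneg _
    have h2 : 0 ≤ ∫ t in Icc a b, ‖Lv t (u t) (w t)‖ := integral_nonneg fun _ => norm_nonneg _
    have h3 : 0 ≤ ∫ t in Icc a b, ‖f t‖ := integral_nonneg fun _ => norm_nonneg _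
    positivity
  have hbound : ∀ ε > 0, |firstVariation Lx Lv f a b u w (prim a h) h| ≤ 0 + ε * Q := by
    intro ε hε
    obtain ⟨k, hk, hkε⟩ := hS.test_dense h hh h0 ε hε
    have hkc := hS.test_cont k hk
    have hzero := hS.firstVariation_limit_eq_zero hL hG hΔ hab hβ hf hk
    have hi : IntegrableOn (fun t => h t - k t) (Icc a b) :=
      (hh.sub hkc).continuousOn.integrableOn_Icc
    have hp : ∀ t ∈ Icc a b, ‖prim a h t - prim a k t‖ ≤ (b - a) * ε := by
      intro t ht
      have h1 : prim a h t - prim a k t = prim a (fun s => h s - k s) t :=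
        (intervalIntegral.integral_sub (hh.intervalIntegrable _ _)
          (hkc.intervalIntegrable _ _)).symm
      rw [h1]
      refine (norm_prim_le hi ht).trans ?_
      calc ∫ s in Icc a b, ‖h s - k s‖ ≤ ∫ _ in Icc a b, ε :=
            setIntegral_mono_on hi.norm (integrable_const _) measurableSet_Icc hkε
        _ = _ := by simp [hab.le]
    have e1 := fun {y : ℝ → Euc N} (hy : Continuous y) => integrableOn_inner hX
      (hy.continuousOn (s := Icc a b))
    have e2 := fun {y : ℝ → Euc N} (hy : Continuous y) => integrableOn_inner hV
      (hy.continuousOn (s := Icc a b))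
    have e3 := fun {y : ℝ → Euc N} (hy : Continuous y) => integrableOn_inner hf
      (hy.continuousOn (s := Icc a b))
    have hsum : ∀ y : ℝ → Euc N, Continuous y → firstVariation Lx Lv f a b u w (prim a y) y =
        ∫ t in Icc a b, (inner ℝ (Lx t (u t) (w t)) (prim a y t) + inner ℝ (Lv t (u t) (w t)) (y t)
          + inner ℝ (f t) (prim a y t)) := by
      intro y hy
      have hpy := continuous_prim (a := a) hy
      have e4 : IntegrableOn (fun t => (inner ℝ (Lx t (u t) (w t)) (prim a y t)
        + inner ℝ (Lv t (u t) (w t)) (y t) : ℝ)) (Icc a b) := (e1 hpy).add (e2 hy)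
      rw [integral_add e4 (e3 hpy)]
      rfl
    have hint : ∀ y : ℝ → Euc N, Continuous y → IntegrableOn
        (fun t => (inner ℝ (Lx t (u t) (w t)) (prim a y t) + inner ℝ (Lv t (u t) (w t)) (y t)
          + inner ℝ (f t) (prim a y t) : ℝ)) (Icc a b) := fun y hy =>
      ((e1 (continuous_prim hy)).add (e2 hy)).add (e3 (continuous_prim hy))
    have hdiff : firstVariation Lx Lv f a b u w (prim a h) h
        = ∫ t in Icc a b, (inner ℝ (Lx t (u t) (w t)) (prim a h t - prim a k t)
          + inner ℝ (Lv t (u t) (w t)) (h t - k t) + inner ℝ (f t) (prim a h t - prim a k t)) := by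
      rw [← sub_zero (firstVariation Lx Lv f a b u w (prim a h) h), ← hzero, hsum h hh,
        hsum k hkc, ← integral_sub (hint h hh) (hint k hkc)]
      refine integral_congr_ae (Eventually.of_forall fun t => ?_)
      simp only [inner_sub_right]
      ring
    have i1 : IntegrableOn (fun t => (b - a) * (‖Lx t (u t) (w t)‖ + ‖f t‖)) (Icc a b) :=
      (hX.norm.add hf.norm).const_mul _
    have i2 : IntegrableOn (fun t => ε * ((b - a) * (‖Lx t (u t) (w t)‖ + ‖f t‖)
      + ‖Lv t (u t) (w t)‖)) (Icc a b) := (i1.add hV.norm).const_mul _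
    rw [zero_add, hdiff, ← Real.norm_eq_abs]
    refine (norm_integral_le_of_norm_le i2 ?_).trans_eq ?_
    · filter_upwards [ae_restrict_mem measurableSet_Icc] with t ht
      have h1 := (norm_inner_le_norm (𝕜 := ℝ) (Lx t (u t) (w t)) (prim a h t - prim a k t)).trans
        (mul_le_mul_of_nonneg_left (hp t ht) (norm_nonneg _))
      have h2 := (norm_inner_le_norm (𝕜 := ℝ) (f t) (prim a h t - prim a k t)).trans
        (mul_le_mul_of_nonneg_left (hp t ht) (norm_nonneg _))
      have h3 := (norm_inner_le_norm (𝕜 := ℝ) (Lv t (u t) (w t)) (h t - k t)).trans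
        (mul_le_mul_of_nonneg_left (hkε t ht) (norm_nonneg _))
      refine (norm_add₃_le).trans ?_
      linarith
    · rw [integral_const_mul, integral_add i1 hV.norm, integral_const_mul,
        integral_add hX.norm hf.norm, hQ]
  refine abs_nonpos_iff.1 (le_of_forall_pos_le_add fun ε hε => ?_)
  refine (hbound (ε / (Q + 1)) (by positivity)).trans ?_
  have : ε / (Q + 1) * Q ≤ ε := by
    rw [div_mul_eq_mul_div, div_le_iff₀ (by positivity)]
    nlinarith
  linarith

/-- Mountain pass critical points of the action on an exhausting sequence of finite-dimensional
spaces of velocities. -/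
theorem exists_galerkin_sequence {X : Type*} [NormedAddCommGroup X] [NormedSpace ℝ X]
    [TopologicalSpace.SeparableSpace X] {ι : X →ₗ[ℝ] (ℝ → Euc N)}
    (hL : IsConvexLagrangian G β L Lx Lv) (hG : IsGFunction G)
    (hΔ : Delta2 G) (hab : a < b) (hβ : IntegrableOn β (Icc a b)) (hf : IntegrableOn f (Icc a b))
    (hι : ∀ v, Continuous (ι v)) (hιn : ∀ v t, ‖ι v t‖ ≤ ‖v‖)
    (hιi : ∀ v, (∀ t ∈ Icc a b, ι v t = 0) → v = 0)
    {κ μ c r c₀ c₁ : ℝ} (hκ : 0 < κ) (hμ : 0 ≤ μ) (hc₀ : 0 < c₀)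
    (hAR : ∀ v : X, κ * ∫ t in Icc a b, G (ι v t) ≤ action L f a b (ι v)
      - μ * firstVariation Lx Lv f a b (prim a (ι v)) (ι v) (prim a (ι v)) (ι v) + c)
    (hbar : ∀ v : X, ∫ t in Icc a b, G (r⁻¹ • ι v t) = 1 → c₀ ≤ action L f a b (ι v))
    (h0 : action L f a b (0 : ℝ → Euc N) ≤ 0) {e : X} (he : action L f a b (ι e) ≤ 0)
    (he1 : 1 ≤ ∫ t in Icc a b, G (r⁻¹ • ι e t))
    (hc₁ : ∀ s ∈ Icc (0 : ℝ) 1, action L f a b (s • ι e) ≤ c₁) :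
    ∃ (E : ℕ → Submodule ℝ X) (v : ℕ → X), Monotone E ∧
      (∀ z ε, 0 < ε → ∃ n, ∃ h ∈ E n, ‖z - h‖ < ε) ∧
      ∀ n, v n ∈ E n ∧ c₀ ≤ action L f a b (ι (v n)) ∧ action L f a b (ι (v n)) ≤ c₁ ∧
        ∀ h ∈ E n, firstVariation Lx Lv f a b (prim a (ι (v n))) (ι (v n)) (prim a (ι h)) (ι h)
          = 0 := by
  let d := TopologicalSpace.denseSeq X
  -- The endpoint `e` is put into every space, so that the same path, barrier `c₀` and upper level
  -- `c₁` serve for all `n`.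
  let E : ℕ → Submodule ℝ X := fun n => Submodule.span ℝ (insert e (d '' Iic n))
  have hcrit : ∀ n, ∃ v ∈ E n, c₀ ≤ action L f a b (ι v) ∧ action L f a b (ι v) ≤ c₁ ∧
      ∀ h ∈ E n, firstVariation Lx Lv f a b (prim a (ι v)) (ι v) (prim a (ι h)) (ι h) = 0 := by
    intro n
    have : FiniteDimensional ℝ (E n) :=
      FiniteDimensional.span_of_finite ℝ (((finite_Iic n).image d).insert e)
    obtain ⟨v, hv1, hv2, hv3⟩ := exists_galerkin_critical (E := E n) (K := 1)
      (ι := ι.comp (E n).subtype) hL hG hΔ hab hβ hf (fun v => hι v)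
      (fun v t _ => by
        rw [one_mul]
        exact hιn v t)
      (fun v hv => Subtype.ext (hιi v hv)) hκ hμ hc₀ (fun v => hAR v) (fun v => hbar v) h0
      (e := ⟨e, Submodule.subset_span (mem_insert _ _)⟩) he he1 hc₁
    exact ⟨v, v.2, hv1, hv2, fun h hh => hv3 ⟨h, hh⟩⟩
  choose v hvE hv using hcrit
  refine ⟨E, v, fun m n hmn =>
    Submodule.span_mono (insert_subset_insert (image_mono (Iic_subset_Iic.2 hmn))),
    fun z ε hε => ?_, fun n => ⟨hvE n, hv n⟩⟩
  obtain ⟨k, hk⟩ := (TopologicalSpace.denseRange_denseSeq X).exists_dist_lt z hε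
  exact ⟨k, d k, Submodule.subset_span (mem_insert_of_mem _ (mem_image_of_mem _
    (mem_Iic.2 le_rfl))), by rwa [← dist_eq_norm]⟩

/-- Existence of a mountain pass critical point of the action, given a separable parametrization
of the continuous velocities with zero mean. -/
theorem exists_critical_point_of_parametrization {X : Type*} [NormedAddCommGroup X]
    [NormedSpace ℝ X] [TopologicalSpace.SeparableSpace X] {ι : X →ₗ[ℝ] (ℝ → Euc N)}
    (hιc : ∀ v, Continuous (ι v)) (hι0 : ∀ v, ∫ t in Icc a b, ι v t = 0)
    (hιn : ∀ v t, ‖ι v t‖ ≤ ‖v‖) (hιi : ∀ v, (∀ t ∈ Icc a b, ι v t = 0) → v = 0)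
    (hιs : ∀ h : ℝ → Euc N, Continuous h → ∫ t in Icc a b, h t = 0 →
      ∃ v, ∀ t ∈ Icc a b, ι v t = h t)
    (hL : IsConvexLagrangian G β L Lx Lv) (hG : IsGFunction G)
    (hΔ : Delta2 G) (hab : a < b) (hβ : IntegrableOn β (Icc a b)) (hf : IntegrableOn f (Icc a b))
    {κ μ c r c₀ : ℝ} (hκ : 0 < κ) (hμ : 0 ≤ μ) (hc₀ : 0 < c₀)
    (hAR : ∀ v : ℝ → Euc N, Continuous v → ∫ t in Icc a b, v t = 0 →
      κ * ∫ t in Icc a b, G (v t) ≤ action L f a b v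
        - μ * firstVariation Lx Lv f a b (prim a v) v (prim a v) v + c)
    (hbar : ∀ v : ℝ → Euc N, Continuous v → ∫ t in Icc a b, v t = 0 →
      ∫ t in Icc a b, G (r⁻¹ • v t) = 1 → c₀ ≤ action L f a b v)
    (h0 : action L f a b (0 : ℝ → Euc N) ≤ 0) {e : ℝ → Euc N} (hec : Continuous e)
    (he0 : ∫ t in Icc a b, e t = 0) (he : action L f a b e ≤ 0)
    (he1 : 1 ≤ ∫ t in Icc a b, G (r⁻¹ • e t)) :
    ∃ u : ℝ → Euc N, Continuous u ∧ AbsolutelyContinuousOnInterval u a b ∧ u a = 0 ∧ u b = 0 ∧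
      IntegrableOn (fun t => G (deriv u t)) (Icc a b) ∧
      (∀ h : ℝ → Euc N, Continuous h → ∫ t in Icc a b, h t = 0 →
        firstVariation Lx Lv f a b u (deriv u) (prim a h) h = 0) ∧
      c₀ ≤ (∫ t in Icc a b, L t (u t) (deriv u t)) + ∫ t in Icc a b, inner ℝ (f t) (u t) := by
  -- the level of the segment
  obtain ⟨c₁, hc₁⟩ : ∃ c₁, ∀ s ∈ Icc (0 : ℝ) 1, action L f a b (s • e) ≤ c₁ := by
    obtain ⟨B, hB⟩ := isCompact_Icc.exists_bound_of_continuousOn (s := Icc a b) hec.continuousOn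
    have hcont := hL.continuous_action (f := f) (K := B) hab.le
      (ι := LinearMap.toSpanSingleton ℝ (ℝ → Euc N) e)
      (fun s => by
        rw [LinearMap.toSpanSingleton_apply]
        exact hec.const_smul s) (fun s t ht => by
        rw [LinearMap.toSpanSingleton_apply, Pi.smul_apply, norm_smul, mul_comm]
        exact mul_le_mul_of_nonneg_right (hB t ht) (norm_nonneg _)) hf
    simp only [LinearMap.toSpanSingleton_apply] at hcont
    obtain ⟨c₁, hc₁⟩ := (isCompact_Icc (a := (0 : ℝ)) (b := 1)).bddAbove_image hcont.continuousOn
    exact ⟨c₁, fun s hs => hc₁ (mem_image_of_mem _ hs)⟩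
  obtain ⟨e', he'⟩ := hιs e hec he0
  have hen : action L f a b (ι e') ≤ 0 := by rwa [action_congr he']
  have hen1 : 1 ≤ ∫ t in Icc a b, G (r⁻¹ • ι e' t) := by
    rwa [setIntegral_congr_fun (g := fun t => G (r⁻¹ • e t)) measurableSet_Icc
      fun t ht => by simp only [he' t ht]]
  have hen2 : ∀ s ∈ Icc (0 : ℝ) 1, action L f a b (s • ι e') ≤ c₁ := fun s hs => by
    rw [action_congr (w := s • e) fun t ht => by simp only [Pi.smul_apply, he' t ht]]
    exact hc₁ s hs
  obtain ⟨E, v, hEmono, hEdense, hv⟩ := exists_galerkin_sequence hL hG hΔ hab hβ hf hιc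
    hιn hιi hκ hμ hc₀
    (fun v => hAR _ (hιc v) (hι0 v)) (fun v => hbar _ (hιc v) (hι0 v)) h0 hen hen1 hen2
  have hvE := fun n => (hv n).1
  have hv0 := fun n => (hv n).2.1
  have hv1 := fun n => (hv n).2.2.1
  have hvc := fun n => (hv n).2.2.2
  -- Each critical velocity lies in its own Galerkin space, so it may be tested against itself. The
  -- first variation then drops out of the Ambrosetti-Rabinowitz estimate, and a modular bound
  -- independent of `n` remains.
  set M := (c₁ + c) / κ
  have hM : ∀ n, ∫ t in Icc a b, G (ι (v n) t) ≤ M := by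
    intro n
    have h1 := hAR _ (hιc (v n)) (hι0 (v n))
    rw [hvc n _ (hvE n), mul_zero, sub_zero] at h1
    rw [le_div_iff₀ hκ, mul_comm]
    linarith [hv1 n]
  obtain ⟨u, huc, σ, hσ, hlim⟩ := hG.exists_subseq_tendstoUniformlyOn hab.le
    (fun n => hιc (v n)) hM
  have hlim' : ∀ t ∈ Icc a b, Tendsto (fun n => prim a (ι (v (σ n))) t) atTop (𝓝 (u t)) :=
    fun t ht => hlim.tendsto_at ht
  have hac := hG.absolutelyContinuous_of_tendsto hab.le (fun n => hιc (v (σ n)))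
    (fun n => hM (σ n)) hlim'
  have hlint := hG.lintegral_deriv_le_of_tendsto hab (fun n => hιc (v (σ n)))
    (fun n => hM (σ n)) huc hlim'
  have hdm : AEStronglyMeasurable (deriv u) (volume.restrict (Icc a b)) :=
    (stronglyMeasurable_deriv u).aestronglyMeasurable
  have hmod : IntegrableOn (fun t => G (deriv u t)) (Icc a b) := by
    refine (lintegral_ofReal_ne_top_iff_integrable
      (hG.continuous.comp_aestronglyMeasurable hdm)
      (Eventually.of_forall fun t => hG.nonneg _)).1 ?_
    exact (hlint.trans_lt ENNReal.ofReal_lt_top).ne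
  have hdi := hG.integrableOn_of_modular hdm hmod
  have hua : u a = 0 := by
    refine tendsto_nhds_unique (hlim' a (left_mem_Icc.2 hab.le)) ?_
    simp [prim]
  have hub : u b = 0 := by
    refine tendsto_nhds_unique (hlim' b (right_mem_Icc.2 hab.le)) ?_
    refine tendsto_const_nhds.congr fun n => ?_
    rw [prim, ← setIntegral_Icc_eq hab.le, hι0]
  have hS : IsGalerkinSequence G Lx Lv f a b M {z | ∃ n, ∃ h ∈ E n, ι h = z}
      (fun n => ι (v (σ n))) u (deriv u) :=
    { cont := fun n => hιc _
      modular_le := fun n => hM _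
      critical := by
        rintro _ ⟨m, h, hh, rfl⟩
        filter_upwards [eventually_ge_atTop m] with n hn
        exact hvc _ h (hEmono (hn.trans (hσ.id_le n)) hh)
      critical_self := fun n => hvc _ _ (hvE _)
      test_cont := by
        rintro _ ⟨m, h, hh, rfl⟩
        exact hιc h
      test_mean := by
        rintro _ ⟨m, h, hh, rfl⟩
        exact hι0 h
      test_neg := by
        rintro _ ⟨m, h, hh, rfl⟩
        exact ⟨m, -h, (E m).neg_mem hh, map_neg ι h⟩
      test_dense := by
        intro z hz hz0 ε hε
        obtain ⟨z', hz'⟩ := hιs z hz hz0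
        obtain ⟨k, h, hh, hk⟩ := hEdense z' ε hε
        refine ⟨ι h, ⟨k, h, hh, rfl⟩, fun t ht => ?_⟩
        rw [← hz' t ht, ← Pi.sub_apply, ← map_sub]
        exact (hιn _ t).trans hk.le
      cont_limit := huc
      tendsto := hlim
      aesm := hdm
      modular_limit := hmod
      mean_limit := by
        have := eq_add_prim_deriv hab.le hac hdi (right_mem_Icc.2 hab.le)
        rw [hua, hub, zero_add, prim, ← setIntegral_Icc_eq hab.le] at this
        exact this.symm
      eq_prim := fun t ht => by rw [eq_add_prim_deriv hab.le hac hdi ht, hua, zero_add] }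
  refine ⟨u, huc, hac, hua, hub, hmod, fun h hh hh0 =>
    hS.firstVariation_eq_zero_of_continuous hL hG hΔ hab hβ hf hh hh0, ?_⟩
  exact ge_of_tendsto' (hS.tendsto_action hL hG hΔ hab hβ hf) fun n => hv0 (σ n)

/-- Existence of a mountain pass critical point of the action. -/
theorem exists_critical_point (hL : IsConvexLagrangian G β L Lx Lv) (hG : IsGFunction G)
    (hΔ : Delta2 G) (hab : a < b) (hβ : IntegrableOn β (Icc a b)) (hf : IntegrableOn f (Icc a b))
    {κ μ c r c₀ : ℝ} (hκ : 0 < κ) (hμ : 0 ≤ μ) (hc₀ : 0 < c₀)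
    (hAR : ∀ v : ℝ → Euc N, Continuous v → ∫ t in Icc a b, v t = 0 →
      κ * ∫ t in Icc a b, G (v t) ≤ action L f a b v
        - μ * firstVariation Lx Lv f a b (prim a v) v (prim a v) v + c)
    (hbar : ∀ v : ℝ → Euc N, Continuous v → ∫ t in Icc a b, v t = 0 →
      ∫ t in Icc a b, G (r⁻¹ • v t) = 1 → c₀ ≤ action L f a b v)
    (h0 : action L f a b (0 : ℝ → Euc N) ≤ 0) {e : ℝ → Euc N} (hec : Continuous e)
    (he0 : ∫ t in Icc a b, e t = 0) (he : action L f a b e ≤ 0)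
    (he1 : 1 ≤ ∫ t in Icc a b, G (r⁻¹ • e t)) :
    ∃ u : ℝ → Euc N, Continuous u ∧ AbsolutelyContinuousOnInterval u a b ∧ u a = 0 ∧ u b = 0 ∧
      IntegrableOn (fun t => G (deriv u t)) (Icc a b) ∧
      (∀ h : ℝ → Euc N, Continuous h → ∫ t in Icc a b, h t = 0 →
        firstVariation Lx Lv f a b u (deriv u) (prim a h) h = 0) ∧
      c₀ ≤ (∫ t in Icc a b, L t (u t) (deriv u t)) + ∫ t in Icc a b, inner ℝ (f t) (u t) := by
  refine exists_critical_point_of_parametrization (X := zeroMean N hab.le)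
    (ι := zeroMeanExtend (N := N) hab.le) ?_ ?_ ?_ ?_ ?_ hL hG hΔ hab hβ hf hκ hμ hc₀ hAR hbar h0
    hec he0 he he1
  · exact continuous_zeroMeanExtend hab.le
  · exact fun v => v.2
  · exact fun v t => norm_zeroMeanExtend_le hab.le v t
  · exact fun _ => zeroMeanExtend_eq_zero hab.le
  · exact fun _ => exists_zeroMeanExtend_eq hab.le

/-! ### The Ambrosetti-Rabinowitz estimate and the mountain pass geometry -/

/-- The structural hypotheses on the kinetic part `F` and the potential `V` of a Lagrangian, with
partial gradients `Fx`, `Fv`, `Vx`. -/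
structure IsAdmissible (G : Euc N → ℝ) (β : ℝ → ℝ) (F : ℝ → Euc N → Euc N → ℝ)
    (V : ℝ → Euc N → ℝ) (Fx Fv : ℝ → Euc N → Euc N → Euc N) (Vx : ℝ → Euc N → Euc N)
    (θF θV Λ r₀ : ℝ) : Prop where
  contF : Continuous fun z : ℝ × Euc N × Euc N => F z.1 z.2.1 z.2.2
  contFx : Continuous fun z : ℝ × Euc N × Euc N => Fx z.1 z.2.1 z.2.2
  contFv : Continuous fun z : ℝ × Euc N × Euc N => Fv z.1 z.2.1 z.2.2
  contV : Continuous fun z : ℝ × Euc N => V z.1 z.2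
  contVx : Continuous fun z : ℝ × Euc N => Vx z.1 z.2
  hasDerivAtF : ∀ t x v φ h, HasDerivAt (fun s : ℝ => F t (x + s • φ) (v + s • h))
    (inner ℝ (Fx t x v) φ + inner ℝ (Fv t x v) h) 0
  hasDerivAtV : ∀ t x φ, HasDerivAt (fun s : ℝ => V t (x + s • φ)) (inner ℝ (Vx t x) φ) 0
  tangent : ∀ t x v w, F t x w + inner ℝ (Fv t x w) (v - w) ≤ F t x v
  nonneg : ∀ t, 0 ≤ β t
  growth : ∀ R, ∃ A, 0 ≤ A ∧ ∀ t x v, ‖x‖ ≤ R → |F t x v| ≤ A * (β t + G v) ∧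
    ‖Fx t x v‖ ≤ A * (β t + G v) ∧ conj G (Fv t x v) ≤ A * (β t + G v)
  bound : ∀ R, ∃ A, 0 ≤ A ∧ ∀ t x, ‖x‖ ≤ R → |V t x| ≤ A ∧ ‖Vx t x‖ ≤ A
  homF : ∀ t x v, inner ℝ (Fx t x v) x + inner ℝ (Fv t x v) v ≤ θF * F t x v
  lower : ∀ t x v, Λ * G v ≤ F t x v
  zero : ∀ t x, F t x 0 = 0
  homV : ∀ t x, r₀ ≤ ‖x‖ → inner ℝ (Vx t x) x ≤ θV * V t x
  neg : ∀ t x, r₀ ≤ ‖x‖ → V t x < 0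
  one_lt : 1 < θV
  lt : θF < θV
  pos_Λ : 0 < Λ
  pos_r₀ : 0 < r₀

namespace IsAdmissible

variable {G : Euc N → ℝ} {β : ℝ → ℝ} {F : ℝ → Euc N → Euc N → ℝ}
    {V : ℝ → Euc N → ℝ} {Fx Fv : ℝ → Euc N → Euc N → Euc N} {Vx : ℝ → Euc N → Euc N}
    {θF θV Λ r₀ a b : ℝ} {f : ℝ → Euc N}

theorem contV_comp (hA : IsAdmissible G β F V Fx Fv Vx θF θV Λ r₀) {x : ℝ → Euc N}
    (hx : Continuous x) : Continuous fun t => V t (x t) :=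
  hA.contV.comp (f := fun t => (t, x t)) (by fun_prop)

theorem contVx_comp (hA : IsAdmissible G β F V Fx Fv Vx θF θV Λ r₀) {x : ℝ → Euc N}
    (hx : Continuous x) : Continuous fun t => Vx t (x t) :=
  hA.contVx.comp (f := fun t => (t, x t)) (by fun_prop)

theorem contF_comp (hA : IsAdmissible G β F V Fx Fv Vx θF θV Λ r₀) {x v : ℝ → Euc N}
    (hx : Continuous x) (hv : Continuous v) : Continuous fun t => F t (x t) (v t) :=
  hA.contF.comp (f := fun t => (t, x t, v t)) (by fun_prop)

theorem contFx_comp (hA : IsAdmissible G β F V Fx Fv Vx θF θV Λ r₀) {x v : ℝ → Euc N}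
    (hx : Continuous x) (hv : Continuous v) : Continuous fun t => Fx t (x t) (v t) :=
  hA.contFx.comp (f := fun t => (t, x t, v t)) (by fun_prop)

theorem contFv_comp (hA : IsAdmissible G β F V Fx Fv Vx θF θV Λ r₀) {x v : ℝ → Euc N}
    (hx : Continuous x) (hv : Continuous v) : Continuous fun t => Fv t (x t) (v t) :=
  hA.contFv.comp (f := fun t => (t, x t, v t)) (by fun_prop)

/-- On bounded positions `V` and its gradient are bounded and only change constants. Young's
inequality at `y` and `-y`, with evenness of `G`, turns the bound on the conjugate of `Fv` into the
two-sided bound on its pairings. -/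
theorem isConvexLagrangian (hA : IsAdmissible G β F V Fx Fv Vx θF θV Λ r₀)
    (hG : IsGFunction G) :
    IsConvexLagrangian G β (fun t x v => F t x v + V t x) (fun t x v => Fx t x v + Vx t x) Fv := by
  have hproj : Continuous fun z : ℝ × Euc N × Euc N => (z.1, z.2.1) := by fun_prop
  refine ⟨hA.contF.add (hA.contV.comp hproj), hA.contFx.add (hA.contVx.comp hproj), hA.contFv,
    fun t x v φ h => ?_, fun t x v w => ?_, hA.nonneg, fun R => ?_, fun R => ?_⟩
  · refine ((hA.hasDerivAtF t x v φ h).add (hA.hasDerivAtV t x φ)).congr_deriv ?_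
    simp only [dirDeriv, inner_add_left]
    ring
  · linarith [hA.tangent t x v w]
  · obtain ⟨A, hA0, hgr⟩ := hA.growth R
    obtain ⟨B, hB0, hbd⟩ := hA.bound R
    obtain ⟨c, hc0, hc⟩ := hG.norm_le_conj
    refine ⟨A + B + c, by positivity, fun t x v hx => ?_⟩
    obtain ⟨h1, h2, h3⟩ := hgr t x v hx
    obtain ⟨h4, h5⟩ := hbd t x hx
    have hβ := hA.nonneg t
    have hGv := hG.nonneg v
    have key : ∀ y z : ℝ, y ≤ A * (β t + G v) → z ≤ B + c →
        y + z ≤ (A + B + c) * (1 + β t + G v) := by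
      intro y z hy hz
      have : 0 ≤ (B + c) * (β t + G v) := by positivity
      nlinarith
    have hconj : conj G (Fv t x v) ≤ (A + B + c) * (1 + β t + G v) := by
      have := key _ 0 h3 (by positivity)
      linarith
    refine ⟨(abs_add_le _ _).trans (key _ _ h1 (by linarith)),
      (norm_add_le _ _).trans (key _ _ h2 (by linarith)),
      (hc _).trans (key _ _ h3 (by linarith)), fun y => ?_⟩
    have h6 := hG.young y (Fv t x v)
    have h7 := hG.young (-y) (Fv t x v)
    rw [hG.even, inner_neg_left] at h7
    rw [real_inner_comm, abs_le]
    constructor <;> linarith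
  · obtain ⟨B, hB0, hbd⟩ := hA.bound R
    have hΛ := hA.pos_Λ
    refine ⟨Λ⁻¹ + B, by positivity, fun t x v hx => ?_⟩
    have h1 := hA.lower t x v
    have h2 := (abs_le.1 (hbd t x hx).1).1
    have h3 : G v ≤ Λ⁻¹ * F t x v := by
      rw [← div_eq_inv_mul, le_div_iff₀ hΛ, mul_comm]
      exact h1
    have h4 : 0 ≤ F t x v := (mul_nonneg hΛ.le (hG.nonneg v)).trans h1
    have h5 : 0 < Λ⁻¹ := inv_pos.2 hΛ
    calc G v ≤ Λ⁻¹ * F t x v := h3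
      _ ≤ (Λ⁻¹ + B) * F t x v := mul_le_mul_of_nonneg_right (by linarith) h4
      _ ≤ _ := mul_le_mul_of_nonneg_left (by linarith) (by positivity)

/-- The Ambrosetti-Rabinowitz estimate: energy and self-variation control the modular. -/
theorem exists_modular_le (hA : IsAdmissible G β F V Fx Fv Vx θF θV Λ r₀) (hG : IsGFunction G)
    (hab : a < b) (hf : IntegrableOn f (Icc a b)) :
    ∃ κ > 0, ∃ c, ∀ v : ℝ → Euc N, Continuous v →
      κ * ∫ t in Icc a b, G (v t) ≤ action (fun t x v => F t x v + V t x) f a b v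
        - θV⁻¹ * firstVariation (fun t x v => Fx t x v + Vx t x) Fv f a b (prim a v) v
          (prim a v) v + c := by
  have hθ : 0 < θV := one_pos.trans hA.one_lt
  have hθ1 : θV⁻¹ ≤ 1 := inv_le_one_of_one_le₀ hA.one_lt.le
  have hθ0 : 0 < θV⁻¹ := inv_pos.2 hθ
  have hθF : θV⁻¹ * θF < 1 := by
    rw [← div_eq_inv_mul, div_lt_one hθ]
    exact hA.lt
  -- The part of the kinetic term left after subtracting `θV⁻¹` times its radial derivative; it is
  -- positive because `θF < θV`.
  set κ₀ := Λ * (1 - θV⁻¹ * θF) with hκ₀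
  have hκ₀pos : 0 < κ₀ := mul_pos hA.pos_Λ (by linarith)
  set D := ∫ t in Icc a b, ‖f t‖ with hD
  have hD0 : 0 ≤ D := integral_nonneg fun _ => norm_nonneg _
  obtain ⟨B, hB0, hB⟩ := hA.bound r₀
  -- The parameter is chosen so that the force, at most `D` times the `L¹` norm of the velocity,
  -- consumes no more than half of `κ₀` times the modular.
  obtain ⟨c, hc0, hc⟩ := hG.exists_norm_le (η := κ₀ / (2 * (D + 1))) (by positivity)
  set CV := B + B * r₀ with hCV
  have hCV0 : 0 ≤ CV := by have := hA.pos_r₀; positivity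
  -- Outside the ball of radius `r₀` the Ambrosetti-Rabinowitz condition makes this combination
  -- nonnegative; inside it, boundedness of `V` and its gradient suffices.
  have hpt : ∀ t x, -CV ≤ V t x - θV⁻¹ * inner ℝ (Vx t x) x := by
    intro t x
    rcases le_or_gt r₀ ‖x‖ with hx | hx
    · have h1 := mul_le_mul_of_nonneg_left (hA.homV t x hx) hθ0.le
      rw [← mul_assoc, inv_mul_cancel₀ hθ.ne', one_mul] at h1
      linarith
    · obtain ⟨h1, h2⟩ := hB t x hx.le
      have h3 : inner ℝ (Vx t x) x ≤ B * r₀ := (real_inner_le_norm _ _).trans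
        (mul_le_mul h2 hx.le (norm_nonneg _) hB0)
      have h4 : θV⁻¹ * inner ℝ (Vx t x) x ≤ B * r₀ := by
        have h5 : 0 ≤ B * r₀ := mul_nonneg hB0 hA.pos_r₀.le
        calc _ ≤ θV⁻¹ * (B * r₀) := mul_le_mul_of_nonneg_left h3 hθ0.le
          _ ≤ 1 * (B * r₀) := mul_le_mul_of_nonneg_right hθ1 h5
          _ = _ := one_mul _
      linarith [(abs_le.1 h1).1]
  refine ⟨κ₀ / 2, by positivity, (b - a) * CV + D * (c * (b - a)), fun v hv => ?_⟩
  have hu := continuous_prim (a := a) hv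
  have hvi : IntegrableOn v (Icc a b) := hv.continuousOn.integrableOn_Icc
  have hGi : IntegrableOn (fun t => G (v t)) (Icc a b) :=
    (hG.continuous.comp hv).continuousOn.integrableOn_Icc
  have hnv : ∫ t in Icc a b, ‖v t‖ ≤ κ₀ / (2 * (D + 1)) * (∫ t in Icc a b, G (v t))
      + c * (b - a) := by
    have i1 : IntegrableOn (fun t => κ₀ / (2 * (D + 1)) * G (v t)) (Icc a b) := hGi.const_mul _
    have i2 : IntegrableOn (fun _ : ℝ => c) (Icc a b) := integrable_const _
    calc ∫ t in Icc a b, ‖v t‖ ≤ ∫ t in Icc a b, (κ₀ / (2 * (D + 1)) * G (v t) + c) :=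
          integral_mono hvi.norm (i1.add i2) fun t => hc (v t)
      _ = _ := by
          rw [integral_add i1 i2, integral_const_mul]
          simp [hab.le, mul_comm]
  have hfu : |∫ t in Icc a b, inner ℝ (f t) (prim a v t)| ≤ D * ∫ t in Icc a b, ‖v t‖ := by
    rw [← Real.norm_eq_abs, hD, ← integral_mul_const]
    refine norm_integral_le_of_norm_le (hf.norm.mul_const _) ?_
    filter_upwards [ae_restrict_mem measurableSet_Icc] with t ht
    exact (norm_inner_le_norm _ _).trans
      (mul_le_mul_of_nonneg_left (norm_prim_le hvi ht) (norm_nonneg _))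
  have hmain : κ₀ * (∫ t in Icc a b, G (v t)) - (b - a) * CV
      ≤ (∫ t in Icc a b, (F t (prim a v t) (v t) + V t (prim a v t)))
        - θV⁻¹ * ∫ t in Icc a b, dirDeriv (fun t x v => Fx t x v + Vx t x) Fv t (prim a v t) (v t)
          (prim a v t) (v t) := by
    have i1 : IntegrableOn (fun t => F t (prim a v t) (v t) + V t (prim a v t)) (Icc a b) :=
      ((hA.contF_comp hu hv).add (hA.contV_comp hu)).continuousOn.integrableOn_Icc
    have i2 : IntegrableOn (fun t => θV⁻¹ * dirDeriv (fun t x v => Fx t x v + Vx t x) Fv t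
        (prim a v t) (v t) (prim a v t) (v t)) (Icc a b) :=
      ((((hA.contFx_comp hu hv).add (hA.contVx_comp hu)).inner hu).add
        ((hA.contFv_comp hu hv).inner hv)).const_mul θV⁻¹ |>.continuousOn.integrableOn_Icc
    have i3 : IntegrableOn (fun t => κ₀ * G (v t)) (Icc a b) := hGi.const_mul _
    have i4 : IntegrableOn (fun _ : ℝ => CV) (Icc a b) := integrable_const _
    have e1 : κ₀ * (∫ t in Icc a b, G (v t)) - (b - a) * CV
        = ∫ t in Icc a b, (κ₀ * G (v t) - CV) := by
      rw [integral_sub i3 i4, integral_const_mul]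
      simp [hab.le]
    rw [e1, ← integral_const_mul, ← integral_sub i1 i2]
    refine integral_mono (i3.sub i4) (i1.sub i2) fun t => ?_
    have h1 := hpt t (prim a v t)
    have h2 := mul_le_mul_of_nonneg_left (hA.homF t (prim a v t) (v t)) hθ0.le
    have h3 := mul_le_mul_of_nonneg_right (hA.lower t (prim a v t) (v t))
      (by linarith : 0 ≤ 1 - θV⁻¹ * θF)
    simp only [dirDeriv, inner_add_left, hκ₀]
    nlinarith
  have hfin : κ₀ / (2 * (D + 1)) * D ≤ κ₀ / 2 := by
    rw [div_mul_eq_mul_div, div_le_div_iff₀ (by positivity) (by positivity)]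
    nlinarith
  have hGnn : 0 ≤ ∫ t in Icc a b, G (v t) := integral_nonneg fun t => hG.nonneg _
  have h5 : D * (∫ t in Icc a b, ‖v t‖) ≤ κ₀ / 2 * (∫ t in Icc a b, G (v t))
      + D * (c * (b - a)) := by
    have h6 := mul_le_mul_of_nonneg_left hnv hD0
    have h7 := mul_le_mul_of_nonneg_right hfin hGnn
    nlinarith
  -- The force is linear in the curve, so it enters the combination with the coefficient `1 - θV⁻¹`,
  -- which lies between `0` and `1`.
  have h8 : -(D * ∫ t in Icc a b, ‖v t‖) ≤ (1 - θV⁻¹) *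
      ∫ t in Icc a b, inner ℝ (f t) (prim a v t) := by
    have h9 : 0 ≤ D * ∫ t in Icc a b, ‖v t‖ :=
      mul_nonneg hD0 (integral_nonneg fun _ => norm_nonneg _)
    have h10 := neg_le_of_abs_le hfu
    nlinarith
  unfold action firstVariation
  linarith

theorem action_zero (hA : IsAdmissible G β F V Fx Fv Vx θF θV Λ r₀)
    (hV0 : ∫ t in Icc a b, V t 0 = 0) :
    action (fun t x v => F t x v + V t x) f a b (0 : ℝ → Euc N) = 0 := by
  have h : ∀ t, prim a (0 : ℝ → Euc N) t = 0 := fun t => by simp [prim]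
  simp [action, h, hA.zero, hV0]

end IsAdmissible

theorem IsGFunction.integrableOn_smul {G : Euc N → ℝ} (hG : IsGFunction G) {a b : ℝ}
    {v : ℝ → Euc N} (hv : Continuous v) (r : ℝ) :
    IntegrableOn (fun t => G (r • v t)) (Icc a b) :=
  (hG.continuous.comp (g := G) (f := fun t => r • v t)
    (by fun_prop)).continuousOn.integrableOn_Icc

/-- A Poincaré type inequality: the modular of a rescaled primitive is at most the modular. -/
theorem IsGFunction.integral_prim_le {G : Euc N → ℝ} (hG : IsGFunction G) {a b : ℝ} (hab : a < b)
    {v : ℝ → Euc N} (hv : Continuous v) :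
    ∫ t in Icc a b, G ((b - a)⁻¹ • prim a v t) ≤ ∫ t in Icc a b, G (v t) := by
  have hba : 0 < b - a := sub_pos.2 hab
  have hGc : Continuous fun t => G (v t) := hG.continuous.comp hv
  have hpt : ∀ t ∈ Icc a b, G ((b - a)⁻¹ • prim a v t) ≤ (b - a)⁻¹ * ∫ s in Icc a b, G (v s) := by
    intro t ht
    have hnn : 0 ≤ ∫ s in Icc a b, G (v s) := integral_nonneg fun t => hG.nonneg _
    rcases eq_or_lt_of_le ht.1 with rfl | hat
    · simp only [prim, intervalIntegral.integral_same, smul_zero, hG.zero]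
      positivity
    have hta : 0 < t - a := sub_pos.2 hat
    have h1 := hG.map_average_le hat (hv.continuousOn.integrableOn_Icc)
      (hGc.continuousOn.integrableOn_Icc)
    -- The scaled primitive is the average of `v` over `[a, t]` contracted by `(t - a) / (b - a) ≤
    -- 1`. Jensen's inequality applies to the average, and convexity with `G 0 = 0` to the
    -- contraction.
    have h2 : (b - a)⁻¹ • prim a v t = ((t - a) / (b - a)) • ((t - a)⁻¹ • ∫ r in a..t, v r) := by
      rw [smul_smul, prim]
      congr 1
      field_simp
    rw [h2]
    have h3 : ∫ r in a..t, G (v r) ≤ ∫ s in Icc a b, G (v s) := by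
      rw [← setIntegral_Icc_eq hat.le]
      exact setIntegral_mono_set hGc.continuousOn.integrableOn_Icc
        (Eventually.of_forall fun t => hG.nonneg _) (Icc_subset_Icc_right ht.2).eventuallyLE
    calc _ ≤ (t - a) / (b - a) * G ((t - a)⁻¹ • ∫ r in a..t, v r) :=
          hG.smul_le (by positivity) ((div_le_one hba).2 (by linarith [ht.2])) _
      _ ≤ (t - a) / (b - a) * ((t - a)⁻¹ * ∫ r in a..t, G (v r)) :=
          mul_le_mul_of_nonneg_left h1 (by positivity)
      _ = (b - a)⁻¹ * ∫ r in a..t, G (v r) := by field_simp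
      _ ≤ _ := mul_le_mul_of_nonneg_left h3 (by positivity)
  have hu := continuous_prim (a := a) hv
  have i1 : IntegrableOn (fun t => G ((b - a)⁻¹ • prim a v t)) (Icc a b) :=
    hG.integrableOn_smul hu _
  calc _ ≤ ∫ _ in Icc a b, (b - a)⁻¹ * ∫ s in Icc a b, G (v s) :=
        setIntegral_mono_on i1 (integrable_const _) measurableSet_Icc hpt
    _ = _ := by
        simp [hab.le]
        field_simp

theorem IsGFunction.memOrlicz_of_continuous {G : Euc N → ℝ} (hG : IsGFunction G) {a b : ℝ}
    {v : ℝ → Euc N} (hv : Continuous v) : MemOrlicz G a b v := by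
  refine ⟨hv.aestronglyMeasurable, ?_⟩
  have hi : IntegrableOn (fun t => G (v t)) (Icc a b) :=
    (hG.continuous.comp hv).continuousOn.integrableOn_Icc
  exact lt_top_iff_ne_top.2 ((lintegral_ofReal_ne_top_iff_integrable hi.aestronglyMeasurable
    (Eventually.of_forall fun t => hG.nonneg _)).2 hi)

/-- Velocities of unit modular at scale `r` have primitives bounded by `C * r`. -/
theorem norm_prim_le_of_modular_eq_one {G : Euc N → ℝ} (hG : IsGFunction G) {a b C r : ℝ}
    (hab : a < b) (hC : IsEmbeddingConstant G a b C) (hr : 0 < r) {v : ℝ → Euc N}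
    (hv : Continuous v) (hv0 : ∫ t in Icc a b, v t = 0)
    (hv1 : ∫ t in Icc a b, G (r⁻¹ • v t) = 1) {t : ℝ} (ht : t ∈ Icc a b) :
    ‖prim a v t‖ ≤ C * r := by
  have hd : deriv (prim a v) = v := funext fun t => (hasDerivAt_prim hv t).deriv
  have hW : MemW0 G a b (prim a v) := by
    refine ⟨⟨prim_absolutelyContinuous hab.le hv.continuousOn.integrableOn_Icc,
      hG.memOrlicz_of_continuous (continuous_prim hv), ?_⟩, ?_, ?_⟩
    · rw [hd]
      exact hG.memOrlicz_of_continuous hv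
    · simp [prim]
    · rw [prim, ← setIntegral_Icc_eq hab.le, hv0]
  refine (hC.2 _ hW t ht).trans (mul_le_mul_of_nonneg_left ?_ hC.1.le)
  rw [hd]
  refine csInf_le ⟨0, fun s hs => hs.1.le⟩ ⟨hr, ?_⟩
  have hi : IntegrableOn (fun t => G (r⁻¹ • v t)) (Icc a b) :=
    hG.integrableOn_smul hv _
  unfold modular
  rw [← ofReal_integral_eq_lintegral_ofReal hi (Eventually.of_forall fun t => hG.nonneg _), hv1,
    ENNReal.ofReal_one]

/-- The conjugate is a finite convex function on a finite-dimensional space, hence continuous; this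
gives measurability of the dual modular integrand. -/
theorem IsGFunction.continuous_conj {G : Euc N → ℝ} (hG : IsGFunction G) :
    Continuous (conj G) := by
  have hc : ConvexOn ℝ univ (conj G) := by
    refine ⟨convex_univ, fun x _ y _ s t hs ht hst => ?_⟩
    refine ciSup_le fun z => ?_
    have h1 := mul_le_mul_of_nonneg_left (hG.young z x) hs
    have h2 := mul_le_mul_of_nonneg_left (hG.young z y) ht
    rw [inner_add_right, inner_smul_right, inner_smul_right, smul_eq_mul, smul_eq_mul]
    have h3 : G z = s * G z + t * G z := by rw [← add_mul, hst, one_mul]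
    rw [h3]
    linarith
  exact continuousOn_univ.1 (hc.continuousOn isOpen_univ)

/-- Hölder type inequality for the force term. -/
theorem IsGFunction.abs_integral_inner_le {G : Euc N → ℝ} (hG : IsGFunction G) {a b s r : ℝ}
    (hs : 0 < s) (hr : 0 < r) {f u : ℝ → Euc N} (hf : IntegrableOn f (Icc a b))
    (hfs : modular (conj G) a b (fun t => s⁻¹ • f t) ≤ 1)
    (hu : Continuous u) (hu1 : ∫ t in Icc a b, G (r⁻¹ • u t) ≤ 1) :
    |∫ t in Icc a b, inner ℝ (f t) (u t)| ≤ 2 * s * r := by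
  have hm : AEStronglyMeasurable (fun t => conj G (s⁻¹ • f t)) (volume.restrict (Icc a b)) :=
    hG.continuous_conj.comp_aestronglyMeasurable (hf.aestronglyMeasurable.const_smul s⁻¹)
  have i1 : IntegrableOn (fun t => conj G (s⁻¹ • f t)) (Icc a b) :=
    (lintegral_ofReal_ne_top_iff_integrable hm
      (Eventually.of_forall fun t => hG.conj_nonneg _)).1 (hfs.trans_lt ENNReal.one_lt_top).ne
  have i2 : IntegrableOn (fun t => G (r⁻¹ • u t)) (Icc a b) :=
    hG.integrableOn_smul hu _
  have h1 : ∫ t in Icc a b, conj G (s⁻¹ • f t) ≤ 1 := by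
    unfold modular at hfs
    rw [← ofReal_integral_eq_lintegral_ofReal i1
      (Eventually.of_forall fun t => hG.conj_nonneg _), ← ENNReal.ofReal_one] at hfs
    exact (ENNReal.ofReal_le_ofReal_iff zero_le_one).1 hfs
  have i3 : IntegrableOn (fun t => s * r * (G (r⁻¹ • u t) + conj G (s⁻¹ • f t))) (Icc a b) :=
    (i2.add i1).const_mul _
  rw [← Real.norm_eq_abs]
  calc _ ≤ ∫ t in Icc a b, s * r * (G (r⁻¹ • u t) + conj G (s⁻¹ • f t)) := by
        refine norm_integral_le_of_norm_le i3 (Eventually.of_forall fun t => ?_)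
        have h2 := hG.young (r⁻¹ • u t) (s⁻¹ • f t)
        have h3 := hG.young (-(r⁻¹ • u t)) (s⁻¹ • f t)
        rw [hG.even, inner_neg_left] at h3
        have h4 : (inner ℝ (f t) (u t) : ℝ) = s * r * inner ℝ (r⁻¹ • u t) (s⁻¹ • f t) := by
          rw [inner_smul_left, inner_smul_right, real_inner_comm]
          simp only [conj_trivial]
          field_simp
        rw [h4, Real.norm_eq_abs, abs_mul, abs_of_pos (mul_pos hs hr)]
        exact mul_le_mul_of_nonneg_left (abs_le.2 ⟨by linarith, h2⟩) (mul_pos hs hr).le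
    _ = s * r * ((∫ t in Icc a b, G (r⁻¹ • u t)) + ∫ t in Icc a b, conj G (s⁻¹ • f t)) := by
        rw [integral_const_mul, integral_add i2 i1]
    _ ≤ s * r * (1 + 1) := mul_le_mul_of_nonneg_left (add_le_add hu1 h1) (mul_pos hs hr).le
    _ = _ := by ring

/-- The mountain range: the action is bounded below by a positive constant on velocities of unit
modular at scale `r`. -/
theorem IsAdmissible.exists_barrier {G : Euc N → ℝ} {β : ℝ → ℝ} {F : ℝ → Euc N → Euc N → ℝ}
    {V : ℝ → Euc N → ℝ} {Fx Fv : ℝ → Euc N → Euc N → Euc N} {Vx : ℝ → Euc N → Euc N}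
    {θF θV Λ r₀ a b : ℝ} {f : ℝ → Euc N}
    (hA : IsAdmissible G β F V Fx Fv Vx θF θV Λ r₀) (hG : IsGFunction G) (hab : a < b)
    (hf : MemOrlicz (conj G) a b f) {C ρ₀ : ℝ} (hC : IsEmbeddingConstant G a b C) (hρ₀ : 0 < ρ₀)
    {g : ℝ → ℝ} (hg : IntegrableOn g (Icc a b))
    (hV : ∀ t ∈ Icc a b, ∀ x, ‖x‖ ≤ ρ₀ → -g t ≤ V t x) {m : ℝ}
    (hm : ∀ x, m * G x ≤ G ((ρ₀ / C) • x))
    (hlt : (∫ t in Icc a b, g t) + 2 * (b - a) * luxNorm (conj G) a b f * (ρ₀ / C) < Λ * m) :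
    ∃ c₀ > 0, ∀ v : ℝ → Euc N, Continuous v → ∫ t in Icc a b, v t = 0 →
      ∫ t in Icc a b, G ((ρ₀ / C)⁻¹ • v t) = 1 →
      c₀ ≤ action (fun t x v => F t x v + V t x) f a b v := by
  -- This scale is chosen so that the embedding bound `C * r` is `ρ₀`, the radius on which `V` is
  -- bounded below by `-g`.
  set r := ρ₀ / C with hr
  have hr0 : 0 < r := div_pos hρ₀ hC.1
  have hba : 0 < b - a := sub_pos.2 hab
  have hfi := hG.integrableOn_of_memOrlicz_conj hf
  -- The strict inequality leaves room to replace the Luxemburg norm by an admissible constant `s`,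
  -- for which the modular bound holds.
  obtain ⟨s, hs0, hs, hfs⟩ := hG.exists_luxNorm_conj_lt hf
    (c := (Λ * m - ∫ t in Icc a b, g t) / (2 * (b - a) * r)) (by
      rw [lt_div_iff₀ (by positivity)]
      linarith)
  rw [lt_div_iff₀ (by positivity)] at hs
  refine ⟨Λ * m - (∫ t in Icc a b, g t) - s * (2 * (b - a) * r), by linarith,
    fun v hv hv0 hv1 => ?_⟩
  have hu := continuous_prim (a := a) hv
  have hub : ∀ t ∈ Icc a b, ‖prim a v t‖ ≤ ρ₀ := fun t ht => by
    have := norm_prim_le_of_modular_eq_one hG hab hC hr0 hv hv0 hv1 ht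
    rwa [hr, mul_div_cancel₀ _ hC.1.ne'] at this
  have i1 : IntegrableOn (fun t => F t (prim a v t) (v t)) (Icc a b) :=
    (hA.contF_comp hu hv).continuousOn.integrableOn_Icc
  have i2 : IntegrableOn (fun t => V t (prim a v t)) (Icc a b) :=
    (hA.contV_comp hu).continuousOn.integrableOn_Icc
  have i3 : IntegrableOn (fun t => G (r⁻¹ • v t)) (Icc a b) :=
    hG.integrableOn_smul hv _
  have hF : Λ * m ≤ ∫ t in Icc a b, F t (prim a v t) (v t) := by
    calc Λ * m = ∫ t in Icc a b, Λ * m * G (r⁻¹ • v t) := by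
          rw [integral_const_mul, hv1, mul_one]
      _ ≤ _ := integral_mono (i3.const_mul _) i1 fun t => by
          have h1 := mul_le_mul_of_nonneg_left (hm (r⁻¹ • v t)) hA.pos_Λ.le
          rw [smul_smul, mul_inv_cancel₀ hr0.ne', one_smul, ← mul_assoc] at h1
          exact h1.trans (hA.lower t _ _)
  have hVi : -(∫ t in Icc a b, g t) ≤ ∫ t in Icc a b, V t (prim a v t) := by
    rw [← integral_neg]
    exact setIntegral_mono_on hg.neg i2 measurableSet_Icc fun t ht => hV t ht _ (hub t ht)
  -- The Poincaré inequality gives the position unit modular at scale `(b - a) * r`. Together with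
  -- the factor `2` of the Hölder inequality this produces the constant of the hypothesis.
  have hfu : |∫ t in Icc a b, inner ℝ (f t) (prim a v t)| ≤ 2 * s * ((b - a) * r) := by
    refine hG.abs_integral_inner_le hs0 (by positivity) hfi hfs hu ?_
    have h1 := hG.integral_prim_le hab (hv.const_smul r⁻¹)
    simp only [Pi.smul_apply, hv1] at h1
    refine le_trans (le_of_eq ?_) h1
    refine integral_congr_ae (Eventually.of_forall fun t => ?_)
    have h2 : prim a (r⁻¹ • v) t = r⁻¹ • prim a v t := congrFun (prim_smul a r⁻¹ v) t
    simp only [h2, smul_smul, mul_inv]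
  unfold action
  rw [integral_add i1 i2]
  linarith [(abs_le.1 hfu).1]

/-- A differential inequality along rays gives a power bound. -/
theorem le_rpow_mul_of_deriv_le {φ φ' : ℝ → ℝ} {θ : ℝ}
    (hφ : ∀ s, 1 ≤ s → HasDerivAt φ (φ' s) s) (hle : ∀ s, 1 ≤ s → s * φ' s ≤ θ * φ s) {s : ℝ}
    (hs : 1 ≤ s) : φ s ≤ s ^ θ * φ 1 := by
  have hd : ∀ r, 1 ≤ r → HasDerivAt (fun r => r ^ (-θ) * φ r)
      (-θ * r ^ (-θ - 1) * φ r + r ^ (-θ) * φ' r) r := fun r hr =>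
    (Real.hasDerivAt_rpow_const (Or.inl (by positivity))).mul (hφ r hr)
  have hanti : AntitoneOn (fun r => r ^ (-θ) * φ r) (Ici 1) := by
    refine antitoneOn_of_deriv_nonpos (convex_Ici 1)
      (fun r hr => (hd r hr).continuousAt.continuousWithinAt) (fun r hr => ?_) fun r hr => ?_
    · exact (hd r (interior_subset hr)).differentiableAt.differentiableWithinAt
    · have hr1 : (1 : ℝ) ≤ r := interior_subset hr
      have hr0 : 0 < r := by linarith
      rw [(hd r hr1).deriv]
      have h1 : r ^ (-θ) = r ^ (-θ - 1) * r := by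
        rw [Real.rpow_sub_one hr0.ne', div_mul_cancel₀ _ hr0.ne']
      rw [h1]
      have h2 : 0 < r ^ (-θ - 1) := Real.rpow_pos_of_pos hr0 _
      nlinarith [hle r hr1]
  have h := hanti (mem_Ici.2 le_rfl) (mem_Ici.2 hs) hs
  simp only [Real.one_rpow, one_mul] at h
  have hs0 : 0 < s := by linarith
  have h3 : 0 < s ^ θ := Real.rpow_pos_of_pos hs0 _
  calc φ s = s ^ θ * (s ^ (-θ) * φ s) := by
        rw [← mul_assoc, ← Real.rpow_add hs0, add_neg_cancel, Real.rpow_zero, one_mul]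
    _ ≤ _ := mul_le_mul_of_nonneg_left h h3.le

namespace IsAdmissible

variable {G : Euc N → ℝ} {β : ℝ → ℝ} {F : ℝ → Euc N → Euc N → ℝ}
    {V : ℝ → Euc N → ℝ} {Fx Fv : ℝ → Euc N → Euc N → Euc N} {Vx : ℝ → Euc N → Euc N}
    {θF θV Λ r₀ a b : ℝ}

/-- The Ambrosetti-Rabinowitz inequality for `F` is a differential inequality along the joint ray
through `(x, v)`. -/
theorem kinetic_smul_le (hA : IsAdmissible G β F V Fx Fv Vx θF θV Λ r₀) (t : ℝ) (x v : Euc N)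
    {s : ℝ} (hs : 1 ≤ s) : F t (s • x) (s • v) ≤ s ^ θF * F t x v := by
  have h := le_rpow_mul_of_deriv_le (φ := fun s => F t (s • x) (s • v)) (θ := θF)
    (φ' := fun s => inner ℝ (Fx t (s • x) (s • v)) x + inner ℝ (Fv t (s • x) (s • v)) v)
    (fun r _ => by
      have h1 := hA.hasDerivAtF t (r • x) (r • v) x v
      have h2 : HasDerivAt (fun s : ℝ => s - r) 1 r := (hasDerivAt_id r).sub_const r
      have h3 := HasDerivAt.comp (h₂ := fun s : ℝ => F t (r • x + s • x) (r • v + s • v)) r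
        (by simpa using h1) h2
      simp only [mul_one, Function.comp_def] at h3
      refine h3.congr_of_eventuallyEq (Eventually.of_forall fun s => ?_)
      simp only
      congr 1 <;> module)
    (fun r _ => by
      have := hA.homF t (r • x) (r • v)
      simp only [inner_smul_right] at this
      linarith) hs
  simpa using h

/-- For `s ≥ 1` the ray never re-enters the ball of radius `r₀`, so the differential inequality for
`V` holds along all of it. As `V t x` is negative there, `V` decreases at least like `-s ^ θV`. -/
theorem potential_smul_le (hA : IsAdmissible G β F V Fx Fv Vx θF θV Λ r₀) (t : ℝ) {x : Euc N}
    (hx : r₀ ≤ ‖x‖) {s : ℝ} (hs : 1 ≤ s) : V t (s • x) ≤ s ^ θV * V t x := by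
  have h := le_rpow_mul_of_deriv_le (φ := fun s => V t (s • x)) (θ := θV)
    (φ' := fun s => inner ℝ (Vx t (s • x)) x)
    (fun r _ => by
      have h1 := hA.hasDerivAtV t (r • x) x
      have h2 : HasDerivAt (fun s : ℝ => s - r) 1 r := (hasDerivAt_id r).sub_const r
      have h3 := HasDerivAt.comp (h₂ := fun s : ℝ => V t (r • x + s • x)) r
        (by simpa using h1) h2
      simp only [mul_one, Function.comp_def] at h3
      refine h3.congr_of_eventuallyEq (Eventually.of_forall fun s => ?_)
      simp only
      congr 1
      module)
    (fun r hr => by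
      have := hA.homV t (r • x) (by
        rw [norm_smul, Real.norm_of_nonneg (by linarith)]
        nlinarith [norm_nonneg x])
      simp only [inner_smul_right] at this
      linarith) hs
  simpa using h

/-- A continuous velocity with zero mean whose large multiples have negative action. -/
theorem exists_action_nonpos (hA : IsAdmissible G β F V Fx Fv Vx θF θV Λ r₀)
    (hG : IsGFunction G) (hΔ : Delta2 G) (hN : 1 ≤ N) (hab : a < b) (f : ℝ → Euc N)
    {r : ℝ} (hr : 0 < r) :
    ∃ e : ℝ → Euc N, Continuous e ∧ ∫ t in Icc a b, e t = 0 ∧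
      action (fun t x v => F t x v + V t x) f a b e ≤ 0 ∧
      1 ≤ ∫ t in Icc a b, G (r⁻¹ • e t) := by
  have hba : 0 < b - a := sub_pos.2 hab
  have hr₀ := hA.pos_r₀
  obtain ⟨y, hy⟩ : ∃ y : Euc N, ‖y‖ = 1 := by
    have : Nonempty (Fin N) := ⟨⟨0, hN⟩⟩
    exact exists_norm_eq _ zero_le_one
  -- With this constant the parabola `q` vanishes at both endpoints and has norm `2 * r₀` at the
  -- midpoint, so part of the curve lies where `V` is negative.
  set k : ℝ := 8 * r₀ / (b - a) ^ 2 with hk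
  have hk0 : 0 < k := by positivity
  let w : ℝ → Euc N := fun t => (k * (a + b - 2 * t)) • y
  let q : ℝ → Euc N := fun t => (k * ((t - a) * (b - t))) • y
  have hwc : Continuous w := by fun_prop
  have hqc : Continuous q := by fun_prop
  have hprim : prim a w = q := by
    ext1 t
    have hd : ∀ s ∈ uIcc a t, HasDerivAt q (w s) s := fun s _ => by
      have h1 : HasDerivAt (fun s : ℝ => k * ((s - a) * (b - s))) (k * (a + b - 2 * s)) s := by
        have h2 := (((hasDerivAt_id s).sub_const a).mul ((hasDerivAt_id s).const_sub b)).const_mul k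
        refine h2.congr_deriv ?_
        simp only [id]
        ring
      exact h1.smul_const y
    rw [prim, intervalIntegral.integral_eq_sub_of_hasDerivAt hd (hwc.intervalIntegrable _ _)]
    simp [q]
  have hw0 : ∫ t in Icc a b, w t = 0 := by
    have h1 : prim a w b = 0 := by simp [hprim, q]
    rwa [prim, ← setIntegral_Icc_eq hab.le] at h1
  -- the weight measuring the negative part of the potential
  let W : ℝ → ℝ := fun t => max 0 (-V t (q t)) * min 1 (max 0 (‖q t‖ - r₀))
  have hWc : Continuous W :=
    (continuous_const.max (hA.contV_comp hqc).neg).mul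
      (continuous_const.min (continuous_const.max (hqc.norm.sub continuous_const)))
  have hW0 : ∀ t, 0 ≤ W t := fun t =>
    mul_nonneg (le_max_left _ _) (le_min zero_le_one (le_max_left _ _))
  have hWpos : 0 < ∫ t in Icc a b, W t := by
    rw [setIntegral_Icc_eq hab.le]
    refine intervalIntegral.integral_pos hab hWc.continuousOn (fun _ _ => hW0 _)
      ⟨(a + b) / 2, ⟨by linarith, by linarith⟩, ?_⟩
    have hq : ‖q ((a + b) / 2)‖ = 2 * r₀ := by
      simp only [q, norm_smul, hy, mul_one]
      have h1 : k * (((a + b) / 2 - a) * (b - (a + b) / 2)) = 2 * r₀ := by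
        rw [hk]
        field_simp
        ring
      rw [h1, Real.norm_of_nonneg (by positivity)]
    have h1 := hA.neg ((a + b) / 2) (q ((a + b) / 2)) (by rw [hq]; linarith)
    refine mul_pos (lt_max_of_lt_right (by linarith)) (lt_min one_pos (lt_max_of_lt_right ?_))
    rw [hq]
    linarith
  obtain ⟨B, hB0, hB⟩ := hA.bound r₀
  -- Where `‖q t‖ ≥ r₀`, the power bound makes the potential at most `-s ^ θV * W t`. Where `‖q t‖ <
  -- r₀` the weight vanishes, and the dilated point either has bounded potential or has entered the
  -- negative region.
  have hVle : ∀ s, 1 ≤ s → ∀ t, V t (s • q t) ≤ B - s ^ θV * W t := by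
    intro s hs t
    have hsp : 0 < s ^ θV := Real.rpow_pos_of_pos (by linarith) _
    rcases le_or_gt r₀ ‖q t‖ with hq | hq
    · have h1 := hA.potential_smul_le t hq hs
      have h2 := hA.neg t _ hq
      have h3 : W t ≤ -V t (q t) := by
        simp only [W]
        rw [max_eq_right (by linarith : 0 ≤ -V t (q t))]
        exact mul_le_of_le_one_right (by linarith) (min_le_left _ _)
      have h4 := mul_le_mul_of_nonneg_left h3 hsp.le
      linarith
    · have h1 : W t = 0 := by
        simp only [W]
        rw [max_eq_left (by linarith : ‖q t‖ - r₀ ≤ 0), min_eq_right zero_le_one, mul_zero]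
      rw [h1, mul_zero, sub_zero]
      rcases le_or_gt r₀ ‖s • q t‖ with h2 | h2
      · exact (hA.neg t _ h2).le.trans hB0
      · exact (le_abs_self _).trans (hB t _ h2.le).1
  set Q := ∫ t in Icc a b, F t (q t) (w t)
  set D := ∫ t in Icc a b, inner ℝ (f t) (q t)
  set ω := ∫ t in Icc a b, W t
  have hact : ∀ s, 1 ≤ s → action (fun t x v => F t x v + V t x) f a b (s • w)
      ≤ s ^ θF * Q + (B * (b - a) - s ^ θV * ω) + s * D := by
    intro s hs
    have hsq : Continuous fun t => s • q t := hqc.const_smul s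
    have hsw : Continuous fun t => s • w t := hwc.const_smul s
    have i1 : IntegrableOn (fun t => F t (s • q t) (s • w t)) (Icc a b) :=
      (hA.contF_comp hsq hsw).continuousOn.integrableOn_Icc
    have i2 : IntegrableOn (fun t => V t (s • q t)) (Icc a b) :=
      (hA.contV_comp hsq).continuousOn.integrableOn_Icc
    have i3 : IntegrableOn (fun t => F t (q t) (w t)) (Icc a b) :=
      (hA.contF_comp hqc hwc).continuousOn.integrableOn_Icc
    have i4 : IntegrableOn W (Icc a b) := hWc.continuousOn.integrableOn_Icc
    have i5 : IntegrableOn (fun t => s ^ θV * W t) (Icc a b) := i4.const_mul _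
    have i6 : IntegrableOn (fun _ : ℝ => B) (Icc a b) := integrable_const _
    have h1 : ∫ t in Icc a b, F t (s • q t) (s • w t) ≤ s ^ θF * Q := by
      rw [← integral_const_mul]
      exact integral_mono i1 (i3.const_mul _) fun t => hA.kinetic_smul_le t _ _ hs
    have h2 : ∫ t in Icc a b, V t (s • q t) ≤ B * (b - a) - s ^ θV * ω := by
      calc _ ≤ ∫ t in Icc a b, (B - s ^ θV * W t) := integral_mono i2 (i6.sub i5) (hVle s hs)
        _ = _ := by
          rw [integral_sub i6 i5, integral_const_mul]
          simp [hab.le, mul_comm, ω]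
    have h3 : ∫ t in Icc a b, inner ℝ (f t) (s • q t) = s * D := by
      simp only [inner_smul_right, integral_const_mul, D]
    unfold action
    simp only [prim_smul, hprim, Pi.smul_apply]
    rw [integral_add i1 i2, h3]
    linarith
  -- After division by `s ^ θV`, every term except the negative constant `-ω` tends to `0`, since
  -- `θV` exceeds both `θF` and `1`.
  have hlim : Tendsto (fun s : ℝ => s ^ (-(θV - θF)) * Q + s ^ (-θV) * (B * (b - a))
      + s ^ (-(θV - 1)) * D) atTop (𝓝 (0 * Q + 0 * (B * (b - a)) + 0 * D)) :=
    (((tendsto_rpow_neg_atTop (sub_pos.2 hA.lt)).mul_const Q).add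
      ((tendsto_rpow_neg_atTop (one_pos.trans hA.one_lt)).mul_const _)).add
      ((tendsto_rpow_neg_atTop (sub_pos.2 hA.one_lt)).mul_const D)
  simp only [zero_mul, add_zero] at hlim
  have hGw : IntegrableOn (fun t => G (r⁻¹ • w t)) (Icc a b) := hG.integrableOn_smul hwc _
  have hGpos : 0 < ∫ t in Icc a b, G (r⁻¹ • w t) := by
    rw [setIntegral_Icc_eq hab.le]
    have hc : Continuous fun t => G (r⁻¹ • w t) :=
      hG.continuous.comp (g := G) (f := fun t => r⁻¹ • w t) (by fun_prop)
    refine intervalIntegral.integral_pos hab hc.continuousOn (fun _ _ => hG.nonneg _)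
      ⟨a, ⟨le_rfl, hab.le⟩, hG.pos hΔ ?_⟩
    have hy0 : y ≠ 0 := by
      rintro rfl
      simp at hy
    refine smul_ne_zero (inv_ne_zero hr.ne') (smul_ne_zero (mul_ne_zero hk0.ne' ?_) hy0)
    linarith
  -- The last requirement places the endpoint beyond the barrier: convexity gives `G (s • x) ≥ s * G
  -- x` for `s ≥ 1`, so the scaled modular reaches `1`.
  obtain ⟨s, hs1, hs2, hs3⟩ := ((eventually_ge_atTop (1 : ℝ)).and
    ((hlim.eventually_lt_const hWpos).and
      (eventually_ge_atTop (∫ t in Icc a b, G (r⁻¹ • w t))⁻¹))).exists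
  have hs0 : 0 < s := by linarith
  refine ⟨s • w, hwc.const_smul s, ?_, ?_, ?_⟩
  · simp only [Pi.smul_apply, integral_smul, hw0, smul_zero]
  · refine (hact s hs1).trans ?_
    have h1 : s ^ θV * (s ^ (-(θV - θF)) * Q + s ^ (-θV) * (B * (b - a)) + s ^ (-(θV - 1)) * D)
        = s ^ θF * Q + B * (b - a) + s * D := by
      have e1 : s ^ θV * s ^ (-(θV - θF)) = s ^ θF := by
        rw [← Real.rpow_add hs0]
        congr 1
        ring
      have e2 : s ^ θV * s ^ (-θV) = 1 := by
        rw [← Real.rpow_add hs0, add_neg_cancel, Real.rpow_zero]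
      have e3 : s ^ θV * s ^ (-(θV - 1)) = s := by
        rw [← Real.rpow_add hs0, show θV + -(θV - 1) = 1 by ring, Real.rpow_one]
      linear_combination Q * e1 + B * (b - a) * e2 + D * e3
    have h2 := mul_le_mul_of_nonneg_left hs2.le (Real.rpow_pos_of_pos hs0 θV).le
    linarith
  · have h1 : s * (∫ t in Icc a b, G (r⁻¹ • w t)) ≤ ∫ t in Icc a b, G (r⁻¹ • (s • w) t) := by
      rw [← integral_const_mul]
      refine integral_mono (hGw.const_mul s) (hG.integrableOn_smul (hwc.const_smul s) _)
        fun t => ?_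
      have := hG.le_smul hs1 (r⁻¹ • w t)
      rw [smul_comm s r⁻¹ (w t)] at this
      exact this
    refine le_trans ?_ h1
    have h2 := mul_le_mul_of_nonneg_right hs3 hGpos.le
    rwa [inv_mul_cancel₀ hGpos.ne'] at h2

end IsAdmissible

/-! ### Continuation in time and verification of admissibility -/

/-- The projection of the real line onto `[a, b]`. -/
def clamp (a b t : ℝ) : ℝ := max a (min b t)

theorem clamp_mem {a b : ℝ} (hab : a ≤ b) (t : ℝ) : clamp a b t ∈ Icc a b :=
  ⟨le_max_left _ _, max_le hab (min_le_left _ _)⟩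

theorem clamp_of_mem {a b t : ℝ} (ht : t ∈ Icc a b) : clamp a b t = t := by
  rw [clamp, min_eq_right ht.2, max_eq_right ht.1]

theorem continuous_clamp (a b : ℝ) : Continuous (clamp a b) :=
  continuous_const.max (continuous_const.min continuous_id)

/-- Partial differentials of a function of class `C¹` on a strip. -/
theorem exists_partial_fderiv {W : Type*} [NormedAddCommGroup W] [NormedSpace ℝ W] {a b : ℝ}
    (hab : a < b) {Φ : ℝ → W → ℝ}
    (hΦ : ContDiffOn ℝ 1 (fun z : ℝ × W => Φ z.1 z.2) (Icc a b ×ˢ univ)) :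
    (Continuous fun z : ℝ × W => Φ (clamp a b z.1) z.2) ∧
    ∃ D : ℝ → W → (W →L[ℝ] ℝ), (Continuous fun z : ℝ × W => D z.1 z.2) ∧
      ∀ t w, HasFDerivAt (Φ (clamp a b t)) (D t w) w := by
  set S : Set (ℝ × W) := Icc a b ×ˢ univ
  have hS : UniqueDiffOn ℝ S := (uniqueDiffOn_Icc hab).prod uniqueDiffOn_univ
  have hp : Continuous fun z : ℝ × W => (clamp a b z.1, z.2) :=
    ((continuous_clamp a b).comp continuous_fst).prodMk continuous_snd
  have hmem : ∀ z : ℝ × W, (clamp a b z.1, z.2) ∈ S := fun z => ⟨clamp_mem hab.le _, mem_univ _⟩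
  have hd := hΦ.continuousOn_fderivWithin hS le_rfl
  -- The strip is a set of unique differentiability, so its derivative within is continuous up to
  -- the boundary times. The strip is unrestricted in the space variable, so composing with the
  -- inclusion of that variable gives a full partial derivative even at `t = a` and `t = b`.
  refine ⟨hΦ.continuousOn.comp_continuous hp hmem, fun t w =>
    (fderivWithin ℝ (fun z : ℝ × W => Φ z.1 z.2) S (clamp a b t, w)).comp
      (ContinuousLinearMap.inr ℝ ℝ W), (hd.comp_continuous hp hmem).clm_comp continuous_const,
    fun t w => ?_⟩
  have h1 := ((hΦ.differentiableOn one_ne_zero) _ (hmem (t, w))).hasFDerivWithinAt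
  exact h1.comp_hasFDerivAt (f := fun w : W => (clamp a b t, w)) w (hasFDerivAt_prodMk_right _ _)
    (Eventually.of_forall fun w => hmem (t, w))

/-- The hypotheses on a Lagrangian over `[a, b]`, continued by constants in time, give an
admissible Lagrangian. -/
theorem isAdmissible_clamp {a b : ℝ} (hab : a < b) {G : Euc N → ℝ} (hG : IsGFunction G)
    (hΔ : Delta2 G) {F : ℝ → Euc N → Euc N → ℝ} {V : ℝ → Euc N → ℝ}
    (hFC1 : ContDiffOn ℝ 1 (fun z : ℝ × Euc N × Euc N => F z.1 z.2.1 z.2.2) (Icc a b ×ˢ univ))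
    (hVC1 : ContDiffOn ℝ 1 (fun z : ℝ × Euc N => V z.1 z.2) (Icc a b ×ˢ univ))
    (hFconv : ∀ t ∈ Icc a b, ∀ x, ConvexOn ℝ univ (F t x))
    {α β : ℝ → ℝ} (hα : ContinuousOn α (Ici 0))
    (hβ0 : ∀ t ∈ Icc a b, 0 ≤ β t)
    (hFgrowth : ∀ t ∈ Icc a b, ∀ x v, |F t x v| ≤ α ‖x‖ * (β t + G v))
    (hFxgrowth : ∀ t ∈ Icc a b, ∀ x v,
      ‖gradient (fun y => F t y v) x‖ ≤ α ‖x‖ * (β t + G v))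
    (hFvgrowth : ∀ t ∈ Icc a b, ∀ x v,
      conj G (gradient (F t x) v) ≤ α ‖x‖ * (β t + conj G (gradient G v)))
    {θF : ℝ}
    (hFAR : ∀ t ∈ Icc a b, ∀ x v,
      inner ℝ (gradient (fun y => F t y v) x) x + inner ℝ (gradient (F t x) v) v ≤ θF * F t x v)
    {Λ : ℝ} (hΛ : 0 < Λ) (hFell : ∀ t ∈ Icc a b, ∀ x v, Λ * G v ≤ F t x v)
    (hFzero : ∀ t ∈ Icc a b, ∀ x, F t x 0 = 0)
    {θV r₀ : ℝ} (hθV1 : 1 < θV) (hθVF : θF < θV) (hr₀ : 0 < r₀)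
    (hVAR : ∀ t ∈ Icc a b, ∀ x, r₀ ≤ ‖x‖ → inner ℝ (gradient (V t) x) x ≤ θV * V t x)
    (hVneg : ∀ t ∈ Icc a b, ∀ x, r₀ ≤ ‖x‖ → V t x < 0) :
    IsAdmissible G (fun t => β (clamp a b t)) (fun t => F (clamp a b t))
      (fun t => V (clamp a b t)) (fun t x v => gradient (fun y => F (clamp a b t) y v) x)
      (fun t x v => gradient (F (clamp a b t) x) v) (fun t x => gradient (V (clamp a b t)) x)
      θF θV Λ r₀ := by
  have hcl := clamp_mem hab.le
  obtain ⟨hFc, DF, hDFc, hDF⟩ := exists_partial_fderiv (W := Euc N × Euc N) hab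
    (Φ := fun t w => F t w.1 w.2) hFC1
  obtain ⟨hVc, DV, hDVc, hDV⟩ := exists_partial_fderiv hab hVC1
  have hgx : ∀ t x v, HasGradientAt (fun y => F (clamp a b t) y v)
      ((InnerProductSpace.toDual ℝ (Euc N)).symm ((DF t (x, v)).comp
        (ContinuousLinearMap.inl ℝ _ _))) x := fun t x v =>
    ((hDF t (x, v)).comp (f := fun y => (y, v)) x (hasFDerivAt_prodMk_left x v)).hasGradientAt
  have hgv : ∀ t x v, HasGradientAt (F (clamp a b t) x)
      ((InnerProductSpace.toDual ℝ (Euc N)).symm ((DF t (x, v)).comp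
        (ContinuousLinearMap.inr ℝ _ _))) v := fun t x v =>
    ((hDF t (x, v)).comp (f := fun y => (x, y)) v (hasFDerivAt_prodMk_right x v)).hasGradientAt
  have hgV : ∀ t x, HasGradientAt (V (clamp a b t))
      ((InnerProductSpace.toDual ℝ (Euc N)).symm (DV t x)) x := fun t x => (hDV t x).hasGradientAt
  have hsymm := (InnerProductSpace.toDual ℝ (Euc N)).symm.continuous
  have hDFc' : Continuous fun z : ℝ × Euc N × Euc N => DF z.1 (z.2.1, z.2.2) := hDFc
  refine
    { contF := hFc
      contFx := ?_
      contFv := ?_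
      contV := hVc
      contVx := ?_
      hasDerivAtF := fun t x v φ h => ?_
      hasDerivAtV := fun t x φ => ?_
      tangent := fun t x v w => ?_
      nonneg := fun t => hβ0 _ (hcl t)
      growth := fun R => ?_
      bound := fun R => ?_
      homF := fun t => hFAR _ (hcl t)
      lower := fun t => hFell _ (hcl t)
      zero := fun t => hFzero _ (hcl t)
      homV := fun t => hVAR _ (hcl t)
      neg := fun t => hVneg _ (hcl t)
      one_lt := hθV1
      lt := hθVF
      pos_Λ := hΛ
      pos_r₀ := hr₀ }
  · simp only [(hgx _ _ _).gradient]
    exact hsymm.comp (hDFc'.clm_comp continuous_const)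
  · simp only [(hgv _ _ _).gradient]
    exact hsymm.comp (hDFc'.clm_comp continuous_const)
  · simp only [(hgV _ _).gradient]
    exact hsymm.comp hDVc
  · have h1 : HasDerivAt (fun s : ℝ => (x + s • φ, v + s • h)) (φ, h) 0 := by
      have h2 : ∀ y z : Euc N, HasDerivAt (fun s : ℝ => y + s • z) z 0 := fun y z => by
        simpa using ((hasDerivAt_id (0 : ℝ)).smul_const z).const_add y
      exact (h2 x φ).prodMk (h2 v h)
    have h3 := HasFDerivAt.comp_hasDerivAt (0 : ℝ) (by simpa using hDF t (x, v)) h1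
    refine h3.congr_deriv ?_
    rw [(hgx t x v).gradient, (hgv t x v).gradient, InnerProductSpace.toDual_symm_apply,
      InnerProductSpace.toDual_symm_apply]
    simp only [ContinuousLinearMap.comp_apply, ContinuousLinearMap.inl_apply,
      ContinuousLinearMap.inr_apply, ← map_add, Prod.mk_add_mk, add_zero, zero_add]
  · have h1 : HasDerivAt (fun s : ℝ => x + s • φ) φ 0 := by
      simpa using ((hasDerivAt_id (0 : ℝ)).smul_const φ).const_add x
    have h3 := HasFDerivAt.comp_hasDerivAt (0 : ℝ) (by simpa using hDV t x) h1
    refine h3.congr_deriv ?_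
    rw [(hgV t x).gradient, InnerProductSpace.toDual_symm_apply]
  · have h1 := hgv t x w
    rw [← h1.gradient] at h1
    exact ConvexOn.inner_gradient_le (hFconv _ (hcl t) x) h1 v
  -- On positions bounded by `R` the factor `α ‖x‖` is bounded by compactness, and
  -- `conj_gradient_le` replaces `G*(∇G v)` by a multiple of `G v`.
  · obtain ⟨c, hc⟩ := (isCompact_Icc (a := (0 : ℝ)) (b := R)).bddAbove_image
      (hα.mono Icc_subset_Ici_self)
    obtain ⟨K, hK, hKle⟩ := hG.conj_gradient_le hΔ
    have hαc : ∀ x : Euc N, ‖x‖ ≤ R → α ‖x‖ ≤ |c| := fun x hx =>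
      (hc (mem_image_of_mem α ⟨norm_nonneg x, hx⟩)).trans (le_abs_self c)
    refine ⟨|c| * (1 + K), by positivity, fun t x v hx => ?_⟩
    have hb := hβ0 _ (hcl t)
    have hg := hG.nonneg v
    have h1 : α ‖x‖ * (β (clamp a b t) + G v) ≤ |c| * (1 + K) * (β (clamp a b t) + G v) := by
      refine mul_le_mul_of_nonneg_right ((hαc x hx).trans ?_) (by positivity)
      exact le_mul_of_one_le_right (abs_nonneg _) (by linarith)
    refine ⟨(hFgrowth _ (hcl t) x v).trans h1, (hFxgrowth _ (hcl t) x v).trans h1,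
      (hFvgrowth _ (hcl t) x v).trans ?_⟩
    rw [mul_assoc |c|]
    refine mul_le_mul (hαc x hx) ?_ ?_ (abs_nonneg _)
    · have := hKle v
      have : 0 ≤ K * β (clamp a b t) := by positivity
      linarith
    · have := hG.conj_nonneg (gradient G v)
      positivity
  · have hgc : Continuous fun z : ℝ × Euc N => gradient (V (clamp a b z.1)) z.2 := by
      simp only [(hgV _ _).gradient]
      exact hsymm.comp hDVc
    obtain ⟨c₁, hc₁⟩ := (isCompact_Icc.prod (isCompact_closedBall (0 : Euc N)
      R)).exists_bound_of_continuousOn (s := Icc a b ×ˢ _) hVc.continuousOn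
    obtain ⟨c₂, hc₂⟩ := (isCompact_Icc.prod (isCompact_closedBall (0 : Euc N)
      R)).exists_bound_of_continuousOn (s := Icc a b ×ˢ _) hgc.continuousOn
    refine ⟨max 0 (max c₁ c₂), le_max_left _ _, fun t x hx => ?_⟩
    have hm : (clamp a b t, x) ∈ Icc a b ×ˢ Metric.closedBall (0 : Euc N) R :=
      ⟨hcl t, by simpa using hx⟩
    have hcc : clamp a b (clamp a b t) = clamp a b t := clamp_of_mem (hcl t)
    have h1 := hc₁ _ hm
    have h2 := hc₂ _ hm
    simp only [hcc] at h1 h2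
    exact ⟨h1.trans ((le_max_left _ _).trans (le_max_right _ _)),
      h2.trans ((le_max_right _ _).trans (le_max_right _ _))⟩

/-! ### From the weak to the almost everywhere Euler-Lagrange equation -/

/-- A critical point with respect to continuous velocities of zero mean solves the
Euler-Lagrange equation. -/
theorem exists_momentum {a b : ℝ} (hab : a < b) {p q f : ℝ → Euc N}
    (hp : IntegrableOn p (Icc a b)) (hq : IntegrableOn q (Icc a b)) (hf : IntegrableOn f (Icc a b))
    (h0 : ∀ h : ℝ → Euc N, Continuous h → ∫ t in Icc a b, h t = 0 →
      (∫ t in Icc a b, (inner ℝ (q t) (prim a h t) + inner ℝ (p t) (h t)))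
        + ∫ t in Icc a b, inner ℝ (f t) (prim a h t) = 0) :
    ∃ P : ℝ → Euc N, AbsolutelyContinuousOnInterval P a b ∧
      (∀ᵐ t ∂volume.restrict (Icc a b), P t = p t) ∧
      ∀ᵐ t ∂volume.restrict (Icc a b), HasDerivAt P (q t + f t) t := by
  have hqf : IntegrableOn (fun t => q t + f t) (Icc a b) := hq.add hf
  obtain ⟨c, hc⟩ := ae_eq_prim_of_integral_eq_zero hab hp hqf fun h hh hh0 => by
    rw [← h0 h hh hh0]
    have hφ := (continuous_prim (a := a) hh).continuousOn (s := Icc a b)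
    have i1 : IntegrableOn (fun t => (inner ℝ (q t) (prim a h t) + inner ℝ (p t) (h t) : ℝ))
      (Icc a b) := (integrableOn_inner hq hφ).add (integrableOn_inner hp hh.continuousOn)
    rw [← integral_add i1 (integrableOn_inner hf hφ)]
    refine integral_congr_ae (Eventually.of_forall fun t => ?_)
    simp only [inner_add_left]
    ring
  refine ⟨fun t => c + prim a (fun t => q t + f t) t, ?_, ?_, ?_⟩
  · have h1 := prim_absolutelyContinuous hab.le hqf
    unfold AbsolutelyContinuousOnInterval at h1 ⊢
    simpa only [dist_add_left] using h1
  · filter_upwards [hc] with t ht using ht.symm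
  · filter_upwards [ae_hasDerivAt_prim hab.le hqf] with t ht using ht.const_add c

end AnisoMP

end

/-! ### The main theorem -/

theorem theoremB
    {N : ℕ} (hN : 1 ≤ N) {a b : ℝ} (hab : a < b)
    -- the G-function
    (G : AnisoMP.Euc N → ℝ) (hG : AnisoMP.IsGFunction G)
    (hΔ : AnisoMP.Delta2 G) (hnab : AnisoMP.Nabla2 G)
    (F : ℝ → AnisoMP.Euc N → AnisoMP.Euc N → ℝ) (V : ℝ → AnisoMP.Euc N → ℝ)
    (f : ℝ → AnisoMP.Euc N)
    -- `F` and `V` are of class `C^1`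
    (hFC1 : ContDiffOn ℝ 1 (fun z : ℝ × AnisoMP.Euc N × AnisoMP.Euc N => F z.1 z.2.1 z.2.2)
      (Icc a b ×ˢ univ))
    (hVC1 : ContDiffOn ℝ 1 (fun z : ℝ × AnisoMP.Euc N => V z.1 z.2) (Icc a b ×ˢ univ))
    -- convexity and growth of `F`
    (hFconv : ∀ t ∈ Icc a b, ∀ x, ConvexOn ℝ univ (F t x))
    (α β : ℝ → ℝ) (hα : ContinuousOn α (Ici 0)) (hα0 : ∀ s, 0 ≤ s → 0 ≤ α s)
    (hβ : IntegrableOn β (Icc a b)) (hβ0 : ∀ t ∈ Icc a b, 0 ≤ β t)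
    (hFgrowth : ∀ t ∈ Icc a b, ∀ x v, |F t x v| ≤ α ‖x‖ * (β t + G v))
    (hFxgrowth : ∀ t ∈ Icc a b, ∀ x v,
      ‖gradient (fun y => F t y v) x‖ ≤ α ‖x‖ * (β t + G v))
    (hFvgrowth : ∀ t ∈ Icc a b, ∀ x v,
      AnisoMP.conj G (gradient (F t x) v) ≤ α ‖x‖ * (β t + AnisoMP.conj G (gradient G v)))
    -- Ambrosetti-Rabinowitz condition, ellipticity and normalization of `F`
    (θF : ℝ) (hθF : 0 < θF)
    (hFAR : ∀ t ∈ Icc a b, ∀ x v,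
      inner ℝ (gradient (fun y => F t y v) x) x + inner ℝ (gradient (F t x) v) v ≤ θF * F t x v)
    (Lam : ℝ) (hLam : 0 < Lam) (hFell : ∀ t ∈ Icc a b, ∀ x v, Lam * G v ≤ F t x v)
    (hFzero : ∀ t ∈ Icc a b, ∀ x, F t x 0 = 0)
    -- the potential `V`
    (θV r₀ : ℝ) (hθV1 : 1 < θV) (hθVF : θF < θV) (hr₀ : 0 < r₀)
    (hVAR : ∀ t ∈ Icc a b, ∀ x, r₀ ≤ ‖x‖ → inner ℝ (gradient (V t) x) x ≤ θV * V t x)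
    (hVzero : ∫ t in a..b, V t 0 = 0)
    (ρ₀ : ℝ) (hρ₀ : 0 < ρ₀) (g : ℝ → ℝ) (hg : IntegrableOn g (Icc a b))
    (hVnear : ∀ t ∈ Icc a b, ∀ x, ‖x‖ ≤ ρ₀ → -g t ≤ V t x)
    (hVneg : ∀ t ∈ Icc a b, ∀ x, r₀ ≤ ‖x‖ → V t x < 0)
    -- the forcing term
    (hf : AnisoMP.MemOrlicz (AnisoMP.conj G) a b f)
    -- the embedding constant and the main inequality
    (C : ℝ) (hC : AnisoMP.IsEmbeddingConstant G a b C)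
    (hB : (∫ t in a..b, g t) + 2 * (b - a) * AnisoMP.luxNorm (AnisoMP.conj G) a b f * (ρ₀ / C) <
      Lam * (if ρ₀ ≤ C then (ρ₀ / C) ^ AnisoMP.qIndex G else (ρ₀ / C) ^ AnisoMP.pIndex G)) :
    ∃ u : ℝ → AnisoMP.Euc N,
      AnisoMP.IsSolution G (AnisoMP.lagrangian F V f) a b u ∧ ∃ t ∈ Icc a b, u t ≠ 0 := by
  have hba : 0 < b - a := sub_pos.2 hab
  have hA := AnisoMP.isAdmissible_clamp hab hG hΔ hFC1 hVC1 hFconv hα hβ0 hFgrowth hFxgrowth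
    hFvgrowth hFAR hLam hFell hFzero hθV1 hθVF hr₀ hVAR hVneg
  have hL := hA.isConvexLagrangian hG
  have hfi := hG.integrableOn_of_memOrlicz_conj hf
  have hr : 0 < ρ₀ / C := div_pos hρ₀ hC.1
  have hβ' : IntegrableOn (fun t => β (AnisoMP.clamp a b t)) (Icc a b) :=
    hβ.congr_fun (fun t ht => by simp only [AnisoMP.clamp_of_mem ht]) measurableSet_Icc
  have hV0 : ∫ t in Icc a b, V (AnisoMP.clamp a b t) 0 = 0 := by
    rw [setIntegral_congr_fun (g := fun t => V t 0) measurableSet_Icc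
      fun t ht => by simp only [AnisoMP.clamp_of_mem ht], AnisoMP.setIntegral_Icc_eq hab.le, hVzero]
  obtain ⟨κ, hκ, c, hAR⟩ := hA.exists_modular_le hG hab hfi
  obtain ⟨c₀, hc₀, hbar⟩ := hA.exists_barrier hG hab hf hC hρ₀ hg
    (fun t ht x hx => by
      rw [AnisoMP.clamp_of_mem ht]
      exact hVnear t ht x hx)
    -- The condition `ρ₀ ≤ C` means that the scale `ρ₀ / C` is at most `1`, which selects the upper
    -- index; otherwise the dilation bound with the lower index applies.
    (m := if ρ₀ ≤ C then (ρ₀ / C) ^ AnisoMP.qIndex G else (ρ₀ / C) ^ AnisoMP.pIndex G)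
    (fun x => by
      split_ifs with h
      · exact hG.rpow_qIndex_mul_le hΔ hr ((div_le_one hC.1).2 h) x
      · exact hG.rpow_pIndex_mul_le hΔ ((one_le_div hC.1).2 (not_le.1 h).le) x)
    (by rwa [AnisoMP.setIntegral_Icc_eq hab.le])
  obtain ⟨e, hec, he0, he, he1⟩ := hA.exists_action_nonpos hG hΔ hN hab f hr
  obtain ⟨u, huc, hac, hua, hub, hmod, hcrit, hlev⟩ :=
    AnisoMP.exists_critical_point hL hG hΔ hab hβ' hfi hκ (inv_nonneg.2 (by linarith)) hc₀
      (fun v hv _ => hAR v hv) hbar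
    (hA.action_zero hV0).le hec he0 he he1
  have hdm : AEStronglyMeasurable (deriv u) (volume.restrict (Icc a b)) :=
    (stronglyMeasurable_deriv u).aestronglyMeasurable
  obtain ⟨R, hR⟩ := isCompact_Icc.exists_bound_of_continuousOn (s := Icc a b) huc.continuousOn
  obtain ⟨hX, hP⟩ := hL.integrable_gradients hβ' huc.aestronglyMeasurable hdm hR hmod
  obtain ⟨p, hpac, hpeq, hpder⟩ := AnisoMP.exists_momentum hab hP hX hfi hcrit
  refine ⟨u, ⟨⟨⟨hac, hG.memOrlicz_of_continuous huc, hdm, ?_⟩, hua, hub⟩, p, hpac, ?_, ?_⟩, ?_⟩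
  · exact lt_top_iff_ne_top.2 ((lintegral_ofReal_ne_top_iff_integrable hmod.aestronglyMeasurable
      (Eventually.of_forall fun t => hG.nonneg _)).2 hmod)
  · filter_upwards [hpeq, ae_restrict_mem measurableSet_Icc] with t ht htI
    rw [ht, AnisoMP.clamp_of_mem htI]
    simp only [gradient, AnisoMP.lagrangian, fderiv_add_const]
  · filter_upwards [hpder, ae_restrict_mem measurableSet_Icc] with t ht htI
    convert ht using 1
    obtain ⟨-, DF, -, hDF⟩ := AnisoMP.exists_partial_fderiv (W := AnisoMP.Euc N × AnisoMP.Euc N) hab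
      (Φ := fun t w => F t w.1 w.2) hFC1
    obtain ⟨-, DV, -, hDV⟩ := AnisoMP.exists_partial_fderiv hab hVC1
    rw [AnisoMP.clamp_of_mem htI]
    have h1 : DifferentiableAt ℝ (fun y => F t y (deriv u t)) (u t) := by
      have h := ((hDF t (u t, deriv u t)).comp (f := fun y => (y, deriv u t)) (u t)
        (hasFDerivAt_prodMk_left _ _)).differentiableAt
      rwa [AnisoMP.clamp_of_mem htI] at h
    have h2 : DifferentiableAt ℝ (V t) (u t) := by
      have h := (hDV t (u t)).differentiableAt
      rwa [AnisoMP.clamp_of_mem htI] at h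
    refine HasGradientAt.gradient ?_
    have h3 : HasFDerivAt (fun x => (inner ℝ (f t) x : ℝ))
        (InnerProductSpace.toDual ℝ (AnisoMP.Euc N) (f t)) (u t) :=
      (InnerProductSpace.toDual ℝ (AnisoMP.Euc N) (f t)).hasFDerivAt
    have h4 := (h1.hasGradientAt.hasFDerivAt.add h2.hasGradientAt.hasFDerivAt).add h3
    rw [← map_add, ← map_add] at h4
    exact h4
  -- If `u` vanished on `[a, b]`, its action would be the integral of `V t 0`, which is `0`, against
  -- the level `c₀ > 0`.
  · by_contra! hzero
    have h1 : (∫ t in Icc a b, (F (AnisoMP.clamp a b t) (u t) (deriv u t)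
          + V (AnisoMP.clamp a b t) (u t)))
        = ∫ t in Icc a b, V (AnisoMP.clamp a b t) 0 := by
      -- The two-sided derivative at the endpoints also sees values of `u` outside `[a, b]`, so the
      -- comparison is made on the open interval.
      rw [integral_Icc_eq_integral_Ioo, integral_Icc_eq_integral_Ioo]
      refine setIntegral_congr_fun measurableSet_Ioo fun t ht => ?_
      have h2 : deriv u t = 0 := by
        have h3 : u =ᶠ[𝓝 t] fun _ => 0 := by
          filter_upwards [Ioo_mem_nhds ht.1 ht.2] with s hs using hzero s (Ioo_subset_Icc_self hs)
        rw [h3.deriv_eq, deriv_const]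
      simp only [h2, hzero t (Ioo_subset_Icc_self ht), hA.zero, zero_add]
    have h2 : ∫ t in Icc a b, inner ℝ (f t) (u t) = ∫ t in Icc a b, (0 : ℝ) :=
      setIntegral_congr_fun measurableSet_Icc fun t ht => by
        simp only [hzero t ht, inner_zero_right]
    rw [h1, hV0, h2, integral_zero, add_zero] at hlev
    linarith
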